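/- Let $S$ be a compact connected Riemann surface. An exp-algebraic structure $\mathcal H=\{[h_1],\dots,[h_n]\}$ on $S$ consists of finitely many distinct points $p_1,\dots,p_n\in S$ ($n\ge 0$) and, at each $p_i$, a class $[h_i]\in\mathcal M_{p_i}/\mathcal O_{p_i}$ of germs of meromorphic functions modulo germs of holomorphic functions, represented by a germ $h_i$ with a pole at $p_i$. Write $S'=S\setminus\{p_1,\dots,p_n\}$. Choose pairwise disjoint open neighbourhoods $B_i$ of the $p_i$ such that $h_i$ is holomorphic on $B_i\setminus\{p_i\}$. Let $L_{\mathcal H}$ be the holomorphic line bundle on $S$ given by the cover $\{S',B_1,\dots,B_n\}$ and the transition functions $e^{-h_i}$ from the trivialization over $S'$ to the one over $B_i$. Let $s_{\mathcal H}$ be the nowhere vanishing holomorphic section of $L_{\mathcal H}$ over $S'$ which is $1$ in the trivialization over $S'$ (hence $e^{-h_i}$ in the trivialization over $B_i$), and let $\nabla_{\mathcal H}$ be the meromorphic connection on $L_{\mathcal H}$ with $\nabla_{\mathcal H}s_{\mathcal H}=0$, i.e. $\nabla_{\mathcal H}(f s_{\mathcal H})=df\otimes s_{\mathcal H}$. **Proposition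 3.2.** (1) For every exp-algebraic structure $\mathcal H$ on $S$ and every choice of the $B_i$ and of representatives $h_i$, the line bundle $L_{\mathcal H}$ has degree zero, the poles of $\nabla_{\mathcal H}$ are exactly $p_1,\dots,p_n$ and all have order at least two, all residues of $\nabla_{\mathcal H}$ are zero, and $\nabla_{\mathcal H}$ has trivial monodromy on $S'$; the isomorphism class of $(L_{\mathcal H},\nabla_{\mathcal H})$ depends only on $\mathcal H$. (2) The assignment $\mathcal H\mapsto(L_{\mathcal H},\nabla_{\mathcal H})$ is a bijection from the set of exp-algebraic structures on $S$ onto the set of isomorphism classes of pairs $(L,\nabla)$, where $L$ is a holomorphic line bundle of degree zero on $S$ and $\nabla$ is a meromorphic connection on $L$ all of whose poles have order at least two, all of whose residues are zero, and whose monodromy on the complement of the poles is trivial. -/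

import Mathlib

open Bundle Set Filter Topology Complex
open scoped Manifold ContDiff

noncomputable section

universe u

namespace ExpAlg

/-! ### Germs of meromorphic functions and exp-algebraic structures

Throughout, `S` is a Riemann surface: a manifold modelled on `ℂ` with holomorphic transition maps.
-/

section Germs

variable {S : Type u} [TopologicalSpace S] [ChartedSpace ℂ S]

/-- `f` is meromorphic at `p` (read in the chart at `p`). -/
def MeromorphicFunAt (p : S) (f : S → ℂ) : Prop :=
  MeromorphicAt (fun z => f ((chartAt ℂ p).symm z)) (chartAt ℂ p p)

/-- `f` is holomorphic at `p` (read in the chart at `p`). -/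
def HolomorphicFunAt (p : S) (f : S → ℂ) : Prop :=
  AnalyticAt ℂ (fun z => f ((chartAt ℂ p).symm z)) (chartAt ℂ p p)

/-- The space `𝓜_p` of germs at `p` of meromorphic functions. A meromorphic function is determined
by its values off its poles, so its germ at `p` is taken along punctured neighbourhoods of `p`. -/
def meromorphicGerms (p : S) : Submodule ℂ (Germ (𝓝[≠] p) ℂ) where
  carrier := {g | ∃ f : S → ℂ, MeromorphicFunAt p f ∧ (f : Germ (𝓝[≠] p) ℂ) = g}
  add_mem' := by
    rintro _ _ ⟨f, hf, rfl⟩ ⟨g, hg, rfl⟩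
    exact ⟨f + g, MeromorphicAt.add hf hg, rfl⟩
  zero_mem' := ⟨fun _ => 0, MeromorphicAt.const 0 _, rfl⟩
  smul_mem' := by
    rintro c _ ⟨f, hf, rfl⟩
    exact ⟨c • f, MeromorphicAt.const_smul hf c, rfl⟩

/-- The subspace `𝓞_p ⊆ 𝓜_p` of germs at `p` of holomorphic functions. -/
def holomorphicGerms (p : S) : Submodule ℂ (meromorphicGerms p) where
  carrier := {g | ∃ f : S → ℂ, HolomorphicFunAt p f ∧
    (f : Germ (𝓝[≠] p) ℂ) = (g : Germ (𝓝[≠] p) ℂ)}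
  add_mem' := by
    rintro a b ⟨f, hf, hfa⟩ ⟨g, hg, hgb⟩
    refine ⟨f + g, AnalyticAt.add hf hg, ?_⟩
    rw [Submodule.coe_add, ← hfa, ← hgb]; rfl
  zero_mem' := ⟨fun _ => 0, analyticAt_const, rfl⟩
  smul_mem' := by
    rintro c a ⟨f, hf, hfa⟩
    refine ⟨c • f, AnalyticAt.const_smul hf, ?_⟩
    rw [Submodule.coe_smul, ← hfa]; rfl

/-- The quotient `𝓜_p / 𝓞_p`. -/
abbrev PrincipalParts (p : S) : Type u := meromorphicGerms p ⧸ holomorphicGerms p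

/-- The class `[f] ∈ 𝓜_p / 𝓞_p` of a function meromorphic at `p`. -/
def principalPart (p : S) (f : S → ℂ) (hf : MeromorphicFunAt p f) : PrincipalParts p :=
  Submodule.Quotient.mk ⟨(f : Germ (𝓝[≠] p) ℂ), f, hf, rfl⟩

end Germs

/-- An exp-algebraic structure `𝓗 = {[h₁], …, [hₙ]}` on `S`: finitely many points `p₁, …, pₙ` and,
at each `pᵢ`, the class modulo `𝓞_{pᵢ}` of the germ of a meromorphic function `hᵢ` with a pole at
`pᵢ`. It is recorded as the finitely supported family of classes which is `[hᵢ]` at `pᵢ` and `0`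
elsewhere; a class is nonzero precisely if its representatives have a pole. -/
@[ext] structure ExpAlgStructure (S : Type u) [TopologicalSpace S] [ChartedSpace ℂ S] where
  part : ∀ p : S, PrincipalParts p
  finite_support : {p : S | part p ≠ 0}.Finite

/-- The punctures `p₁, …, pₙ`. -/
def ExpAlgStructure.punctures {S : Type u} [TopologicalSpace S] [ChartedSpace ℂ S]
    (H : ExpAlgStructure S) : Set S :=
  {p : S | H.part p ≠ 0}

/-! ### Holomorphic line bundles, meromorphic sections, degree -/

/-- A holomorphic line bundle on `S`: a holomorphic vector bundle with model fibre `ℂ`. -/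
structure HolomorphicLineBundle (S : Type u) [TopologicalSpace S] [ChartedSpace ℂ S] where
  Fiber : S → Type
  [addCommGroup : ∀ x, AddCommGroup (Fiber x)]
  [module : ∀ x, Module ℂ (Fiber x)]
  [topology : ∀ x, TopologicalSpace (Fiber x)]
  [isTopologicalAddGroup : ∀ x, IsTopologicalAddGroup (Fiber x)]
  [continuousSMul : ∀ x, ContinuousSMul ℂ (Fiber x)]
  [totalTopology : TopologicalSpace (TotalSpace ℂ Fiber)]
  [fiberBundle : FiberBundle ℂ Fiber]
  [vectorBundle : VectorBundle ℂ ℂ Fiber]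
  [holomorphic : ContMDiffVectorBundle ω ℂ Fiber 𝓘(ℂ)]

namespace HolomorphicLineBundle

attribute [instance] addCommGroup module topology isTopologicalAddGroup continuousSMul
  totalTopology fiberBundle vectorBundle holomorphic

variable {S : Type u} [TopologicalSpace S] [ChartedSpace ℂ S] (L : HolomorphicLineBundle S)

/-- The section `s` near `p`, in the chart and in the trivialization of `L` at `p`. -/
def sectionCoeff (s : ∀ x, L.Fiber x) (p : S) (z : ℂ) : ℂ :=
  (trivializationAt ℂ L.Fiber p ⟨(chartAt ℂ p).symm z, s ((chartAt ℂ p).symm z)⟩).2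

/-- `s` is a meromorphic section of `L`. (Its values at the poles are irrelevant.) -/
def IsMeromorphicSection (s : ∀ x, L.Fiber x) : Prop :=
  ∀ p : S, MeromorphicAt (L.sectionCoeff s p) (chartAt ℂ p p)

/-- The order at `p` of a meromorphic section; it is `⊤` if the section vanishes near `p`. -/
def sectionOrder (s : ∀ x, L.Fiber x) (p : S) : WithTop ℤ :=
  meromorphicOrderAt (L.sectionCoeff s p) (chartAt ℂ p p)

/-- `L` has degree `d`: the divisor of a nonzero meromorphic section of `L` has degree `d`.
On a compact Riemann surface such a section exists and the degree of its divisor does not depend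
on it. -/
def HasDegree (d : ℤ) : Prop :=
  ∀ s : (∀ x, L.Fiber x), L.IsMeromorphicSection s → (∀ p, L.sectionOrder s p ≠ ⊤) →
    ∑ᶠ p : S, (L.sectionOrder s p).untop₀ = d

/-- The frame over a neighbourhood of `p` given by the trivialization of `L` at `p`. -/
def frame (p : S) (x : S) : L.Fiber x := (trivializationAt ℂ L.Fiber p).symm x 1

/-- A section of `L` is complex differentiable at `x`. -/
def SectionDiffAt (s : ∀ x, L.Fiber x) (x : S) : Prop :=
  MDifferentiableAt 𝓘(ℂ) (𝓘(ℂ).prod 𝓘(ℂ)) (fun y => (⟨y, s y⟩ : TotalSpace ℂ L.Fiber)) x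

/-- For an operator `D` taking sections `s` of `L` to `L`-valued `1`-forms `D s`, the function `a`
such that `D e = a dz ⊗ e` near `p`, where `e` is the frame of `L` at `p` and `z` is the chart at
`p`: the coefficient of the connection `1`-form. -/
def connectionCoeff (D : (∀ x, L.Fiber x) → ∀ x, TangentSpace 𝓘(ℂ) x →L[ℂ] L.Fiber x)
    (p : S) (z : ℂ) : ℂ :=
  (trivializationAt ℂ L.Fiber p ⟨(chartAt ℂ p).symm z,
    D (L.frame p) ((chartAt ℂ p).symm z)
      (mfderiv 𝓘(ℂ) 𝓘(ℂ) (chartAt ℂ p).symm z (1 : ℂ))⟩).2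

/-- The order at `p` of the connection `1`-form (negative at a pole). -/
def connectionOrder (D : (∀ x, L.Fiber x) → ∀ x, TangentSpace 𝓘(ℂ) x →L[ℂ] L.Fiber x)
    (p : S) : WithTop ℤ :=
  meromorphicOrderAt (L.connectionCoeff D p) (chartAt ℂ p p)

end HolomorphicLineBundle

/-! ### Meromorphic connections -/

/-- `f` has residue `c` at `z₀`: `∮ f dz = 2πi c` over all small circles around `z₀`. -/
def HasResidueAt (f : ℂ → ℂ) (z₀ c : ℂ) : Prop :=
  ∀ᶠ r : ℝ in 𝓝[>] 0, (∮ z in C(z₀, r), f z) = 2 * Real.pi * I * c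

/-- A meromorphic connection on `L`: its connection `1`-forms are meromorphic, it has finitely many
poles, and off the poles it is a covariant derivative with holomorphic connection `1`-forms.
What `toFun` does at the poles is irrelevant. -/
structure MeromorphicConnection {S : Type u} [TopologicalSpace S] [ChartedSpace ℂ S]
    (L : HolomorphicLineBundle S) where
  toFun : (∀ x, L.Fiber x) → ∀ x, TangentSpace 𝓘(ℂ) x →L[ℂ] L.Fiber x
  meromorphic : ∀ p : S, MeromorphicAt (L.connectionCoeff toFun p) (chartAt ℂ p p)
  finite_poles : {p : S | L.connectionOrder toFun p < 0}.Finite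
  holomorphic : ∀ p : S, ¬ L.connectionOrder toFun p < 0 →
    AnalyticAt ℂ (L.connectionCoeff toFun p) (chartAt ℂ p p)
  isCovariantDerivativeOn :
    IsCovariantDerivativeOn ℂ toFun {p : S | L.connectionOrder toFun p < 0}ᶜ

namespace MeromorphicConnection

variable {S : Type u} [TopologicalSpace S] [ChartedSpace ℂ S] {L : HolomorphicLineBundle S}
  (D : MeromorphicConnection L)

/-- The set of poles of the connection. -/
def poles : Set S := {p : S | L.connectionOrder D.toFun p < 0}

/-- All poles of the connection `1`-form have order at least two. -/
def PolesOrderAtLeastTwo : Prop := ∀ p ∈ D.poles, L.connectionOrder D.toFun p ≤ (-2 : ℤ)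

/-- All residues of the connection vanish. -/
def ResiduesZero : Prop :=
  ∀ p ∈ D.poles, HasResidueAt (L.connectionCoeff D.toFun p) (chartAt ℂ p p) 0

/-- `Γ` is a parallel family of vectors of `L` along the path `t ↦ (Γ t).proj`: locally it is given
by a horizontal section of `L`. -/
def IsParallelAlong (Γ : unitInterval → TotalSpace ℂ L.Fiber) : Prop :=
  ∀ t, ∃ s : ∀ x, L.Fiber x,
    (∀ᶠ y in 𝓝 (Γ t).proj, L.SectionDiffAt s y ∧ D.toFun s y = 0) ∧
      ∀ᶠ t' in 𝓝 t, (Γ t').snd = s (Γ t').proj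

/-- Trivial monodromy: parallel transport along a loop avoiding the poles is the identity. -/
def HasTrivialMonodromy : Prop :=
  ∀ Γ : unitInterval → TotalSpace ℂ L.Fiber,
    Continuous (fun t => (Γ t).proj) → (∀ t, (Γ t).proj ∉ D.poles) →
    D.IsParallelAlong Γ → (Γ 0).proj = (Γ 1).proj → Γ 0 = Γ 1

end MeromorphicConnection

/-- A pair `(L, ∇)`. -/
structure LineBundleWithConnection (S : Type u) [TopologicalSpace S] [ChartedSpace ℂ S] where
  bundle : HolomorphicLineBundle S
  conn : MeromorphicConnection bundle

namespace LineBundleWithConnection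

variable {S : Type u} [TopologicalSpace S] [ChartedSpace ℂ S]

/-- An isomorphism of pairs `(L, ∇) ≅ (L', ∇')`: a biholomorphic bundle isomorphism over the
identity of `S` which intertwines the connections. -/
structure Iso (X Y : LineBundleWithConnection S) where
  equiv : ∀ x, X.bundle.Fiber x ≃L[ℂ] Y.bundle.Fiber x
  holomorphic : ContMDiff (𝓘(ℂ).prod 𝓘(ℂ)) (𝓘(ℂ).prod 𝓘(ℂ)) ω
    (fun v : TotalSpace ℂ X.bundle.Fiber =>
      (⟨v.proj, equiv v.proj v.snd⟩ : TotalSpace ℂ Y.bundle.Fiber))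
  holomorphic_symm : ContMDiff (𝓘(ℂ).prod 𝓘(ℂ)) (𝓘(ℂ).prod 𝓘(ℂ)) ω
    (fun v : TotalSpace ℂ Y.bundle.Fiber =>
      (⟨v.proj, (equiv v.proj).symm v.snd⟩ : TotalSpace ℂ X.bundle.Fiber))
  poles_eq : X.conn.poles = Y.conn.poles
  map_conn : ∀ (s : ∀ x, X.bundle.Fiber x) (x : S), x ∉ X.conn.poles →
    X.bundle.SectionDiffAt s x → ∀ v : TangentSpace 𝓘(ℂ) x,
      Y.conn.toFun (fun y => equiv y (s y)) x v = equiv x (X.conn.toFun s x v)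

/-- The identity isomorphism. -/
def Iso.refl (X : LineBundleWithConnection S) : Iso X X where
  equiv _ := ContinuousLinearEquiv.refl ℂ _
  holomorphic := contMDiff_id
  holomorphic_symm := contMDiff_id
  poles_eq := rfl
  map_conn _ _ _ _ _ := rfl

/-- An isomorphism maps differentiable sections to differentiable sections. -/
lemma sectionDiffAt_map {X Y : LineBundleWithConnection S}
    (e : ∀ x, X.bundle.Fiber x ≃L[ℂ] Y.bundle.Fiber x)
    (he : ContMDiff (𝓘(ℂ).prod 𝓘(ℂ)) (𝓘(ℂ).prod 𝓘(ℂ)) ω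
      (fun v : TotalSpace ℂ X.bundle.Fiber =>
        (⟨v.proj, e v.proj v.snd⟩ : TotalSpace ℂ Y.bundle.Fiber)))
    {s : ∀ x, X.bundle.Fiber x} {x : S} (hs : X.bundle.SectionDiffAt s x) :
    Y.bundle.SectionDiffAt (fun y => e y (s y)) x :=
  ((he.mdifferentiable (by simp)) _).comp x hs

/-- The inverse isomorphism. -/
def Iso.symm {X Y : LineBundleWithConnection S} (e : Iso X Y) : Iso Y X where
  equiv x := (e.equiv x).symm
  holomorphic := e.holomorphic_symm
  holomorphic_symm := e.holomorphic
  poles_eq := e.poles_eq.symm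
  map_conn s x hx hs v := by
    have hs' : X.bundle.SectionDiffAt (fun y => (e.equiv y).symm (s y)) x :=
      sectionDiffAt_map (fun y => (e.equiv y).symm) e.holomorphic_symm hs
    have h := e.map_conn (fun y => (e.equiv y).symm (s y)) x (e.poles_eq ▸ hx) hs' v
    simp only [ContinuousLinearEquiv.apply_symm_apply] at h
    rw [h, ContinuousLinearEquiv.symm_apply_apply]

/-- The composition of isomorphisms. -/
def Iso.trans {X Y Z : LineBundleWithConnection S} (e : Iso X Y) (f : Iso Y Z) : Iso X Z where
  equiv x := (e.equiv x).trans (f.equiv x)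
  holomorphic := f.holomorphic.comp e.holomorphic
  holomorphic_symm := e.holomorphic_symm.comp f.holomorphic_symm
  poles_eq := e.poles_eq.trans f.poles_eq
  map_conn s x hx hs v := by
    have hs' : Y.bundle.SectionDiffAt (fun y => e.equiv y (s y)) x :=
      sectionDiffAt_map e.equiv e.holomorphic hs
    have h := f.map_conn (fun y => e.equiv y (s y)) x (e.poles_eq ▸ hx) hs' v
    simp only [ContinuousLinearEquiv.trans_apply]
    rw [h, e.map_conn s x hx hs v]

/-- Isomorphism of pairs `(L, ∇)` is an equivalence relation. -/
instance isoSetoid (S : Type u) [TopologicalSpace S] [ChartedSpace ℂ S] :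
    Setoid (LineBundleWithConnection S) where
  r X Y := Nonempty (Iso X Y)
  iseqv := ⟨fun X => ⟨Iso.refl X⟩, fun ⟨e⟩ => ⟨e.symm⟩, fun ⟨e⟩ ⟨f⟩ => ⟨e.trans f⟩⟩

/-- The set of isomorphism classes of pairs `(L, ∇)`. -/
def IsoClass (S : Type u) [TopologicalSpace S] [ChartedSpace ℂ S] :=
  Quotient (isoSetoid S)

/-- The isomorphism class of `(L, ∇)`. -/
def isoClass (X : LineBundleWithConnection S) : IsoClass S := Quotient.mk _ X

/-- `L` has degree zero and `∇` has all poles of order at least two, all residues zero and trivial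
monodromy. -/
structure Admissible (X : LineBundleWithConnection S) : Prop where
  degree_zero : X.bundle.HasDegree 0
  order_ge_two : X.conn.PolesOrderAtLeastTwo
  residues_zero : X.conn.ResiduesZero
  trivial_monodromy : X.conn.HasTrivialMonodromy

end LineBundleWithConnection

/-! ### The line bundle with connection of an exp-algebraic structure -/

/-- Local data for `𝓗`: pairwise disjoint open neighbourhoods `Bᵢ` of the punctures `pᵢ` and
functions `hᵢ`, holomorphic on `Bᵢ - {pᵢ}` and meromorphic at `pᵢ`, which represent the classes of
`𝓗`. -/
structure ExpAlgStructure.LocalData {S : Type u} [TopologicalSpace S] [ChartedSpace ℂ S]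
    (H : ExpAlgStructure S) where
  B : H.punctures → Set S
  h : H.punctures → S → ℂ
  isOpen_B : ∀ p, IsOpen (B p)
  mem_B : ∀ p : H.punctures, (p : S) ∈ B p
  disjoint_B : Pairwise fun p q => Disjoint (B p) (B q)
  holomorphic_h : ∀ p : H.punctures, ContMDiffOn 𝓘(ℂ) 𝓘(ℂ) ω (h p) (B p \ {(p : S)})
  meromorphic_h : ∀ p : H.punctures, MeromorphicFunAt (p : S) (h p)
  principalPart_h : ∀ p : H.punctures, principalPart (p : S) (h p) (meromorphic_h p) = H.part p

namespace ExpAlgStructure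

section Construction

variable {S : Type u} [TopologicalSpace S] [ChartedSpace ℂ S]

/-- A function meromorphic at `p` is holomorphic on a punctured neighbourhood of `p`. -/
lemma eventually_contMDiffAt [IsManifold 𝓘(ℂ) ω S] {p : S} {f : S → ℂ}
    (hf : MeromorphicFunAt p f) : ∀ᶠ x in 𝓝[≠] p, ContMDiffAt 𝓘(ℂ) 𝓘(ℂ) ω f x := by
  have h1 := MeromorphicAt.eventually_analyticAt hf
  rw [eventually_nhdsWithin_iff] at h1 ⊢
  have hc : ContinuousAt (chartAt ℂ p) p :=
    (chartAt ℂ p).continuousAt (mem_chart_source ℂ p)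
  filter_upwards [hc.eventually h1, chart_source_mem_nhds ℂ p] with x hx hxs hxp
  have hne : chartAt ℂ p x ∈ ({chartAt ℂ p p}ᶜ : Set ℂ) := fun h =>
    hxp ((chartAt ℂ p).injOn hxs (mem_chart_source ℂ p) h)
  have h2 : ContMDiffAt 𝓘(ℂ) 𝓘(ℂ) ω (fun z => f ((chartAt ℂ p).symm z)) (chartAt ℂ p x) :=
    (hx hne).contDiffAt.contMDiffAt
  have h3 : ContMDiffAt 𝓘(ℂ) 𝓘(ℂ) ω (chartAt ℂ p) x :=
    contMDiffAt_of_mem_maximalAtlas (IsManifold.chart_mem_maximalAtlas p) hxs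
  refine (h2.comp x h3).congr_of_eventuallyEq ?_
  filter_upwards [(chartAt ℂ p).open_source.mem_nhds hxs] with y hy
  simp [(chartAt ℂ p).left_inv hy]

/-- Every exp-algebraic structure on a (Hausdorff) Riemann surface admits local data. -/
instance [T2Space S] [IsManifold 𝓘(ℂ) ω S] (H : ExpAlgStructure S) : Nonempty H.LocalData := by
  have hrep : ∀ p : S, ∃ (f : S → ℂ) (hf : MeromorphicFunAt p f),
      principalPart p f hf = H.part p := by
    intro p
    obtain ⟨⟨g, f, hf, hfg⟩, hg⟩ := Submodule.Quotient.mk_surjective _ (H.part p)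
    subst hfg
    exact ⟨f, hf, hg⟩
  choose f hf hpart using hrep
  obtain ⟨U, hU, hdisj⟩ := H.finite_support.t2_separation
  have hW : ∀ p : S, ∃ W : Set S, IsOpen W ∧ p ∈ W ∧
      ∀ x ∈ W, x ≠ p → ContMDiffAt 𝓘(ℂ) 𝓘(ℂ) ω (f p) x := by
    intro p
    have h := eventually_contMDiffAt (hf p)
    rw [eventually_nhdsWithin_iff] at h
    obtain ⟨W, hW, hWo, hpW⟩ := eventually_nhds_iff.1 h
    exact ⟨W, hWo, hpW, hW⟩
  choose W hWo hpW hWf using hW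
  exact ⟨{
    B := fun p => U p ∩ W p
    h := fun p => f p
    isOpen_B := fun p => (hU p).2.inter (hWo p)
    mem_B := fun p => ⟨(hU p).1, hpW p⟩
    disjoint_B := fun p q hpq =>
      (hdisj p.2 q.2 (fun h => hpq (Subtype.ext h))).mono inter_subset_left inter_subset_left
    holomorphic_h := fun p x hx => (hWf p x hx.1.2 hx.2).contMDiffWithinAt
    meromorphic_h := fun p => hf p
    principalPart_h := fun p => hpart p }⟩

namespace LocalData

variable {H : ExpAlgStructure S} (D : H.LocalData)

/-- The open sets `V = S' = S - {p₁, …, pₙ}` and `B₁, …, Bₙ`. -/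
def baseSet : Option H.punctures → Set S
  | none => H.puncturesᶜ
  | some p => D.B p

/-- The function `0` on `V` and the functions `hᵢ` on `Bᵢ`. -/
def exponent : Option H.punctures → S → ℂ
  | none => fun _ => 0
  | some p => D.h p

lemma eq_of_mem_B {p : H.punctures} {x : S} (hx : x ∈ D.B p) (hxH : x ∈ H.punctures) :
    x = p := by
  by_contra hne
  have hpq : (⟨x, hxH⟩ : H.punctures) ≠ p := fun h => hne (congrArg Subtype.val h)
  exact Set.disjoint_left.1 (D.disjoint_B hpq) (D.mem_B ⟨x, hxH⟩) hx

/-- The transition functions are holomorphic. -/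
lemma contMDiffOn_transition (i j : Option H.punctures) :
    ContMDiffOn 𝓘(ℂ) 𝓘(ℂ) ω (fun x => D.exponent i x - D.exponent j x)
      (D.baseSet i ∩ D.baseSet j) := by
  have key : ∀ p : H.punctures, D.B p ∩ H.puncturesᶜ ⊆ D.B p \ {(p : S)} := by
    rintro p x ⟨hx, hx'⟩
    exact ⟨hx, fun h => hx' (by rw [mem_singleton_iff.1 h]; exact p.2)⟩
  rcases eq_or_ne i j with rfl | hij
  · simpa using! contMDiffOn_const
  · rcases i with _ | p <;> rcases j with _ | q
    · exact absurd rfl hij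
    · have h := ((D.holomorphic_h q).mono (key q)).neg
      rw [inter_comm]
      simpa [exponent, baseSet] using! h
    · simpa [exponent, baseSet] using! (D.holomorphic_h p).mono (key p)
    · have hpq : p ≠ q := fun h => hij (congrArg some h)
      have : D.baseSet (some p) ∩ D.baseSet (some q) = ∅ :=
        (D.disjoint_B hpq).inter_eq
      rw [this]
      exact fun x hx => hx.elim


/-- The functions `hᵢ` have poles. -/
lemma order_lt_zero (p : H.punctures) :
    meromorphicOrderAt (fun w => D.h p ((chartAt ℂ (p : S)).symm w)) (chartAt ℂ (p : S) p) < 0 := by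
  by_contra hneg
  obtain ⟨g, hg, hgh⟩ :=
    (MeromorphicAt.meromorphicOrderAt_nonneg_iff (D.meromorphic_h p)).1 (not_lt.1 hneg)
  apply p.2
  rw [← D.principalPart_h p]
  refine (Submodule.Quotient.mk_eq_zero _).2
    ⟨fun x => g (chartAt ℂ (p : S) x), ?_, ?_⟩
  · refine hg.congr ?_
    filter_upwards [chart_target_mem_nhds ℂ (p : S)] with z hz
    simp [(chartAt ℂ (p : S)).right_inv hz]
  · refine Germ.coe_eq.2 ?_
    rw [EventuallyEq, eventually_nhdsWithin_iff] at hgh ⊢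
    have hc : ContinuousAt (chartAt ℂ (p : S)) p :=
      (chartAt ℂ (p : S)).continuousAt (mem_chart_source ℂ _)
    filter_upwards [hc.eventually hgh, chart_source_mem_nhds ℂ (p : S)] with x hx hxs hxp
    have hne : chartAt ℂ (p : S) x ∈ ({chartAt ℂ (p : S) p}ᶜ : Set ℂ) := fun h =>
      hxp ((chartAt ℂ (p : S)).injOn hxs (mem_chart_source ℂ _) h)
    have := hx hne
    rw [(chartAt ℂ (p : S)).left_inv hxs] at this
    exact this.symm

variable [T2Space S]

open Classical in
/-- The transition functions of the line bundle `L_𝓗` with respect to the cover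
`{V, B₁, …, Bₙ}`; the one from `V` to `Bᵢ` is `e^{-hᵢ}`. -/
def core : VectorBundleCore ℂ S ℂ (Option H.punctures) where
  baseSet := D.baseSet
  isOpen_baseSet i := by
    rcases i with _ | p
    · exact H.finite_support.isClosed.isOpen_compl
    · exact D.isOpen_B p
  indexAt x := if hx : x ∈ H.punctures then some ⟨x, hx⟩ else none
  mem_baseSet_at x := by
    by_cases hx : x ∈ H.punctures
    · simpa [hx, baseSet] using D.mem_B ⟨x, hx⟩
    · simp [hx, baseSet]
  coordChange i j x := exp (D.exponent i x - D.exponent j x) • ContinuousLinearMap.id ℂ ℂ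
  coordChange_self i x _ v := by simp
  continuousOn_coordChange i j :=
    ((continuous_exp.comp_continuousOn
      (D.contMDiffOn_transition i j).continuousOn)).smul continuousOn_const
  coordChange_comp i j k x _ v := by
    simp only [smul_apply, ContinuousLinearMap.id_apply, smul_eq_mul]
    rw [← mul_assoc, ← Complex.exp_add]
    congr 2
    ring

instance : D.core.IsContMDiff 𝓘(ℂ) ω where
  contMDiffOn_coordChange i j := by
    have h : ContDiff ℂ ω (fun w : ℂ => exp w • ContinuousLinearMap.id ℂ ℂ) :=
      contDiff_exp.smul contDiff_const
    exact h.contMDiff.comp_contMDiffOn (D.contMDiffOn_transition i j)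

/-- The line bundle `L_𝓗`. -/
def lineBundle : HolomorphicLineBundle S where
  Fiber := D.core.Fiber
  isTopologicalAddGroup _ := inferInstanceAs (IsTopologicalAddGroup ℂ)
  continuousSMul _ := inferInstanceAs (ContinuousSMul ℂ ℂ)

/-- The section `s_𝓗` of `L_𝓗` over `S'`: it is `1` on `V`, hence `e^{-hᵢ}` on `Bᵢ - {pᵢ}`. -/
def horizontalSection (x : S) : D.lineBundle.Fiber x :=
  D.core.coordChange none (D.core.indexAt x) x (1 : ℂ)

/-- The function `f` on `S'` with `s = f s_𝓗`: the section `s` in the trivialization over `V`. -/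
def quotientFun (s : ∀ x, D.lineBundle.Fiber x) (x : S) : ℂ :=
  (D.core.localTriv none ⟨x, s x⟩).2

/-- The operator `∇_𝓗`, determined by `∇_𝓗 s_𝓗 = 0`: it maps `s = f s_𝓗` to `df ⊗ s_𝓗`. -/
def connectionFun (s : ∀ x, D.lineBundle.Fiber x) (x : S) :
    TangentSpace 𝓘(ℂ) x →L[ℂ] D.lineBundle.Fiber x :=
  (mvfderiv 𝓘(ℂ) (D.quotientFun s) x).smulRight (D.horizontalSection x)

lemma indexAt_of_notMem {x : S} (hx : x ∉ H.punctures) : D.core.indexAt x = none := by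
  simp [core, hx]

lemma indexAt_of_mem {x : S} (hx : x ∈ H.punctures) :
    D.core.indexAt x = some ⟨x, hx⟩ := by
  simp [core, hx]

lemma quotientFun_of_notMem (s : ∀ x, D.lineBundle.Fiber x) {x : S} (hx : x ∉ H.punctures) :
    D.quotientFun s x = s x := by
  have : D.quotientFun s x = D.core.coordChange (D.core.indexAt x) none x (s x) := rfl
  rw [this, D.indexAt_of_notMem hx]
  exact D.core.coordChange_self none x hx _

lemma horizontalSection_of_notMem {x : S} (hx : x ∉ H.punctures) :
    D.horizontalSection x = (1 : ℂ) := by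
  rw [horizontalSection, D.indexAt_of_notMem hx]
  exact D.core.coordChange_self none x hx _

lemma isOpen_compl_punctures (H : ExpAlgStructure S) : IsOpen H.puncturesᶜ :=
  H.finite_support.isClosed.isOpen_compl

lemma quotientFun_add (s t : ∀ x, D.lineBundle.Fiber x) :
    D.quotientFun (s + t) = D.quotientFun s + D.quotientFun t :=
  funext fun x => (D.core.coordChange (D.core.indexAt x) none x).map_add (s x) (t x)

lemma quotientFun_smul (g : S → ℂ) (s : ∀ x, D.lineBundle.Fiber x) :
    D.quotientFun (g • s) = g • D.quotientFun s :=
  funext fun x => (D.core.coordChange (D.core.indexAt x) none x).map_smul (g x) (s x)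

lemma quotientFun_smul_horizontalSection (s : ∀ x, D.lineBundle.Fiber x) {x : S}
    (hx : x ∉ H.punctures) : D.quotientFun s x • D.horizontalSection x = s x := by
  rw [D.quotientFun_of_notMem s hx, D.horizontalSection_of_notMem hx]
  exact mul_one (M := ℂ) (s x)

lemma differentiableAt_quotientFun {s : ∀ x, D.lineBundle.Fiber x} {x : S}
    (hx : x ∉ H.punctures) (hs : D.lineBundle.SectionDiffAt s x) :
    MDifferentiableAt 𝓘(ℂ) 𝓘(ℂ) (D.quotientFun s) x := by
  have h := (mdifferentiableAt_section 𝓘(ℂ) (F := ℂ) (E := D.core.Fiber) s (b₀ := x)).1 hs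
  rw [VectorBundleCore.trivializationAt, VectorBundleCore.localTrivAt,
    D.indexAt_of_notMem hx] at h
  exact h

lemma isCovariantDerivativeOn_connectionFun :
    IsCovariantDerivativeOn ℂ (V := D.lineBundle.Fiber) D.connectionFun H.puncturesᶜ where
  add {s s' x} hs hs' hx := by
    have h1 := D.differentiableAt_quotientFun hx hs
    have h2 := D.differentiableAt_quotientFun hx hs'
    refine ContinuousLinearMap.ext fun v => ?_
    change mvfderiv 𝓘(ℂ) (D.quotientFun (s + s')) x v • D.horizontalSection x =
      mvfderiv 𝓘(ℂ) (D.quotientFun s) x v • D.horizontalSection x +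
        mvfderiv 𝓘(ℂ) (D.quotientFun s') x v • D.horizontalSection x
    rw [quotientFun_add, mvfderiv_add h1 h2, ← add_smul]
    rfl
  leibniz {s g x} hs hg hx := by
    have h1 := D.differentiableAt_quotientFun hx hs
    refine ContinuousLinearMap.ext fun v => ?_
    change mvfderiv 𝓘(ℂ) (D.quotientFun (g • s)) x v • D.horizontalSection x =
      g x • (mvfderiv 𝓘(ℂ) (D.quotientFun s) x v • D.horizontalSection x) +
        mvfderiv 𝓘(ℂ) g x v • s x
    rw [quotientFun_smul, mvfderiv_smul hg h1, ← D.quotientFun_smul_horizontalSection s hx,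
      smul_smul, smul_smul, ← add_smul]
    rfl

/-- With respect to the frame on `V` the connection form is `0`, and on `Bᵢ` it is `dhᵢ`. -/
lemma connectionCoeff_eq [IsManifold 𝓘(ℂ) ω S] (p : S) {z : ℂ}
    (hz : z ∈ (chartAt ℂ p).target)
    (hzB : (chartAt ℂ p).symm z ∈ D.baseSet (D.core.indexAt p))
    (hzV : (chartAt ℂ p).symm z ∉ H.punctures) :
    D.lineBundle.connectionCoeff D.connectionFun p z =
      deriv (fun w => D.exponent (D.core.indexAt p) ((chartAt ℂ p).symm w)) z := by
  set i := D.core.indexAt p with hi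
  set y := (chartAt ℂ p).symm z with hy
  set a := D.exponent i with ha
  -- the frame at `p` is `e^{a} s_𝓗`
  have hframe : D.quotientFun (D.lineBundle.frame p) =ᶠ[𝓝 y] fun x => exp (a x) := by
    have hO : D.baseSet i ∩ H.puncturesᶜ ∈ 𝓝 y :=
      ((D.core.isOpen_baseSet i).inter (isOpen_compl_punctures H)).mem_nhds ⟨hzB, hzV⟩
    filter_upwards [hO] with x hx
    have hxf : D.lineBundle.frame p x = D.core.coordChange i (D.core.indexAt x) x (1 : ℂ) :=
      D.core.localTriv_symm_apply i hx.1 1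
    have hq : D.quotientFun (D.lineBundle.frame p) x =
        D.core.coordChange (D.core.indexAt x) none x (D.lineBundle.frame p x) := rfl
    rw [hq, hxf]
    refine (D.core.coordChange_comp i _ none x ⟨⟨hx.1, D.core.mem_baseSet_at x⟩, hx.2⟩ 1).trans ?_
    change exp (D.exponent i x - D.exponent none x) * 1 = _
    simp [exponent, ha]
  -- the section `s_𝓗` is `e^{-a}` in the trivialization at `p`
  have hhor : ∀ c : ℂ, (trivializationAt ℂ D.lineBundle.Fiber p
      ⟨y, c • D.horizontalSection y⟩).2 = c * exp (-(a y)) := by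
    intro c
    have h1 : (trivializationAt ℂ D.lineBundle.Fiber p ⟨y, c • D.horizontalSection y⟩).2 =
      D.core.coordChange (D.core.indexAt y) i y (c • D.horizontalSection y) := rfl
    have h2 : D.core.coordChange (D.core.indexAt y) i y (D.horizontalSection y) =
        exp (-(a y)) := by
      refine (D.core.coordChange_comp none _ i y
        ⟨⟨hzV, D.core.mem_baseSet_at y⟩, hzB⟩ 1).trans ?_
      change exp (D.exponent none y - D.exponent i y) * 1 = _
      simp [exponent, ha]
    rw [h1]
    refine ((D.core.coordChange (D.core.indexAt y) i y).map_smul c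
      (D.horizontalSection y)).trans ?_
    rw [h2, smul_eq_mul]
  have hdiff : MDifferentiableAt 𝓘(ℂ) 𝓘(ℂ) a y := by
    have h := D.contMDiffOn_transition i none
    have h' : ContMDiffAt 𝓘(ℂ) 𝓘(ℂ) ω (fun x => D.exponent i x - D.exponent none x) y :=
      h.contMDiffAt (((D.core.isOpen_baseSet i).inter
        (isOpen_compl_punctures H)).mem_nhds ⟨hzB, hzV⟩)
    have h'' := h'.mdifferentiableAt (by simp)
    simpa [exponent, ha] using! h''
  have hsymm : MDifferentiableAt 𝓘(ℂ) 𝓘(ℂ) (chartAt ℂ p).symm z := by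
    have : IsManifold 𝓘(ℂ) 1 S := IsManifold.of_le (n := ω) le_top
    exact mdifferentiableAt_atlas_symm (chart_mem_atlas ℂ p) hz
  have hexp : MDifferentiableAt 𝓘(ℂ) 𝓘(ℂ) (fun x => exp (a x)) y :=
    (differentiable_exp.differentiableAt.mdifferentiableAt).comp y hdiff
  have hder : mvfderiv 𝓘(ℂ) (D.quotientFun (D.lineBundle.frame p)) y
      (mfderiv 𝓘(ℂ) 𝓘(ℂ) (chartAt ℂ p).symm z (1 : ℂ)) =
      deriv (fun w => exp (a ((chartAt ℂ p).symm w))) z := by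
    have h1 := mvfderiv_comp_apply z (hexp.congr_of_eventuallyEq hframe) hsymm (1 : ℂ)
    refine h1.symm.trans ?_
    have h2 : (D.quotientFun (D.lineBundle.frame p)) ∘ (chartAt ℂ p).symm =ᶠ[𝓝 z]
        fun w => exp (a ((chartAt ℂ p).symm w)) :=
      hsymm.continuousAt.eventually hframe
    have h3 : mvfderiv 𝓘(ℂ) ((D.quotientFun (D.lineBundle.frame p)) ∘ (chartAt ℂ p).symm) z
        (1 : ℂ) = fderiv ℂ ((D.quotientFun (D.lineBundle.frame p)) ∘ (chartAt ℂ p).symm) z 1 := by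
      rw [← mfderiv_eq_fderiv]
      rfl
    refine h3.trans ?_
    rw [h2.fderiv_eq, fderiv_apply_one_eq_deriv]
  have hda : DifferentiableAt ℂ (fun w => a ((chartAt ℂ p).symm w)) z :=
    (hdiff.comp z hsymm).differentiableAt
  have hmain : D.lineBundle.connectionCoeff D.connectionFun p z =
      mvfderiv 𝓘(ℂ) (D.quotientFun (D.lineBundle.frame p)) y
      (mfderiv 𝓘(ℂ) 𝓘(ℂ) (chartAt ℂ p).symm z (1 : ℂ)) * exp (-(a y)) := hhor _
  rw [hmain, hder, deriv_cexp hda, ← hy, mul_right_comm, ← Complex.exp_add]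
  simp

lemma connectionCoeff_of_notMem [IsManifold 𝓘(ℂ) ω S] {p : S} (hp : p ∉ H.punctures) :
    D.lineBundle.connectionCoeff D.connectionFun p =ᶠ[𝓝 (chartAt ℂ p p)] fun _ => 0 := by
  have hi := D.indexAt_of_notMem hp
  have h1 : ∀ᶠ z in 𝓝 (chartAt ℂ p p), (chartAt ℂ p).symm z ∈ H.puncturesᶜ := by
    refine ((chartAt ℂ p).continuousAt_symm (mem_chart_target ℂ p)).eventually_mem ?_
    rw [(chartAt ℂ p).left_inv (mem_chart_source ℂ p)]
    exact (isOpen_compl_punctures H).mem_nhds hp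
  filter_upwards [h1, chart_target_mem_nhds ℂ p] with z hz hzt
  rw [D.connectionCoeff_eq p hzt (by rw [hi]; exact hz) hz, hi]
  simp [exponent]

lemma connectionCoeff_of_mem [IsManifold 𝓘(ℂ) ω S] (p : H.punctures) :
    D.lineBundle.connectionCoeff D.connectionFun p =ᶠ[𝓝[≠] (chartAt ℂ (p : S) p)]
      deriv (fun w => D.h p ((chartAt ℂ (p : S)).symm w)) := by
  have hi := D.indexAt_of_mem p.2
  have h1 : ∀ᶠ z in 𝓝 (chartAt ℂ (p : S) p), (chartAt ℂ (p : S)).symm z ∈ D.B p := by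
    refine ((chartAt ℂ (p : S)).continuousAt_symm (mem_chart_target ℂ _)).eventually_mem ?_
    rw [(chartAt ℂ (p : S)).left_inv (mem_chart_source ℂ _)]
    exact (D.isOpen_B p).mem_nhds (D.mem_B p)
  rw [EventuallyEq, eventually_nhdsWithin_iff]
  filter_upwards [h1, chart_target_mem_nhds ℂ (p : S)] with z hz hzt hne
  have hzV : (chartAt ℂ (p : S)).symm z ∉ H.punctures := by
    intro h
    have h2 := D.eq_of_mem_B hz h
    apply hne
    rw [mem_singleton_iff, ← (chartAt ℂ (p : S)).right_inv hzt, h2]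
  rw [D.connectionCoeff_eq p hzt (by rw [hi]; exact hz) hzV, hi]
  rfl

lemma poles_connectionFun [IsManifold 𝓘(ℂ) ω S] :
    {p : S | D.lineBundle.connectionOrder D.connectionFun p < 0} = H.punctures := by
  ext p
  rw [mem_ofPred_eq, HolomorphicLineBundle.connectionOrder]
  by_cases hp : p ∈ H.punctures
  · refine iff_of_true ?_ hp
    have hlt := D.order_lt_zero ⟨p, hp⟩
    rw [meromorphicOrderAt_congr (D.connectionCoeff_of_mem ⟨p, hp⟩)]
    obtain ⟨n, hn⟩ := WithTop.ne_top_iff_exists.1 hlt.ne_top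
    rw [← hn] at hlt
    have hn0 : n < 0 := by exact_mod_cast hlt
    rw [meromorphicOrderAt_deriv_eq_sub_one (n := n) (by exact_mod_cast hn0.ne) hn.symm]
    exact_mod_cast (by omega : n - 1 < 0)
  · refine iff_of_false ?_ hp
    rw [meromorphicOrderAt_congr ((D.connectionCoeff_of_notMem hp).filter_mono nhdsWithin_le_nhds)]
    exact not_lt.2 analyticAt_const.meromorphicOrderAt_nonneg

/-- The meromorphic connection `∇_𝓗` on `L_𝓗`. -/
def connection [IsManifold 𝓘(ℂ) ω S] : MeromorphicConnection D.lineBundle where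
  toFun := D.connectionFun
  meromorphic p := by
    by_cases hp : p ∈ H.punctures
    · exact (MeromorphicAt.deriv (D.meromorphic_h ⟨p, hp⟩)).congr
        (D.connectionCoeff_of_mem ⟨p, hp⟩).symm
    · exact (analyticAt_const.congr (D.connectionCoeff_of_notMem hp).symm).meromorphicAt
  finite_poles := by
    rw [D.poles_connectionFun]
    exact H.finite_support
  holomorphic p hp := by
    have hp' : p ∉ H.punctures := by
      rw [← D.poles_connectionFun]
      exact hp
    exact analyticAt_const.congr (D.connectionCoeff_of_notMem hp').symm
  isCovariantDerivativeOn := by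
    rw [D.poles_connectionFun]
    exact D.isCovariantDerivativeOn_connectionFun

/-- The pair `(L_𝓗, ∇_𝓗)` built from local data for `𝓗`. -/
def pair [IsManifold 𝓘(ℂ) ω S] : LineBundleWithConnection S := ⟨D.lineBundle, D.connection⟩

end LocalData

/-- The assignment `𝓗 ↦ (L_𝓗, ∇_𝓗)`, as a map to isomorphism classes of pairs. -/
def toIsoClass [T2Space S] [IsManifold 𝓘(ℂ) ω S] (H : ExpAlgStructure S) :
    LineBundleWithConnection.IsoClass S :=
  LineBundleWithConnection.isoClass (Classical.arbitrary H.LocalData).pair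

end Construction
end ExpAlgStructure
end ExpAlg

end

noncomputable section

universe u

namespace ExpAlg

/-! ### Planar Stokes formulas -/

open MeasureTheory

/-! The section `s_𝓗` reduces everything about `(L_𝓗, ∇_𝓗)` to the functions `hᵢ`. In the frame of
`L_𝓗` over `Bᵢ` it is `e^{-hᵢ}`, so the connection form is `dhᵢ` there, and it is `0` in the frame
over `S'`. An exact form has no residue, differentiating a pole of order `k ≥ 1` gives a pole of
order `k + 1 ≥ 2`, and division by `s_𝓗` turns horizontal sections into locally constant functions,
so there is no monodromy.

For the degree, let `s` be a meromorphic section and `f = s / s_𝓗`. This function may have essential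
singularities, but `df/f` is a meromorphic form: near `p` it is the logarithmic derivative of the
coefficient of `s` plus an exact form, so its residue is the order of `s` at `p`. Hence
`hasDegree_zero` follows from the residue theorem `sum_residues_eq_zero`. The latter is Stokes'
formula with a partition of unity `ρ` constant near the poles of the form `α`: the integral of
`∂̄ρ_j ∧ α` is a multiple of the residue at `j` if `j` is one of the singular points and zero
otherwise, while the sum over `j` vanishes because `∑ ρ_j = 1`.

Pairs are compared through horizontal frames. By `nonempty_iso_of_isHorizontalFrame`, sending one
frame to the other is an isomorphism if their ratio extends to a nonvanishing holomorphic function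
at each pole. Representatives of one class differ by a holomorphic `G` and the ratio is a multiple
of `e^{-G}`; this gives independence of the local data and identifies the pairs in the proof of
surjectivity. For injectivity, an isomorphism changes the connection form by the logarithmic
derivative of a nonvanishing holomorphic function (`Iso.connectionCoeff_sub`), so `d(h - h')`
extends holomorphically and therefore `h - h'` does too.

For surjectivity, the complement of the poles is connected, and with trivial monodromy parallel
transport of a single vector gives a global horizontal frame `σ` (`exists_horizontal_frame`). At a
pole, the vanishing residue provides a meromorphic primitive `h` of the connection form, and `σ e^h`
is constant on a punctured disc, so `σ = c e^{-h}` (`exists_sectionCoeff_eq_exp`). The classes of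
these `h` form the required structure. -/

/-- Twice the Wirtinger derivative `∂u/∂z̄` of a real function. -/
def dbar (u : ℂ → ℝ) (z : ℂ) : ℂ := (fderiv ℝ u z 1 : ℂ) + I * (fderiv ℝ u z I : ℂ)

lemma dbar_congr {u v : ℂ → ℝ} {z : ℂ} (h : u =ᶠ[𝓝 z] v) : dbar u z = dbar v z := by
  simp only [dbar, h.fderiv_eq]

lemma dbar_const (c : ℝ) (z : ℂ) : dbar (fun _ => c) z = 0 := by
  simp [dbar]

lemma dbar_sub {u v : ℂ → ℝ} {z : ℂ} (hu : DifferentiableAt ℝ u z) (hv : DifferentiableAt ℝ v z) :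
    dbar (fun w => u w - v w) z = dbar u z - dbar v z := by
  simp only [dbar, fderiv_fun_sub hu hv, sub_apply]
  push_cast
  ring

lemma dbar_sum {ι : Type*} {s : Finset ι} {u : ι → ℂ → ℝ} {z : ℂ}
    (hu : ∀ i ∈ s, DifferentiableAt ℝ (u i) z) :
    dbar (fun w => ∑ i ∈ s, u i w) z = ∑ i ∈ s, dbar (u i) z := by
  simp only [dbar, fderiv_fun_sum hu, sum_apply]
  push_cast
  rw [Finset.mul_sum, Finset.sum_add_distrib]

lemma continuousAt_dbar {u : ℂ → ℝ} {z : ℂ} (hu : ContDiffAt ℝ 1 u z) : ContinuousAt (dbar u) z := by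
  have h : ContinuousAt (fderiv ℝ u) z := hu.continuousAt_fderiv (by simp)
  unfold dbar
  fun_prop

/-- The chain rule for `∂̄` under a holomorphic change of variable. -/
lemma dbar_comp {u : ℂ → ℝ} {e : ℂ → ℂ} {e' z : ℂ} (he : HasDerivAt e e' z)
    (hu : DifferentiableAt ℝ u (e z)) :
    dbar (fun w => u (e w)) z = (starRingEnd ℂ) e' * dbar u (e z) := by
  have h1 : HasFDerivAt e ((ContinuousLinearMap.toSpanSingleton ℂ e').restrictScalars ℝ) z :=
    he.hasFDerivAt.restrictScalars ℝ
  have h2 := hu.hasFDerivAt.comp z h1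
  have h3 : fderiv ℝ (fun w => u (e w)) z = _ := h2.fderiv
  -- The differential of `u` is only real linear, so it is expanded in the real basis `1, I` before
  -- `e'` and its conjugate can be compared.
  have key : ∀ w : ℂ, fderiv ℝ u (e z) w =
      w.re * fderiv ℝ u (e z) 1 + w.im * fderiv ℝ u (e z) I := by
    intro w
    conv_lhs => rw [← re_add_im w]
    rw [map_add]
    have e1 : ((w.re : ℂ)) = w.re • (1 : ℂ) := by simp
    have e2 : ((w.im : ℂ)) * I = w.im • I := by simp
    rw [e1, e2, map_smul, map_smul]
    simp
  simp only [dbar, h3, ContinuousLinearMap.comp_apply, ContinuousLinearMap.coe_restrictScalars',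
    ContinuousLinearMap.toSpanSingleton_apply, smul_eq_mul, one_mul]
  rw [key e', key (I * e')]
  apply Complex.ext <;> simp <;> ring

/-- **Stokes' formula**: `∫ ∂̄u ∧ a dz = 0` if `a` is holomorphic on the compact support of `u`. -/
lemma integral_dbar_mul_eq_zero {u : ℂ → ℝ} {a : ℂ → ℂ} (hu : ContDiff ℝ 1 u)
    (hc : HasCompactSupport u) (ha : ∀ z ∈ tsupport u, AnalyticAt ℂ a z) :
    ∫ z, dbar u z * a z = 0 := by
  have hdu : ∀ v : ℂ, Continuous fun z => fderiv ℝ u z v := fun v =>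
    (hu.continuous_fderiv (by simp)).clm_apply continuous_const
  have hsupp : ∀ v : ℂ, tsupport (fun z => fderiv ℝ u z v) ⊆ tsupport u := fun v =>
    closure_minimal (fun z hz => support_fderiv_subset ℝ (f := u) (by
      intro h; apply hz; simp [h])) (isClosed_tsupport u)
  -- Nothing is known about `a` outside the support of `u`; the products are still continuous on the
  -- plane because they vanish there.
  have hint : ∀ (w : ℂ → ℝ) (b : ℂ → ℂ), Continuous w → tsupport w ⊆ tsupport u →
      (∀ z ∈ tsupport u, ContinuousAt b z) → Integrable fun z => w z • b z := by
    intro w b hw hwu hb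
    have hts : tsupport (fun z => w z • b z) ⊆ tsupport u := (tsupport_smul_subset_left w b).trans hwu
    refine Continuous.integrable_of_hasCompactSupport ?_ (hc.of_isClosed_subset (isClosed_tsupport _) hts)
    refine continuous_of_tsupport fun z hz => ?_
    exact hw.continuousAt.smul (hb z (hts hz))
  have hder : ∀ z ∈ tsupport u, ∀ v : ℂ, fderiv ℝ a z v = deriv a z * v := by
    intro z hz v
    have h := ((ha z hz).differentiableAt.hasFDerivAt.restrictScalars ℝ).fderiv
    rw [h, ContinuousLinearMap.coe_restrictScalars', ← toSpanSingleton_deriv]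
    simp [mul_comm]
  have hD : ∀ v : ℂ, Integrable fun z => u z • fderiv ℝ a z v := by
    intro v
    have h1 : (fun z => u z • fderiv ℝ a z v) = fun z => u z • (deriv a z * v) := by
      funext z
      by_cases hz : z ∈ tsupport u
      · rw [hder z hz]
      · simp [image_eq_zero_of_notMem_tsupport hz]
    rw [h1]
    exact hint u _ hu.continuous subset_rfl fun z hz => ((ha z hz).deriv.continuousAt).mul continuousAt_const
  have hI : ∀ v : ℂ, Integrable fun z => fderiv ℝ u z v • a z := fun v =>
    hint _ a (hdu v) (hsupp v) fun z hz => (ha z hz).continuousAt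
  -- Integration by parts in the real direction `v`, where the derivative of the holomorphic `a` is
  -- `v a'`.
  have hparts : ∀ v : ℂ, ∫ z, fderiv ℝ u z v • a z = - (v * ∫ z, u z • deriv a z) := by
    intro v
    have h := integral_smul_fderiv_eq_neg_fderiv_smul_of_integrable (μ := volume) (v := v) (hI v)
      (hD v) (hint u a hu.continuous subset_rfl fun z hz => (ha z hz).continuousAt)
      (fun z _ => (hu.differentiable (by simp)) z)
      (fun z hz => (ha z hz).differentiableAt.restrictScalars ℝ)
    have h2 : ∫ z, u z • fderiv ℝ a z v = v * ∫ z, u z • deriv a z := by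
      rw [← integral_const_mul]
      refine integral_congr_ae (Eventually.of_forall fun z => ?_)
      by_cases hz : z ∈ tsupport u
      · simp only [hder z hz, real_smul]; ring
      · simp [image_eq_zero_of_notMem_tsupport hz]
    rw [← h2, h, neg_neg]
  have e : (fun z => dbar u z * a z) =
      fun z => fderiv ℝ u z 1 • a z + I * (fderiv ℝ u z I • a z) := by
    funext z; simp only [dbar, real_smul]; ring
  rw [e, integral_add (hI 1) ((hI I).const_mul I), integral_const_mul, hparts, hparts]
  -- The directions `1` and `I` contribute `-∫ u a'` and `-I² ∫ u a'`, which cancel: these are the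
  -- Cauchy-Riemann equations in weak form.
  linear_combination (-(∫ z, u z • deriv a z)) * I_sq

/-- A smooth cutoff function of the square of the distance. -/
def radialCutoff (r R : ℝ) (s : ℝ) : ℝ :=
  Real.smoothTransition ((R ^ 2 - s) / (R ^ 2 - r ^ 2))

lemma contDiff_radialCutoff (r R : ℝ) : ContDiff ℝ 1 (radialCutoff r R) :=
  Real.smoothTransition.contDiff.comp ((contDiff_const.sub contDiff_id).div_const _)

lemma radialCutoff_eq_one {r R s : ℝ} (hr : 0 < r) (hR : r < R) (hs : s ≤ r ^ 2) :
    radialCutoff r R s = 1 := by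
  apply Real.smoothTransition.one_of_one_le
  have : 0 < R ^ 2 - r ^ 2 := by nlinarith
  rw [le_div_iff₀ this]; linarith

lemma radialCutoff_eq_zero {r R s : ℝ} (hr : 0 < r) (hR : r < R) (hs : R ^ 2 ≤ s) :
    radialCutoff r R s = 0 := by
  apply Real.smoothTransition.zero_of_nonpos
  have : 0 < R ^ 2 - r ^ 2 := by nlinarith
  exact div_nonpos_of_nonpos_of_nonneg (by linarith) this.le

/-- The chain rule for the squared distance. The factor `z - z₀` is, up to `I`, the velocity of a
circle around `z₀`, so that in polar coordinates an area integral against `∂̄ψ` becomes an average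
of circle integrals. -/
lemma dbar_radial {ψ : ℝ → ℝ} (hψ : ContDiff ℝ 1 ψ) (z₀ z : ℂ) :
    dbar (fun w => ψ (normSq (w - z₀))) z = 2 * deriv ψ (normSq (z - z₀)) * (z - z₀) := by
  have h1 : HasFDerivAt (fun w : ℂ => normSq (w - z₀))
      ((2 * (z - z₀).re) • reCLM + (2 * (z - z₀).im) • imCLM) z := by
    have hre : HasFDerivAt (fun w : ℂ => (w - z₀).re) reCLM z :=
      reCLM.hasFDerivAt.comp z ((hasFDerivAt_id z).sub_const z₀)
    have him : HasFDerivAt (fun w : ℂ => (w - z₀).im) imCLM z :=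
      imCLM.hasFDerivAt.comp z ((hasFDerivAt_id z).sub_const z₀)
    have := (hre.mul hre).add (him.mul him)
    convert! this using 1
    module
  have h2 := ((hψ.differentiable (by simp)) (normSq (z - z₀))).hasDerivAt.comp_hasFDerivAt z h1
  have h3 : fderiv ℝ (fun w => ψ (normSq (w - z₀))) z = _ := h2.fderiv
  simp only [dbar, h3]
  apply Complex.ext <;> simp <;> ring

lemma continuousOn_polar (z₀ : ℂ) (a : ℂ → ℂ) {r R : ℝ} (hr : 0 < r)
    (ha : ∀ z, z ≠ z₀ → ‖z - z₀‖ ≤ R → ContinuousAt a z) :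
    ContinuousOn (fun p : ℝ × ℝ => a (circleMap z₀ p.1 p.2)) (Icc r R ×ˢ univ) := by
  rintro ⟨t, θ⟩ ⟨ht, -⟩
  have ht0 : 0 < t := hr.trans_le ht.1
  have hn : ‖circleMap z₀ t θ - z₀‖ = t := by simp [circleMap, abs_of_pos ht0]
  refine ContinuousAt.continuousWithinAt ?_
  have h1 : ContinuousAt (fun p : ℝ × ℝ => circleMap z₀ p.1 p.2) (t, θ) := by
    unfold circleMap
    fun_prop
  refine ContinuousAt.comp (f := fun p : ℝ × ℝ => circleMap z₀ p.1 p.2) (g := a) ?_ h1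
  refine ha _ ?_ (by rw [hn]; exact ht.2)
  intro h
  rw [h] at hn
  simp at hn
  exact ht0.ne hn

/-- The residue computed with a radial cutoff function. -/
lemma integral_dbar_radialCutoff {a : ℂ → ℂ} {z₀ c : ℂ} {r R : ℝ} (hr : 0 < r) (hR : r < R)
    (ha : ∀ z, z ≠ z₀ → ‖z - z₀‖ ≤ R → ContinuousAt a z)
    (hc : ∀ t ∈ Icc r R, (∮ z in C(z₀, t), a z) = 2 * Real.pi * I * c) :
    ∫ z, dbar (fun w => radialCutoff r R (normSq (w - z₀))) z * a z = -(2 * Real.pi * c) := by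
  set ψ := radialCutoff r R with hψdef
  have hψ : ContDiff ℝ 1 ψ := contDiff_radialCutoff r R
  have hdψ : Continuous (deriv ψ) := hψ.continuous_deriv (by simp)
  have hψ0 : ∀ t : ℝ, 0 < t → t ∉ Icc r R → deriv ψ (t ^ 2) = 0 := by
    intro t ht0 ht
    rcases lt_or_ge t r with h | h
    · have : ψ =ᶠ[𝓝 (t ^ 2)] fun _ => 1 := by
        filter_upwards [gt_mem_nhds (show t ^ 2 < r ^ 2 by nlinarith)] with s hs
        exact radialCutoff_eq_one hr hR hs.le
      rw [this.deriv_eq]; simp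
    · have h' : R < t := by
        by_contra h2
        exact ht ⟨h, not_lt.1 h2⟩
      have : ψ =ᶠ[𝓝 (t ^ 2)] fun _ => 0 := by
        filter_upwards [lt_mem_nhds (show R ^ 2 < t ^ 2 by nlinarith)] with s hs
        exact radialCutoff_eq_zero hr hR hs.le
      rw [this.deriv_eq]; simp
  -- translate to `z₀` and pass to polar coordinates
  have e1 : ∫ z, dbar (fun w => ψ (normSq (w - z₀))) z * a z =
      ∫ w, (2 * deriv ψ (normSq w) * w) * a (w + z₀) := by
    rw [← integral_add_right_eq_self _ z₀]
    refine integral_congr_ae (Eventually.of_forall fun z => ?_)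
    simp only [dbar_radial hψ, add_sub_cancel_right]
  rw [e1, ← Complex.integral_comp_polarCoord_symm]
  set F : ℝ × ℝ → ℂ := fun p => (2 * p.1 * deriv ψ (p.1 ^ 2)) *
    ((p.1 * exp (p.2 * I)) * a (circleMap z₀ p.1 p.2)) with hF
  have e2 : ∀ p ∈ polarCoord.target, p.1 • ((2 * deriv ψ (normSq (Complex.polarCoord.symm p)) *
      Complex.polarCoord.symm p) * a (Complex.polarCoord.symm p + z₀)) = F p := by
    rintro ⟨t, θ⟩ ht
    have h1 : Complex.polarCoord.symm (t, θ) = t * exp (θ * I) := by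
      rw [Complex.polarCoord_symm_apply, exp_mul_I]
      simp
    have h2 : normSq (t * exp (θ * I)) = t ^ 2 := by
      rw [normSq_eq_norm_sq, norm_mul, norm_exp_ofReal_mul_I]
      simp
    have h3 : (t : ℂ) * exp (θ * I) + z₀ = circleMap z₀ t θ := by rw [circleMap, add_comm]
    simp only [h1, h2, h3, hF, real_smul]
    ring
  rw [setIntegral_congr_fun polarCoord.open_target.measurableSet e2]
  have htarget : polarCoord.target = Ioi (0 : ℝ) ×ˢ Ioo (-Real.pi) Real.pi := rfl
  -- `ψ'` vanishes outside the annulus, which keeps the integral away from the singularity of `a`.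
  have e3 : ∫ p in polarCoord.target, F p = ∫ p in Icc r R ×ˢ Ioo (-Real.pi) Real.pi, F p := by
    apply setIntegral_eq_of_subset_of_forall_sdiff_eq_zero polarCoord.open_target.measurableSet
    · rw [htarget]
      exact prod_mono (fun t ht => hr.trans_le ht.1) subset_rfl
    · rintro ⟨t, θ⟩ ⟨ht, ht'⟩
      rw [htarget] at ht
      have : deriv ψ (t ^ 2) = 0 := hψ0 t ht.1 fun h => ht' ⟨h, ht.2⟩
      simp [hF, this]
  have hFc : ContinuousOn F (Icc r R ×ˢ univ) := by
    refine ContinuousOn.mul (Continuous.continuousOn ?_) (ContinuousOn.mul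
      (Continuous.continuousOn ?_) (continuousOn_polar z₀ a hr ha))
    · fun_prop
    · fun_prop
  have hFi : IntegrableOn F (Icc r R ×ˢ Ioo (-Real.pi) Real.pi) := by
    refine IntegrableOn.mono_set (t := Icc r R ×ˢ Icc (-Real.pi) Real.pi) ?_
      (prod_mono subset_rfl Ioo_subset_Icc_self)
    exact (hFc.mono (prod_mono subset_rfl (subset_univ _))).integrableOn_compact
      (isCompact_Icc.prod isCompact_Icc)
  rw [e3, Measure.volume_eq_prod, setIntegral_prod _ (by rwa [← Measure.volume_eq_prod])]
  -- For fixed radius the angular integral is the circle integral divided by `I`. Polar coordinates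
  -- use angles in `(-π, π)` and `circleIntegral` uses `[0, 2π]`; periodicity reconciles them.
  have e4 : ∀ t ∈ Icc r R, ∫ θ in Ioo (-Real.pi) Real.pi, F (t, θ) =
      (2 * t * deriv ψ (t ^ 2) : ℝ) * (2 * Real.pi * c) := by
    intro t ht
    simp only [hF, integral_const_mul]
    push_cast
    congr 1
    have hci := hc t ht
    rw [circleIntegral] at hci
    have hper : Function.Periodic (fun θ : ℝ => (t * exp (θ * I)) * a (circleMap z₀ t θ))
        (2 * Real.pi) := by
      intro θ
      have h1 := periodic_circleMap z₀ t θ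
      have h2 : exp (((θ + 2 * Real.pi : ℝ) : ℂ) * I) = exp (θ * I) := by
        push_cast
        rw [add_mul, exp_periodic]
      simp only [h1, h2]
    have h5 := hper.intervalIntegral_add_eq (-Real.pi) 0
    rw [show -Real.pi + 2 * Real.pi = Real.pi by ring, zero_add] at h5
    rw [← integral_Ioc_eq_integral_Ioo, ← intervalIntegral.integral_of_le (by linarith [Real.pi_pos]),
      h5]
    have h6 : ∀ θ : ℝ, deriv (circleMap z₀ t) θ • a (circleMap z₀ t θ) =
        I * ((t * exp (θ * I)) * a (circleMap z₀ t θ)) := by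
      intro θ
      rw [deriv_circleMap, circleMap]
      simp
      ring
    simp only [h6, intervalIntegral.integral_const_mul] at hci
    have : I * (∫ θ in (0:ℝ)..2 * Real.pi, (t * exp (θ * I)) * a (circleMap z₀ t θ)) =
        I * (2 * Real.pi * c) := by rw [hci]; ring
    exact mul_left_cancel₀ I_ne_zero this
  rw [setIntegral_congr_fun measurableSet_Icc e4, integral_mul_const, integral_Icc_eq_integral_Ioc,
    ← intervalIntegral.integral_of_le hR.le]
  have hder : ∀ t : ℝ, HasDerivAt (fun t => ψ (t ^ 2)) (2 * t * deriv ψ (t ^ 2)) t := by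
    intro t
    have h := ((hψ.differentiable (by simp)) (t ^ 2)).hasDerivAt.comp t (hasDerivAt_pow 2 t)
    convert! h using 1
    simp; ring
  -- The integrand is the derivative of `ψ(t²)`, which falls from `1` at `r` to `0` at `R`; this is
  -- the source of the minus sign in the result.
  have hint : ∫ t in r..R, ((2 * t * deriv ψ (t ^ 2) : ℝ) : ℂ) = -1 := by
    rw [intervalIntegral.integral_ofReal, intervalIntegral.integral_eq_sub_of_hasDerivAt
      (fun t _ => hder t) ((by fun_prop : Continuous fun t => 2 * t * deriv ψ (t ^ 2)).intervalIntegrable _ _)]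
    rw [hψdef, radialCutoff_eq_one hr hR le_rfl, radialCutoff_eq_zero hr hR le_rfl]
    simp
  rw [hint]
  ring

/-- **Stokes' formula** with a singularity: `∫ ∂̄u ∧ a dz` is a multiple of the residue of `a` if
`u` is `1` near the singularity. -/
lemma integral_dbar_mul_eq_residue {u : ℂ → ℝ} {a : ℂ → ℂ} {z₀ c : ℂ} (hu : ContDiff ℝ 1 u)
    (hc : HasCompactSupport u) (hu1 : ∀ᶠ z in 𝓝 z₀, u z = 1)
    (ha : ∀ z ∈ tsupport u, z ≠ z₀ → AnalyticAt ℂ a z) (hres : HasResidueAt a z₀ c) :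
    ∫ z, dbar u z * a z = -(2 * Real.pi * c) := by
  obtain ⟨ε, hε, hball⟩ := Metric.eventually_nhds_iff.1 hu1
  obtain ⟨δ, hδ, hres'⟩ := (mem_nhdsGT_iff_exists_Ioo_subset).1 hres
  -- On the disc of radius `R` the function `u` is `1`, and all circles of radius at most `R`
  -- compute the residue.
  set R := min ε δ / 2 with hRdef
  have hR0 : 0 < R := by have := lt_min hε hδ; simp only [R]; linarith
  have hRε : R < ε := by have := min_le_left ε δ; have := lt_min hε hδ; simp only [R]; linarith
  have hRδ : R < δ := by have := min_le_right ε δ; have := lt_min hε hδ; simp only [R]; linarith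
  set r := R / 2 with hrdef
  have hr : 0 < r := by simp only [r]; linarith
  have hrR : r < R := by simp only [r]; linarith
  set χ : ℂ → ℝ := fun w => radialCutoff r R (normSq (w - z₀)) with hχ
  have hχC : ContDiff ℝ 1 χ := by
    refine (contDiff_radialCutoff r R).comp ?_
    have : (fun w : ℂ => normSq (w - z₀)) = fun w => (reCLM (w - z₀)) * (reCLM (w - z₀)) +
      (imCLM (w - z₀)) * (imCLM (w - z₀)) := by
      funext w; simp [normSq_apply]
    rw [this]
    fun_prop
  have hn : ∀ w : ℂ, normSq (w - z₀) = ‖w - z₀‖ ^ 2 := fun w => normSq_eq_norm_sq _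
  have hχ0 : ∀ w, R ≤ ‖w - z₀‖ → χ w = 0 := fun w hw =>
    radialCutoff_eq_zero hr hrR (by rw [hn]; gcongr)
  have hχ1 : ∀ w, ‖w - z₀‖ ≤ r → χ w = 1 := fun w hw =>
    radialCutoff_eq_one hr hrR (by rw [hn]; gcongr)
  have hut : ∀ z, ‖z - z₀‖ ≤ R → z ∈ tsupport u := fun z hz =>
    subset_tsupport u (by
      rw [Function.mem_support, hball (by rw [dist_eq_norm]; linarith)]; exact one_ne_zero)
  have hχs : tsupport χ ⊆ Metric.closedBall z₀ R := by
    refine closure_minimal (fun z hz => ?_) Metric.isClosed_closedBall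
    rw [mem_closedBall_iff_norm]
    by_contra h
    exact hz (hχ0 z (not_le.1 h).le)
  have hχu : tsupport χ ⊆ tsupport u := fun z hz => hut z (mem_closedBall_iff_norm.1 (hχs hz))
  -- Since `u` and the radial cutoff are both `1` near `z₀`, their difference is supported away from
  -- the singularity, and Stokes' formula without residue applies to it.
  have h1 : ∫ z, dbar (fun w => u w - χ w) z * a z = 0 := by
    have hsub : tsupport (fun w => u w - χ w) ⊆ tsupport u := by
      refine closure_minimal (fun z hz => ?_) (isClosed_tsupport u)
      by_contra h
      apply hz
      simp only [image_eq_zero_of_notMem_tsupport h,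
        image_eq_zero_of_notMem_tsupport (fun h' => h (hχu h')), sub_zero]
    refine integral_dbar_mul_eq_zero (hu.sub hχC)
      (hc.of_isClosed_subset (isClosed_tsupport _) hsub) fun z hz => ha z (hsub hz) ?_
    rintro rfl
    refine (mem_closure_iff_frequently.1 hz) ?_
    filter_upwards [Metric.ball_mem_nhds z hr] with w hw
    rw [mem_ball_iff_norm] at hw
    have := hball (y := w) (by rw [dist_eq_norm]; linarith)
    simp [this, hχ1 w hw.le]
  have h2 := integral_dbar_radialCutoff (a := a) (z₀ := z₀) (c := c) hr hrR
    (fun z hz hzR => (ha z (hut z hzR) hz).continuousAt)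
    (fun t ht => hres' ⟨hr.trans_le ht.1, ht.2.trans_lt hRδ⟩)
  have hdiff : ∀ {v : ℂ → ℝ}, ContDiff ℝ 1 v → Differentiable ℝ v :=
    fun hv => hv.differentiable (by simp)
  have e : ∀ z, dbar u z * a z = dbar (fun w => u w - χ w) z * a z + dbar χ z * a z := by
    intro z
    rw [dbar_sub (hdiff hu z) (hdiff hχC z)]
    ring
  -- both summands are continuous with compact support
  have hint : ∀ v : ℂ → ℝ, ContDiff ℝ 1 v → tsupport v ⊆ tsupport u →
      (∃ k : ℝ, ∀ᶠ z in 𝓝 z₀, v z = k) → Integrable fun z => dbar v z * a z := by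
    rintro v hv hvu ⟨k, hk⟩
    have hts : tsupport (fun z => dbar v z * a z) ⊆ tsupport u := by
      refine (closure_minimal (fun z hz => ?_) (isClosed_tsupport v)).trans hvu
      by_contra h
      apply hz
      have : v =ᶠ[𝓝 z] fun _ => 0 := notMem_tsupport_iff_eventuallyEq.1 h
      simp [dbar_congr this, dbar_const]
    refine Continuous.integrable_of_hasCompactSupport ?_
      (hc.of_isClosed_subset (isClosed_tsupport _) hts)
    refine continuous_of_tsupport fun z hz => ?_
    -- At `z₀` the function `a` may be singular, but `v` is constant nearby, so the product vanishes
    -- identically there.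
    by_cases hz0 : z = z₀
    · subst hz0
      have : (fun z => dbar v z * a z) =ᶠ[𝓝 z] fun _ => 0 := by
        filter_upwards [hk.eventually_nhds] with w hw
        rw [dbar_congr hw, dbar_const, zero_mul]
      exact this.continuousAt
    · exact (continuousAt_dbar hv.contDiffAt).mul (ha z (hts hz) hz0).continuousAt
  have hχ1' : ∀ᶠ z in 𝓝 z₀, χ z = 1 := by
    filter_upwards [Metric.ball_mem_nhds z₀ hr] with w hw
    exact hχ1 w (mem_ball_iff_norm.1 hw).le
  have hsubts : tsupport (fun w => u w - χ w) ⊆ tsupport u := by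
    refine closure_minimal (fun z hz => ?_) (isClosed_tsupport u)
    by_contra h
    apply hz
    simp only [image_eq_zero_of_notMem_tsupport h,
      image_eq_zero_of_notMem_tsupport (fun h' => h (hχu h')), sub_zero]
  simp only [e]
  rw [integral_add (hint _ (hu.sub hχC) hsubts ⟨0, by filter_upwards [hu1, hχ1'] with w h h'; simp [h, h']⟩)
    (hint _ hχC hχu ⟨1, hχ1'⟩), h1, h2, zero_add]

/-! ### The residue theorem on a compact Riemann surface -/

/-! ### Holomorphic functions and transition maps in charts. -/

section Charts

variable {S : Type u} [TopologicalSpace S] [ChartedSpace ℂ S] [IsManifold 𝓘(ℂ) ω S]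

lemma analyticAt_comp_chart_symm {f : S → ℂ} {p : S} {z : ℂ} (hz : z ∈ (chartAt ℂ p).target)
    (hf : ContMDiffAt 𝓘(ℂ) 𝓘(ℂ) ω f ((chartAt ℂ p).symm z)) :
    AnalyticAt ℂ (fun w => f ((chartAt ℂ p).symm w)) z := by
  have h1 : ContMDiffAt 𝓘(ℂ) 𝓘(ℂ) ω (chartAt ℂ p).symm z :=
    (contMDiffOn_chart_symm (x := p)).contMDiffAt ((chartAt ℂ p).open_target.mem_nhds hz)
  have h2 := hf.comp z h1
  exact h2.contDiffAt.analyticAt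

lemma contMDiffAt_of_analyticAt {f : S → ℂ} {p x : S} (hx : x ∈ (chartAt ℂ p).source)
    (hf : AnalyticAt ℂ (fun w => f ((chartAt ℂ p).symm w)) (chartAt ℂ p x)) :
    ContMDiffAt 𝓘(ℂ) 𝓘(ℂ) ω f x := by
  have h1 : ContMDiffAt 𝓘(ℂ) 𝓘(ℂ) ω (chartAt ℂ p) x :=
    (contMDiffOn_chart (x := p)).contMDiffAt ((chartAt ℂ p).open_source.mem_nhds hx)
  have h2 : ContMDiffAt 𝓘(ℂ) 𝓘(ℂ) ω (fun w => f ((chartAt ℂ p).symm w)) (chartAt ℂ p x) :=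
    hf.contDiffAt.contMDiffAt
  refine (h2.comp x h1).congr_of_eventuallyEq ?_
  filter_upwards [(chartAt ℂ p).open_source.mem_nhds hx] with y hy
  simp [(chartAt ℂ p).left_inv hy]

lemma analyticAt_transition {p q : S} {z : ℂ} (hz : z ∈ ((chartAt ℂ p).symm ≫ₕ chartAt ℂ q).source) :
    AnalyticAt ℂ (((chartAt ℂ p).symm ≫ₕ chartAt ℂ q) : ℂ → ℂ) z := by
  rw [OpenPartialHomeomorph.trans_source] at hz
  have h1 : ContMDiffAt 𝓘(ℂ) 𝓘(ℂ) ω (chartAt ℂ q) ((chartAt ℂ p).symm z) :=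
    (contMDiffOn_chart (x := q)).contMDiffAt ((chartAt ℂ q).open_source.mem_nhds hz.2)
  exact analyticAt_comp_chart_symm hz.1 h1

variable (S) in
/-- A Riemann surface is a smooth real surface. -/
lemma isManifold_real : IsManifold 𝓘(ℝ, ℂ) ∞ S := by
  refine isManifold_of_contDiffOn _ _ _ fun e e' he he' => ?_
  have h := (contDiffGroupoid ω 𝓘(ℂ)).compatible he he'
  rw [contDiffGroupoid, mem_groupoid_of_pregroupoid] at h
  have h1 : ContDiffOn ℂ ω (𝓘(ℂ) ∘ (e.symm ≫ₕ e') ∘ 𝓘(ℂ).symm)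
    (𝓘(ℂ).symm ⁻¹' (e.symm ≫ₕ e').source ∩ range 𝓘(ℂ)) := h.1
  exact (h1.restrict_scalars ℝ).of_le le_top

end Charts

section ResidueTheorem

open MeasureTheory

variable {S : Type u} [TopologicalSpace S] [ChartedSpace ℂ S]

lemma eventually_chart_symm {p x : S} {Q : S → Prop} (hx : x ∈ (chartAt ℂ p).source)
    (h : ∀ᶠ y in 𝓝 x, Q y) : ∀ᶠ z in 𝓝 (chartAt ℂ p x), Q ((chartAt ℂ p).symm z) := by
  refine ((chartAt ℂ p).continuousAt_symm ((chartAt ℂ p).map_source hx)).eventually ?_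
  rwa [(chartAt ℂ p).left_inv hx]

lemma dbar_chart_eq_zero {ρ : S → ℝ} {p x : S} (hx : x ∈ (chartAt ℂ p).source)
    (h : ∃ c : ℝ, ∀ᶠ y in 𝓝 x, ρ y = c) :
    dbar (fun z => ρ ((chartAt ℂ p).symm z)) (chartAt ℂ p x) = 0 := by
  obtain ⟨c, hc⟩ := h
  rw [dbar_congr (eventually_chart_symm (Q := fun y => ρ y = c) hx hc), dbar_const]

lemma contDiffAt_comp_chart_symm_real [IsManifold 𝓘(ℂ) ω S] {ρ : S → ℝ}
    (hρ : ContMDiff 𝓘(ℝ, ℂ) 𝓘(ℝ) ∞ ρ) {p : S} {z : ℂ} (hz : z ∈ (chartAt ℂ p).target) :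
    ContDiffAt ℝ 1 (fun z => ρ ((chartAt ℂ p).symm z)) z := by
  have := isManifold_real S
  have h1 : ContMDiffAt 𝓘(ℝ, ℂ) 𝓘(ℝ, ℂ) ∞ (chartAt ℂ p).symm z :=
    (contMDiffOn_chart_symm (x := p)).contMDiffAt ((chartAt ℂ p).open_target.mem_nhds hz)
  exact ((hρ _).comp z h1).contDiffAt.of_le (by exact_mod_cast le_top)

/-- The extension by zero of a real function read in a chart. -/
def chartExtend (ρ : S → ℝ) (p : S) : ℂ → ℝ :=
  (chartAt ℂ p).target.indicator fun z => ρ ((chartAt ℂ p).symm z)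

lemma chartExtend_eventuallyEq (ρ : S → ℝ) (p : S) {z : ℂ} (hz : z ∈ (chartAt ℂ p).target) :
    chartExtend ρ p =ᶠ[𝓝 z] fun z => ρ ((chartAt ℂ p).symm z) := by
  filter_upwards [(chartAt ℂ p).open_target.mem_nhds hz] with w hw
  exact indicator_of_mem hw _

lemma isCompact_image_tsupport [CompactSpace S] {ρ : S → ℝ} {p : S}
    (h : tsupport ρ ⊆ (chartAt ℂ p).source) : IsCompact (chartAt ℂ p '' tsupport ρ) :=
  (isClosed_tsupport ρ).isCompact.image_of_continuousOn ((chartAt ℂ p).continuousOn.mono h)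

/-- The image of the compact support is compact, hence closed in the plane. The support therefore
stays away from the boundary of the chart, which is what makes the extension by zero smooth. -/
lemma tsupport_chartExtend [CompactSpace S] {ρ : S → ℝ} {p : S}
    (h : tsupport ρ ⊆ (chartAt ℂ p).source) :
    tsupport (chartExtend ρ p) ⊆ chartAt ℂ p '' tsupport ρ := by
  refine closure_minimal (fun z hz => ?_) (isCompact_image_tsupport h).isClosed
  have hzt : z ∈ (chartAt ℂ p).target := by
    by_contra h'
    exact hz (indicator_of_notMem h' _)
  refine ⟨(chartAt ℂ p).symm z, subset_tsupport ρ ?_, (chartAt ℂ p).right_inv hzt⟩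
  rw [Function.mem_support] at hz ⊢
  rwa [chartExtend, indicator_of_mem hzt] at hz

lemma contDiff_chartExtend [IsManifold 𝓘(ℂ) ω S] [CompactSpace S] {ρ : S → ℝ}
    (hρ : ContMDiff 𝓘(ℝ, ℂ) 𝓘(ℝ) ∞ ρ) {p : S} (h : tsupport ρ ⊆ (chartAt ℂ p).source) :
    ContDiff ℝ 1 (chartExtend ρ p) := by
  rw [contDiff_iff_contDiffAt]
  intro z
  by_cases hz : z ∈ (chartAt ℂ p).target
  · exact (contDiffAt_comp_chart_symm_real hρ hz).congr_of_eventuallyEq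
      (chartExtend_eventuallyEq ρ p hz)
  · have hz' : z ∉ tsupport (chartExtend ρ p) := by
      intro h'
      obtain ⟨x, hx, rfl⟩ := tsupport_chartExtend h h'
      exact hz ((chartAt ℂ p).map_source (h hx))
    exact contDiffAt_const.congr_of_eventuallyEq (notMem_tsupport_iff_eventuallyEq.1 hz')

variable [IsManifold 𝓘(ℂ) ω S] [CompactSpace S] [T2Space S]

/-- A finite smooth partition of unity subordinate to charts, such that every point of `P` lies in
the support of one function only. -/
lemma exists_partition_of_unity (P : Finset S) :
    ∃ (t : Finset S) (ρ : S → S → ℝ), P ⊆ t ∧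
      (∀ i, ContMDiff 𝓘(ℝ, ℂ) 𝓘(ℝ) ∞ (ρ i)) ∧ (∀ x, ∑ i ∈ t, ρ i x = 1) ∧
      (∀ i, tsupport (ρ i) ⊆ (chartAt ℂ i).source) ∧
      (∀ p ∈ P, ∀ i ≠ p, p ∉ tsupport (ρ i)) ∧ ∀ p ∈ P, ∀ᶠ y in 𝓝 p, ρ p y = 1 := by
  classical
  have := isManifold_real S
  -- All points of `P` except the centre are removed from each chart domain. Then only `ρ p` can be
  -- nonzero near `p ∈ P`, and it must equal `1` there.
  obtain ⟨ρ, hρ⟩ := SmoothPartitionOfUnity.exists_isSubordinate 𝓘(ℝ, ℂ) (M := S) isClosed_univ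
    (fun x : S => (chartAt ℂ x).source \ ((P : Set S) \ {x}))
    (fun x => (chartAt ℂ x).open_source.sdiff (P.finite_toSet.subset sdiff_subset).isClosed)
    (fun x _ => mem_iUnion.2 ⟨x, mem_chart_source ℂ x, fun h => h.2 rfl⟩)
  have hfin := ρ.locallyFinite.finite_nonempty_of_compact
  -- Compactness leaves finitely many nonzero functions; `P` is added so that its points are
  -- available as summation indices.
  set t : Finset S := hfin.toFinset ∪ P with ht
  have hsum : ∀ x, ∑ i ∈ t, ρ i x = 1 := by
    intro x
    rw [← ρ.sum_eq_one (mem_univ x), finsum_eq_sum_of_support_subset]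
    intro i hi
    simp only [ht, Finset.coe_union, Finite.coe_toFinset]
    exact Or.inl ⟨x, hi⟩
  have hP : ∀ p ∈ P, ∀ i ≠ p, p ∉ tsupport (ρ i) := fun p hp i hi h =>
    (hρ i h).2 ⟨hp, fun h' => hi h'.symm⟩
  refine ⟨t, fun i => ρ i, Finset.subset_union_right, fun i => (ρ i).contMDiff, hsum,
    fun i => (hρ i).trans sdiff_subset, hP, fun p hp => ?_⟩
  have h1 : ∀ᶠ y in 𝓝 p, ∀ i ∈ t, i ≠ p → ρ i y = 0 := by
    rw [Filter.eventually_all_finset]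
    intro i _
    by_cases hi : i = p
    · simp [hi]
    · filter_upwards [notMem_tsupport_iff_eventuallyEq.1 (hP p hp i hi)] with y hy _ using hy
  filter_upwards [h1] with y hy
  rw [← hsum y, Finset.sum_eq_single_of_mem p (Finset.mem_union_right _ hp)]
  exact fun i hi hip => hy i hi hip

/-- The **residue theorem**: the sum of the residues of a meromorphic `1`-form on a compact Riemann
surface is zero. The form is given by its coefficients `a k` in the charts. -/
theorem sum_residues_eq_zero (P : Finset S) (a : S → ℂ → ℂ) (n : S → ℂ)
    (hol : ∀ k x, x ∈ (chartAt ℂ k).source → x ∉ P → AnalyticAt ℂ (a k) (chartAt ℂ k x))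
    (trans : ∀ j k x, x ∈ (chartAt ℂ j).source → x ∈ (chartAt ℂ k).source → x ∉ P →
      a j (chartAt ℂ j x) =
        a k (chartAt ℂ k x) * deriv ((chartAt ℂ j).symm ≫ₕ chartAt ℂ k) (chartAt ℂ j x))
    (res : ∀ p ∈ P, HasResidueAt (a p) (chartAt ℂ p p) (n p)) :
    ∑ p ∈ P, n p = 0 := by
  classical
  obtain ⟨t, ρ, hPt, hρ, hsum, hsupp, hP, hP1⟩ := exists_partition_of_unity P
  -- the functions are locally constant near `P`
  have hconst : ∀ i, ∀ p ∈ P, ∃ c : ℝ, ∀ᶠ y in 𝓝 p, ρ i y = c := by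
    intro i p hp
    by_cases hi : i = p
    · subst hi
      exact ⟨1, hP1 i hp⟩
    · exact ⟨0, notMem_tsupport_iff_eventuallyEq.1 (hP p hp i hi)⟩
  -- The support of `ρ j` contains no point of `P` other than possibly `j`, so at most one residue
  -- enters.
  have hstokes : ∀ j, ∫ z, dbar (chartExtend (ρ j) j) z * a j z =
      if j ∈ P then -(2 * Real.pi * n j) else 0 := by
    intro j
    have hcs : HasCompactSupport (chartExtend (ρ j) j) :=
      (isCompact_image_tsupport (hsupp j)).of_isClosed_subset (isClosed_tsupport _)
        (tsupport_chartExtend (hsupp j))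
    have hana : ∀ z ∈ tsupport (chartExtend (ρ j) j), z ≠ chartAt ℂ j j → AnalyticAt ℂ (a j) z := by
      intro z hz hzj
      obtain ⟨x, hx, rfl⟩ := tsupport_chartExtend (hsupp j) hz
      refine hol j x (hsupp j hx) fun hxP => ?_
      exact hP x hxP j (fun h => hzj (by rw [h])) hx
    split_ifs with hj
    · refine integral_dbar_mul_eq_residue (contDiff_chartExtend (hρ j) (hsupp j)) hcs ?_ hana
        (res j hj)
      filter_upwards [chartExtend_eventuallyEq (ρ j) j (mem_chart_target ℂ j),
        eventually_chart_symm (mem_chart_source ℂ j) (hP1 j hj)] with z h1 h2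
      rw [h1, h2]
    · refine integral_dbar_mul_eq_zero (contDiff_chartExtend (hρ j) (hsupp j)) hcs fun z hz => ?_
      obtain ⟨x, hx, rfl⟩ := tsupport_chartExtend (hsupp j) hz
      refine hol j x (hsupp j hx) fun hxP => ?_
      exact hP x hxP j (fun h => hj (h ▸ hxP)) hx
  -- the form `ρ k ∂̄(ρ i) ∧ a` in the chart at `m`
  set W : S → S → S → ℂ → ℂ := fun m i k z =>
    ρ k ((chartAt ℂ m).symm z) * (dbar (fun w => ρ i ((chartAt ℂ m).symm w)) z * a m z) with hW
  have hdz : ∀ m i x, x ∈ (chartAt ℂ m).source → x ∉ tsupport (ρ i) →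
      dbar (fun w => ρ i ((chartAt ℂ m).symm w)) (chartAt ℂ m x) = 0 := fun m i x hx hxi =>
    dbar_chart_eq_zero hx ⟨0, notMem_tsupport_iff_eventuallyEq.1 hxi⟩
  have hWcont : ∀ m i k, ContinuousOn (W m i k) (chartAt ℂ m).target := by
    intro m i k z hz
    refine ContinuousAt.continuousWithinAt ?_
    have hzs := (chartAt ℂ m).map_target hz
    by_cases hx : (chartAt ℂ m).symm z ∈ P
    · have hev : W m i k =ᶠ[𝓝 z] fun _ => 0 := by
        obtain ⟨c, hc⟩ := hconst i _ hx
        have h2 := eventually_chart_symm hzs hc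
        rw [(chartAt ℂ m).right_inv hz] at h2
        filter_upwards [h2.eventually_nhds] with w hw
        simp only [hW]
        rw [dbar_congr hw, dbar_const]
        simp
      exact hev.continuousAt
    · have h1 := (contDiffAt_comp_chart_symm_real (hρ k) hz).continuousAt
      have h2 := continuousAt_dbar (contDiffAt_comp_chart_symm_real (hρ i) hz)
      have h3 := (hol m _ hzs hx).continuousAt
      rw [(chartAt ℂ m).right_inv hz] at h3
      exact (continuous_ofReal.continuousAt.comp h1).mul (h2.mul h3)
  -- One of the factors `ρ k` and `∂̄(ρ i)` belongs to the chart in use and cuts the integrand off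
  -- to a compact subset of it.
  have hWint : ∀ m i k, (m = i ∨ m = k) → IntegrableOn (W m i k) (chartAt ℂ m).target := by
    intro m i k hm
    have hsub : chartAt ℂ m '' tsupport (ρ m) ⊆ (chartAt ℂ m).target := by
      rintro _ ⟨x, hx, rfl⟩
      exact (chartAt ℂ m).map_source (hsupp m hx)
    refine IntegrableOn.of_forall_sdiff_eq_zero
      (((hWcont m i k).mono hsub).integrableOn_compact (isCompact_image_tsupport (hsupp m)))
      (chartAt ℂ m).open_target.measurableSet ?_
    rintro z ⟨hz, hz'⟩
    have hx : (chartAt ℂ m).symm z ∉ tsupport (ρ m) := fun h =>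
      hz' ⟨_, h, (chartAt ℂ m).right_inv hz⟩
    rcases hm with rfl | rfl
    · have := hdz m m _ ((chartAt ℂ m).map_target hz) hx
      rw [(chartAt ℂ m).right_inv hz] at this
      simp [hW, this]
    · simp [hW, image_eq_zero_of_notMem_tsupport hx]
  -- `ρ k ∂̄(ρ j) ∧ α` lives on the overlap of the two charts, where its integral does not depend on
  -- the coordinate.
  have hchange : ∀ j k, ∫ z in (chartAt ℂ j).target, W j j k z =
      ∫ z in (chartAt ℂ k).target, W k j k z := by
    intro j k
    set e := (chartAt ℂ j).symm ≫ₕ chartAt ℂ k with he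
    have hsource : e.source = (chartAt ℂ j).target ∩ (chartAt ℂ j).symm ⁻¹' (chartAt ℂ k).source := by
      rw [he, OpenPartialHomeomorph.trans_source]; rfl
    have htarget : e.target = (chartAt ℂ k).target ∩ (chartAt ℂ k).symm ⁻¹' (chartAt ℂ j).source := by
      rw [he, OpenPartialHomeomorph.trans_target]; rfl
    have h1 : ∫ z in (chartAt ℂ j).target, W j j k z = ∫ z in e.source, W j j k z := by
      refine setIntegral_eq_of_subset_of_forall_sdiff_eq_zero
        (chartAt ℂ j).open_target.measurableSet (hsource ▸ inter_subset_left) ?_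
      rintro z ⟨hz, hz'⟩
      have hx : (chartAt ℂ j).symm z ∉ tsupport (ρ k) := fun h =>
        hz' (by rw [hsource]; exact ⟨hz, hsupp k h⟩)
      simp [hW, image_eq_zero_of_notMem_tsupport hx]
    have h2 : ∫ z in (chartAt ℂ k).target, W k j k z = ∫ z in e.target, W k j k z := by
      refine setIntegral_eq_of_subset_of_forall_sdiff_eq_zero
        (chartAt ℂ k).open_target.measurableSet (htarget ▸ inter_subset_left) ?_
      rintro z ⟨hz, hz'⟩
      have hx : (chartAt ℂ k).symm z ∉ tsupport (ρ j) := fun h =>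
        hz' (by rw [htarget]; exact ⟨hz, hsupp j h⟩)
      have := hdz k j _ ((chartAt ℂ k).map_target hz) hx
      rw [(chartAt ℂ k).right_inv hz] at this
      simp [hW, this]
    rw [h1, h2]
    have hder : ∀ z ∈ e.source, HasDerivAt e (deriv e z) z := fun z hz =>
      (analyticAt_transition hz).differentiableAt.hasDerivAt
    rw [integral_target_eq_integral_abs_det_fderiv_smul volume
      (fun z hz => (hder z hz).hasFDerivAt.restrictScalars ℝ)]
    refine setIntegral_congr_fun e.open_source.measurableSet fun z hz => ?_
    have hz' := hz
    rw [hsource] at hz'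
    set x := (chartAt ℂ j).symm z with hx
    have hxj : x ∈ (chartAt ℂ j).source := (chartAt ℂ j).map_target hz'.1
    have hjx : chartAt ℂ j x = z := (chartAt ℂ j).right_inv hz'.1
    have hkx : e z = chartAt ℂ k x := rfl
    have hkx' : (chartAt ℂ k).symm (e z) = x := (chartAt ℂ k).left_inv hz'.2
    have hdet : |((ContinuousLinearMap.toSpanSingleton ℂ (deriv e z)).restrictScalars ℝ).det| =
        normSq (deriv e z) := by
      have : ((ContinuousLinearMap.toSpanSingleton ℂ (deriv e z)).restrictScalars ℝ).det =
          normSq (deriv e z) := by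
        rw [← Algebra.norm_complex_apply, Algebra.norm_apply, ContinuousLinearMap.det]
        congr 1
        ext <;> simp [mul_comm]
      rw [this, abs_of_nonneg (normSq_nonneg _)]
    have hgoal : W j j k z = (normSq (deriv e z) : ℝ) • W k j k (e z) := by
      simp only [hW]
      rw [hkx', ← hx]
      by_cases hxP : x ∈ P
      -- At a singular point the transformation law of `a` is not available, but `ρ j` is locally
      -- constant and both sides vanish.
      · have h3 := dbar_chart_eq_zero hxj (hconst j x hxP)
        have h4 := dbar_chart_eq_zero hz'.2 (hconst j x hxP)
        rw [hjx] at h3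
        rw [h3, hkx, h4]
        simp
      · have h3 : dbar (fun w => ρ j ((chartAt ℂ j).symm w)) z =
            (starRingEnd ℂ) (deriv e z) * dbar (fun w => ρ j ((chartAt ℂ k).symm w)) (e z) := by
          rw [← dbar_comp (hder z hz)
            ((contDiffAt_comp_chart_symm_real (hρ j) (e.map_source hz |> fun h => by
              rw [htarget] at h; exact h.1)).differentiableAt (by simp))]
          refine dbar_congr ?_
          filter_upwards [e.open_source.mem_nhds hz] with w hw
          rw [hsource] at hw
          have : (chartAt ℂ k).symm (e w) = (chartAt ℂ j).symm w := (chartAt ℂ k).left_inv hw.2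
          rw [this]
        have h4 := trans j k x hxj hz'.2 hxP
        rw [hjx, ← hkx] at h4
        -- `∂̄(ρ j)` contributes the conjugate of `e'` and `a` contributes `e'`; their product
        -- `|e'|²` is the real Jacobian.
        rw [h3, h4, real_smul, ← mul_conj]
        ring
    rw [hgoal, hdet]
  -- Insert `∑ ρ k = 1`, move each term from chart `j` to chart `k`, and exchange the sums: for
  -- fixed `k` the sum over `j` is `∂̄` of the constant `1`.
  have hzero : ∑ j ∈ t, ∫ z, dbar (chartExtend (ρ j) j) z * a j z = 0 := by
    have h1 : ∀ j ∈ t, ∫ z, dbar (chartExtend (ρ j) j) z * a j z =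
        ∑ k ∈ t, ∫ z in (chartAt ℂ j).target, W j j k z := by
      intro j _
      rw [← integral_finsetSum _ fun k _ => hWint j j k (Or.inl rfl),
        ← setIntegral_eq_integral_of_forall_compl_eq_zero (s := (chartAt ℂ j).target)]
      · refine setIntegral_congr_fun (chartAt ℂ j).open_target.measurableSet fun z hz => ?_
        simp only [hW, ← Finset.sum_mul]
        rw [dbar_congr (chartExtend_eventuallyEq (ρ j) j hz)]
        rw [← Complex.ofReal_sum, hsum]
        simp
      · intro z hz
        have hz' : z ∉ tsupport (chartExtend (ρ j) j) := by
          intro h'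
          obtain ⟨x, hx, rfl⟩ := tsupport_chartExtend (hsupp j) h'
          exact hz ((chartAt ℂ j).map_source (hsupp j hx))
        rw [dbar_congr (notMem_tsupport_iff_eventuallyEq.1 hz')]
        change dbar (fun _ => 0) z * _ = 0
        rw [dbar_const, zero_mul]
    rw [Finset.sum_congr rfl h1]
    rw [Finset.sum_congr rfl fun j _ => Finset.sum_congr rfl fun k _ => hchange j k]
    rw [Finset.sum_comm]
    refine Finset.sum_eq_zero fun k _ => ?_
    rw [← integral_finsetSum _ fun j _ => hWint k j k (Or.inr rfl)]
    refine (setIntegral_congr_fun (g := fun _ => 0) (chartAt ℂ k).open_target.measurableSet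
      fun z hz => ?_).trans (by simp)
    simp only [hW, ← Finset.mul_sum, ← Finset.sum_mul]
    rw [← dbar_sum fun j _ => (contDiffAt_comp_chart_symm_real (hρ j) hz).differentiableAt (by simp)]
    simp only [hsum, dbar_const]
    simp
  simp only [hstokes] at hzero
  rw [Finset.sum_ite_mem, Finset.inter_eq_right.2 hPt, Finset.sum_neg_distrib, neg_eq_zero,
    ← Finset.mul_sum] at hzero
  exact (mul_eq_zero.1 hzero).resolve_left (by simp [Real.pi_ne_zero])

end ResidueTheorem

/-! ### Residues and primitives of meromorphic functions -/

section Residues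

/-- A small punctured neighbourhood is a neighbourhood of each of its points. This allows identities
valid near a pole to be differentiated. -/
lemma eventually_punctured_nhds {X : Type*} [TopologicalSpace X] [T1Space X] {x : X} {Q : X → Prop}
    (h : ∀ᶠ y in 𝓝[≠] x, Q y) : ∀ᶠ y in 𝓝[≠] x, ∀ᶠ w in 𝓝 y, Q w := by
  rw [eventually_nhdsWithin_iff] at h ⊢
  filter_upwards [h.eventually_nhds] with y hy hne
  filter_upwards [hy, isOpen_ne.mem_nhds hne] with w hw hwne using hw hwne

lemma eventually_sphere {z₀ : ℂ} {Q : ℂ → Prop} (h : ∀ᶠ z in 𝓝[≠] z₀, Q z) :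
    ∀ᶠ r : ℝ in 𝓝[>] 0, 0 < r ∧ ∀ z ∈ Metric.sphere z₀ r, Q z := by
  rw [eventually_nhdsWithin_iff] at h
  obtain ⟨ε, hε, hQ⟩ := Metric.eventually_nhds_iff.1 h
  filter_upwards [Ioo_mem_nhdsGT hε] with r hr
  refine ⟨hr.1, fun z hz => hQ (by rw [Metric.mem_sphere.1 hz]; exact hr.2) ?_⟩
  rintro rfl
  exact hr.1.ne (by simpa using! hz)

lemma HasResidueAt.congr {f g : ℂ → ℂ} {z₀ c : ℂ} (hf : HasResidueAt f z₀ c)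
    (h : f =ᶠ[𝓝[≠] z₀] g) : HasResidueAt g z₀ c := by
  filter_upwards [hf, eventually_sphere h] with r hr hs
  rw [← hr]
  exact circleIntegral.integral_congr hs.1.le fun z hz => (hs.2 z hz).symm

lemma HasResidueAt.unique {f : ℂ → ℂ} {z₀ c c' : ℂ} (h : HasResidueAt f z₀ c)
    (h' : HasResidueAt f z₀ c') : c = c' := by
  obtain ⟨r, hr, hr'⟩ := (h.and h').exists
  rw [hr] at hr'
  exact mul_left_cancel₀ (by simp [Real.pi_ne_zero]) hr'

/-- On a small circle `F` is a single-valued primitive, so its derivative integrates to zero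
whatever pole `F` has inside; only the term `c / (z - z₀)` survives. -/
lemma hasResidueAt_inv_add_deriv {F : ℂ → ℂ} {z₀ : ℂ} (c : ℂ) (hF : MeromorphicAt F z₀) :
    HasResidueAt (fun z => c * (z - z₀)⁻¹ + deriv F z) z₀ c := by
  filter_upwards [eventually_sphere hF.eventually_analyticAt] with r hr
  have h1 : CircleIntegrable (fun z => c * (z - z₀)⁻¹) z₀ r := by
    refine ContinuousOn.circleIntegrable hr.1.le (continuousOn_const.mul ?_)
    refine (continuousOn_id.sub continuousOn_const).inv₀ fun z hz h => ?_
    have h1 : dist z z₀ = r := hz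
    have h2 : z = z₀ := sub_eq_zero.1 h
    rw [h2, dist_self] at h1
    exact hr.1.ne h1
  have h2 : CircleIntegrable (deriv F) z₀ r :=
    ContinuousOn.circleIntegrable hr.1.le fun z hz => (hr.2 z hz).deriv.continuousAt.continuousWithinAt
  have h3 : (∮ z in C(z₀, r), deriv F z) = 0 :=
    circleIntegral.integral_eq_zero_of_hasDerivWithinAt hr.1.le fun z hz =>
      (hr.2 z hz).differentiableAt.hasDerivAt.hasDerivWithinAt
  rw [circleIntegral.integral_add h1 h2, h3, circleIntegral.integral_const_mul,
    circleIntegral.integral_sub_center_inv _ hr.1.ne']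
  ring

lemma hasResidueAt_deriv {F : ℂ → ℂ} {z₀ : ℂ} (hF : MeromorphicAt F z₀) :
    HasResidueAt (deriv F) z₀ 0 := by
  simpa using hasResidueAt_inv_add_deriv 0 hF

/-- An analytic function has a local primitive. -/
lemma exists_primitive {f : ℂ → ℂ} {z₀ : ℂ} (hf : AnalyticAt ℂ f z₀) :
    ∃ F : ℂ → ℂ, AnalyticAt ℂ F z₀ ∧ ∀ᶠ z in 𝓝 z₀, HasDerivAt F (f z) z := by
  obtain ⟨r, hr, hball⟩ := Metric.eventually_nhds_iff_ball.1 hf.eventually_analyticAt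
  have hd : DifferentiableOn ℂ f (Metric.ball z₀ r) := fun z hz =>
    (hball z hz).differentiableAt.differentiableWithinAt
  obtain ⟨F, hF⟩ := hd.isExactOn_ball
  refine ⟨F, ?_, ?_⟩
  · exact DifferentiableOn.analyticAt (s := Metric.ball z₀ r)
      (fun z hz => (hF z hz).differentiableAt.differentiableWithinAt) (Metric.ball_mem_nhds z₀ hr)
  · filter_upwards [Metric.ball_mem_nhds z₀ hr] with z hz using hF z hz

/-- The residue of a logarithmic derivative, twisted by an exponential, is the order. -/
lemma hasResidueAt_logDeriv {f g F : ℂ → ℂ} {z₀ : ℂ} (hg : MeromorphicAt g z₀)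
    (hg0 : meromorphicOrderAt g z₀ ≠ ⊤) (hF : MeromorphicAt F z₀)
    (hf : ∀ᶠ z in 𝓝[≠] z₀, f z = g z * exp (F z)) :
    HasResidueAt (logDeriv f) z₀ ((meromorphicOrderAt g z₀).untop₀ : ℤ) := by
  obtain ⟨n, hn⟩ := WithTop.ne_top_iff_exists.1 hg0
  obtain ⟨u, hu, hu0, hgu⟩ := (meromorphicOrderAt_eq_int_iff hg).1 hn.symm
  -- With `g = (z - z₀)ⁿ u`, the logarithmic derivative of `f` is `n / (z - z₀) + (F + U)'`. A pole
  -- of `F`, hence an essential singularity of `f`, contributes only to the exact part.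
  obtain ⟨U, hU, hUd⟩ := exists_primitive (hu.deriv.div hu hu0)
  rw [← hn, WithTop.untop₀_coe]
  refine (hasResidueAt_inv_add_deriv (n : ℂ) (hF.add hU.meromorphicAt)).congr ?_
  have hfg : ∀ᶠ z in 𝓝[≠] z₀, f z = (z - z₀) ^ n * u z * exp (F z) := by
    filter_upwards [hf, hgu] with z h1 h2
    rw [h1, h2, smul_eq_mul]
  filter_upwards [eventually_punctured_nhds hfg, self_mem_nhdsWithin, hF.eventually_analyticAt,
    nhdsWithin_le_nhds hUd, nhdsWithin_le_nhds hu.eventually_analyticAt,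
    nhdsWithin_le_nhds (hu.continuousAt.eventually_ne hu0)] with z h1 hz h2 h3 h4 h5
  have hne : z - z₀ ≠ 0 := sub_ne_zero.2 hz
  have hd1 : HasDerivAt (fun w => (w - z₀) ^ n) (n * (z - z₀) ^ (n - 1)) z := by
    simpa [Function.comp_def] using (hasDerivAt_zpow n (z - z₀) (Or.inl hne)).comp z ((hasDerivAt_id z).sub_const z₀)
  have hd := (hd1.mul h4.differentiableAt.hasDerivAt).mul h2.differentiableAt.hasDerivAt.cexp
  have hd' : deriv f z = _ := (hd.congr_of_eventuallyEq h1).deriv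
  have hf' : f z = (z - z₀) ^ n * u z * exp (F z) := h1.self_of_nhds
  have hsum : deriv (F + U) z = deriv F z + deriv u z / u z := by
    rw [(h2.differentiableAt.hasDerivAt.add h3).deriv]
    rfl
  have hz1 : (z - z₀) ^ (n - 1) = (z - z₀) ^ n * (z - z₀)⁻¹ := zpow_sub_one₀ hne n
  have hzn : (z - z₀) ^ n ≠ 0 := zpow_ne_zero n hne
  have hexp := exp_ne_zero (F z)
  rw [logDeriv_apply, hd', hf', hsum, hz1]
  simp only [Pi.mul_apply]
  field_simp
  ring

/-- A meromorphic function is the sum of its residue term and a derivative. -/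
lemma exists_eq_inv_add_deriv {a : ℂ → ℂ} {z₀ : ℂ} (ha : MeromorphicAt a z₀) :
    ∃ (c : ℂ) (F : ℂ → ℂ), MeromorphicAt F z₀ ∧
      ∀ᶠ z in 𝓝[≠] z₀, a z = c * (z - z₀)⁻¹ + deriv F z := by
  have key : ∀ (N : ℕ) (b : ℂ → ℂ), AnalyticAt ℂ b z₀ → ∃ (c : ℂ) (F : ℂ → ℂ),
      MeromorphicAt F z₀ ∧ ∀ᶠ z in 𝓝[≠] z₀,
        ((z - z₀) ^ N)⁻¹ * b z = c * (z - z₀)⁻¹ + deriv F z := by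
    intro N
    -- Induction on the pole order, peeling off the leading coefficient: `b = b(z₀) + (z - z₀)
    -- dslope b z₀`.
    induction N with
    | zero =>
      intro b hb
      obtain ⟨F, hF, hFd⟩ := exists_primitive hb
      refine ⟨0, F, hF.meromorphicAt, ?_⟩
      filter_upwards [nhdsWithin_le_nhds hFd] with z hz
      simp [hz.deriv]
    | succ N ih =>
      intro b hb
      have hb1 : AnalyticAt ℂ (dslope b z₀) z₀ := by
        obtain ⟨p, hp⟩ := hb
        exact ⟨_, hp.has_fpower_series_dslope_fslope⟩
      obtain ⟨c, F, hF, hcF⟩ := ih _ hb1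
      have hbs : ∀ z, b z = b z₀ + (z - z₀) * dslope b z₀ z := fun z => by
        have := sub_smul_dslope b z₀ z
        rw [smul_eq_mul] at this
        rw [this]; ring
      rcases Nat.eq_zero_or_pos N with rfl | hN
      -- The power `(z - z₀)⁻¹` is the only one without a primitive, so its coefficient goes into
      -- the residue.
      · refine ⟨b z₀ + c, F, hF, ?_⟩
        filter_upwards [hcF, self_mem_nhdsWithin] with z hz hne
        have hne' : z - z₀ ≠ 0 := sub_ne_zero.2 hne
        rw [hbs z]
        simp only [pow_zero, inv_one, one_mul] at hz
        rw [hz]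
        field_simp
        ring
      · set G : ℂ → ℂ := fun z => -(b z₀ / N) * ((z - z₀) ^ N)⁻¹ with hG
        have hGd : ∀ z, z ≠ z₀ → HasDerivAt G (b z₀ * ((z - z₀) ^ (N + 1))⁻¹) z := by
          intro z hz
          have hne' : z - z₀ ≠ 0 := sub_ne_zero.2 hz
          have hN' : (N : ℂ) ≠ 0 := by exact_mod_cast hN.ne'
          have h1 := ((((hasDerivAt_id z).sub_const z₀).pow N).inv (pow_ne_zero N hne')).const_mul
            (-(b z₀ / N))
          convert! h1 using 1
          obtain ⟨m, rfl⟩ : ∃ m, N = m + 1 := ⟨N - 1, by omega⟩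
          simp only [id, Nat.add_sub_cancel, Pi.pow_apply]
          field_simp
          ring
        refine ⟨c, fun z => G z + F z, ?_, ?_⟩
        · refine MeromorphicAt.add ?_ hF
          exact (MeromorphicAt.const _ _).mul
            (((analyticAt_id.sub analyticAt_const).pow N).meromorphicAt.inv)
        · filter_upwards [hcF, self_mem_nhdsWithin, hF.eventually_analyticAt] with z hz hne hFz
          have hne' : z - z₀ ≠ 0 := sub_ne_zero.2 hne
          rw [deriv_fun_add (hGd z hne).differentiableAt hFz.differentiableAt, (hGd z hne).deriv,
            hbs z, mul_add]
          have : ((z - z₀) ^ (N + 1))⁻¹ * ((z - z₀) * dslope b z₀ z) =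
              ((z - z₀) ^ N)⁻¹ * dslope b z₀ z := by
            rw [pow_succ, mul_inv]
            field_simp
          rw [this, hz]
          ring
  obtain ⟨N, hN⟩ := ha
  obtain ⟨c, F, hF, h⟩ := key N _ hN
  refine ⟨c, F, hF, ?_⟩
  filter_upwards [h, self_mem_nhdsWithin] with z hz hne
  rw [← hz, smul_eq_mul, inv_mul_cancel_left₀ (pow_ne_zero N (sub_ne_zero.2 hne))]

/-- A meromorphic function with zero residue has a meromorphic primitive. -/
lemma exists_primitive_of_hasResidueAt_zero {a : ℂ → ℂ} {z₀ : ℂ} (ha : MeromorphicAt a z₀)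
    (h : HasResidueAt a z₀ 0) :
    ∃ F : ℂ → ℂ, MeromorphicAt F z₀ ∧ ∀ᶠ z in 𝓝[≠] z₀, HasDerivAt F (a z) z := by
  obtain ⟨c, F, hF, hcF⟩ := exists_eq_inv_add_deriv ha
  have hc : c = 0 := ((hasResidueAt_inv_add_deriv c hF).congr
    (hcF.mono fun z hz => hz.symm)).unique h
  refine ⟨F, hF, ?_⟩
  filter_upwards [hcF, hF.eventually_analyticAt] with z hz hFz
  rw [hz, hc, zero_mul, zero_add]
  exact hFz.differentiableAt.hasDerivAt

end Residues

/-! ### The line bundle of an exp-algebraic structure has degree zero -/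

section Degree

/-- By compactness, finitely many neighbourhoods cover the space, and each meets `P` at most in its
centre. -/
lemma finite_of_eventually_notMem {X : Type*} [TopologicalSpace X] [CompactSpace X] {P : Set X} (h : ∀ x, ∀ᶠ y in 𝓝[≠] x, y ∉ P) :
    P.Finite := by
  choose U hU hUP using fun x => mem_nhdsWithin_iff_exists_mem_nhds_inter.1 (h x)
  obtain ⟨t, ht⟩ := finite_cover_nhds hU
  refine t.finite_toSet.subset fun y hy => ?_
  have hyU : y ∈ ⋃ x ∈ t, U x := by rw [ht]; trivial
  simp only [mem_iUnion] at hyU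
  obtain ⟨x, hx, hyx⟩ := hyU
  by_contra hyt
  exact hUP x ⟨hyx, fun h' => hyt (by rw [mem_singleton_iff.1 h']; exact hx)⟩ hy

variable {S : Type u} [TopologicalSpace S] [ChartedSpace ℂ S]

lemma eventually_chart {p : S} {Q : ℂ → Prop} (h : ∀ᶠ z in 𝓝[≠] (chartAt ℂ p p), Q z) :
    ∀ᶠ x in 𝓝[≠] p, Q (chartAt ℂ p x) := by
  rw [eventually_nhdsWithin_iff] at h ⊢
  filter_upwards [((chartAt ℂ p).continuousAt (mem_chart_source ℂ p)).eventually h,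
    chart_source_mem_nhds ℂ p] with x hx hxs hxp
  exact hx fun h => hxp ((chartAt ℂ p).injOn hxs (mem_chart_source ℂ p) h)

lemma eventually_chart_symm_punctured {p : S} {Q : S → Prop} (h : ∀ᶠ x in 𝓝[≠] p, Q x) :
    ∀ᶠ z in 𝓝[≠] (chartAt ℂ p p), Q ((chartAt ℂ p).symm z) := by
  rw [eventually_nhdsWithin_iff] at h ⊢
  filter_upwards [eventually_chart_symm (mem_chart_source ℂ p) h, chart_target_mem_nhds ℂ p]
    with z hz hzt hne
  refine hz fun h => hne ?_
  rw [mem_singleton_iff] at h ⊢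
  rw [← (chartAt ℂ p).right_inv hzt, h]

namespace ExpAlgStructure.LocalData

variable [T2Space S] {H : ExpAlgStructure S} (D : H.LocalData)

/-- The frames over `S'` and at `p` differ by the transition function `e^h`. Thus `s / s_𝓗` is a
meromorphic function times the exponential of one, the form required by `hasResidueAt_logDeriv`. -/
lemma quotientFun_eq_sectionCoeff (s : ∀ x, D.lineBundle.Fiber x) (p : S) {z : ℂ}
    (hzB : (chartAt ℂ p).symm z ∈ D.baseSet (D.core.indexAt p))
    (hzV : (chartAt ℂ p).symm z ∉ H.punctures) :
    D.quotientFun s ((chartAt ℂ p).symm z) = D.lineBundle.sectionCoeff s p z *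
      exp (D.exponent (D.core.indexAt p) ((chartAt ℂ p).symm z)) := by
  set y := (chartAt ℂ p).symm z with hy
  have h1 : D.lineBundle.sectionCoeff s p z =
    D.core.coordChange (D.core.indexAt y) (D.core.indexAt p) y (s y) := rfl
  have h2 : D.quotientFun s y = D.core.coordChange (D.core.indexAt y) none y (s y) := rfl
  have h3 := D.core.coordChange_comp (D.core.indexAt y) (D.core.indexAt p) none y
    ⟨⟨D.core.mem_baseSet_at y, hzB⟩, hzV⟩ (s y)
  rw [h1]
  refine h2.trans (h3.symm.trans ?_)
  change exp (D.exponent (D.core.indexAt p) y - D.exponent none y) * _ = _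
  simp [exponent, mul_comm]

lemma meromorphicAt_exponent (p : S) :
    MeromorphicAt (fun z => D.exponent (D.core.indexAt p) ((chartAt ℂ p).symm z))
      (chartAt ℂ p p) := by
  by_cases hp : p ∈ H.punctures
  · rw [D.indexAt_of_mem hp]
    exact D.meromorphic_h ⟨p, hp⟩
  · rw [D.indexAt_of_notMem hp]
    exact MeromorphicAt.const 0 _

lemma eventually_mem_baseSet (p : S) :
    ∀ᶠ x in 𝓝[≠] p, x ∈ D.baseSet (D.core.indexAt p) ∧ x ∉ H.punctures := by
  have h0 : ∀ᶠ x in 𝓝[≠] p, x ∈ D.baseSet (D.core.indexAt p) :=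
    nhdsWithin_le_nhds ((D.core.isOpen_baseSet _).mem_nhds (D.core.mem_baseSet_at p))
  have h : (H.punctures \ {p})ᶜ ∈ 𝓝 p :=
    (H.finite_support.subset sdiff_subset).isClosed.isOpen_compl.mem_nhds fun h => h.2 rfl
  filter_upwards [h0, nhdsWithin_le_nhds h, self_mem_nhdsWithin] with x hxB hx hxp
  exact ⟨hxB, fun hxH => hx ⟨hxH, hxp⟩⟩

end ExpAlgStructure.LocalData

variable [IsManifold 𝓘(ℂ) ω S] [CompactSpace S] [T2Space S]

/-- The residue theorem for the logarithmic derivative of a holomorphic function with isolated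
singularities on a compact Riemann surface. -/
theorem sum_residues_logDeriv_eq_zero (P : Finset S) (f : S → ℂ) (n : S → ℂ)
    (hol : ∀ x ∉ P, ContMDiffAt 𝓘(ℂ) 𝓘(ℂ) ω f x) (hne : ∀ x ∉ P, f x ≠ 0)
    (res : ∀ p ∈ P, HasResidueAt (logDeriv fun z => f ((chartAt ℂ p).symm z))
      (chartAt ℂ p p) (n p)) :
    ∑ p ∈ P, n p = 0 := by
  have hana : ∀ k x, x ∈ (chartAt ℂ k).source → x ∉ P →
      AnalyticAt ℂ (fun z => f ((chartAt ℂ k).symm z)) (chartAt ℂ k x) := fun k x hx hxP =>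
    analyticAt_comp_chart_symm ((chartAt ℂ k).map_source hx)
      (by rw [(chartAt ℂ k).left_inv hx]; exact hol x hxP)
  refine sum_residues_eq_zero P (fun k => logDeriv fun z => f ((chartAt ℂ k).symm z)) n
    (fun k x hx hxP => ?_) (fun j k x hj hk hxP => ?_) res
  · refine (hana k x hx hxP).deriv.div (hana k x hx hxP) ?_
    simp only [(chartAt ℂ k).left_inv hx]
    exact hne x hxP
  · set e := (chartAt ℂ j).symm ≫ₕ chartAt ℂ k with he
    have hsource : e.source = (chartAt ℂ j).target ∩ (chartAt ℂ j).symm ⁻¹' (chartAt ℂ k).source := by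
      rw [he, OpenPartialHomeomorph.trans_source]; rfl
    have hz : chartAt ℂ j x ∈ e.source := by
      rw [hsource]
      exact ⟨(chartAt ℂ j).map_source hj, by rwa [mem_preimage, (chartAt ℂ j).left_inv hj]⟩
    have hex : e (chartAt ℂ j x) = chartAt ℂ k x := by
      change chartAt ℂ k ((chartAt ℂ j).symm (chartAt ℂ j x)) = _
      rw [(chartAt ℂ j).left_inv hj]
    have h1 : (fun z => f ((chartAt ℂ j).symm z)) =ᶠ[𝓝 (chartAt ℂ j x)]
        (fun z => f ((chartAt ℂ k).symm z)) ∘ e := by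
      filter_upwards [e.open_source.mem_nhds hz] with w hw
      rw [hsource] at hw
      exact congrArg f ((chartAt ℂ k).left_inv hw.2).symm
    -- The chain rule for logarithmic derivatives is exactly the transformation law of the form
    -- `df/f`.
    have h2 := logDeriv_comp (x := chartAt ℂ j x) (g := e)
      (f := fun z => f ((chartAt ℂ k).symm z)) (by rw [hex]; exact (hana k x hk hxP).differentiableAt)
      (analyticAt_transition hz).differentiableAt
    rw [hex] at h2
    exact (logDeriv_congr_nhds h1).self_of_nhds.trans h2

namespace ExpAlgStructure.LocalData

variable {H : ExpAlgStructure S} (D : H.LocalData)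

/-- The line bundle `L_𝓗` has degree zero. -/
theorem hasDegree_zero : D.lineBundle.HasDegree 0 := by
  intro s hs hs0
  -- `f = s / s_𝓗`; the residues of `df/f` are the orders of `s`.
  set f := D.quotientFun s with hf
  have hquot : ∀ p : S, ∀ᶠ z in 𝓝[≠] (chartAt ℂ p p), f ((chartAt ℂ p).symm z) =
      D.lineBundle.sectionCoeff s p z *
        exp (D.exponent (D.core.indexAt p) ((chartAt ℂ p).symm z)) := fun p =>
    (eventually_chart_symm_punctured (D.eventually_mem_baseSet p)).mono fun z hz =>
      D.quotientFun_eq_sectionCoeff s p hz.1 hz.2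
  -- The punctures together with the points where `f` vanishes or fails to be holomorphic. They are
  -- isolated, hence finite in number.
  set P : Set S := {x | ¬ (x ∉ H.punctures ∧ ContMDiffAt 𝓘(ℂ) 𝓘(ℂ) ω f x ∧ f x ≠ 0)} with hPdef
  have hP : P.Finite := by
    refine finite_of_eventually_notMem fun p => ?_
    have h1 := (hs p).eventually_analyticAt
    have h2 := (D.meromorphicAt_exponent p).eventually_analyticAt
    have h3 := ((meromorphicOrderAt_ne_top_iff_eventually_ne_zero (hs p)).1 (hs0 p))
    have h4 := eventually_chart (((h1.and h2).and h3).and (eventually_punctured_nhds (hquot p)))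
    filter_upwards [h4, D.eventually_mem_baseSet p, nhdsWithin_le_nhds (chart_source_mem_nhds ℂ p)]
      with x hx hxB hxs
    obtain ⟨⟨⟨k1, k2⟩, k3⟩, k4⟩ := hx
    refine not_not.2 ⟨hxB.2, contMDiffAt_of_analyticAt hxs ((k1.mul k2.cexp').congr ?_), ?_⟩
    · exact k4.mono fun z hz => hz.symm
    · have := k4.self_of_nhds
      rw [(chartAt ℂ p).left_inv hxs] at this
      rw [this]
      exact mul_ne_zero k3 (exp_ne_zero _)
  have hgood : ∀ x ∉ hP.toFinset, x ∉ H.punctures ∧ ContMDiffAt 𝓘(ℂ) 𝓘(ℂ) ω f x ∧ f x ≠ 0 := by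
    intro x hx
    rw [Finite.mem_toFinset] at hx
    exact not_not.1 hx
  have hsum := sum_residues_logDeriv_eq_zero hP.toFinset f
    (fun p => ((D.lineBundle.sectionOrder s p).untop₀ : ℤ))
    (fun x hx => (hgood x hx).2.1) (fun x hx => (hgood x hx).2.2)
    (fun p _ => hasResidueAt_logDeriv (hs p) (hs0 p) (D.meromorphicAt_exponent p) (hquot p))
  rw [finsum_eq_sum_of_support_subset (s := hP.toFinset)]
  · exact_mod_cast hsum
  -- Outside `P` the function `f` is the coefficient of `s` off the centre and is holomorphic and
  -- nonzero, so the order is zero and such points do not enter the divisor.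
  · intro x hx
    by_contra hxP
    obtain ⟨h1, h2, h3⟩ := hgood x hxP
    apply hx
    have h4 : AnalyticAt ℂ (fun z => f ((chartAt ℂ x).symm z)) (chartAt ℂ x x) :=
      analyticAt_comp_chart_symm (mem_chart_target ℂ x)
        (by rw [(chartAt ℂ x).left_inv (mem_chart_source ℂ x)]; exact h2)
    have h5 : D.lineBundle.sectionCoeff s x =ᶠ[𝓝[≠] (chartAt ℂ x x)]
        fun z => f ((chartAt ℂ x).symm z) := by
      filter_upwards [hquot x] with z hz
      rw [hz, D.indexAt_of_notMem h1]
      simp [exponent]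
    have h6 : D.lineBundle.sectionOrder s x = 0 := by
      rw [HolomorphicLineBundle.sectionOrder, meromorphicOrderAt_congr h5, h4.meromorphicOrderAt_eq,
        h4.analyticOrderAt_eq_zero.2 (by
          simp only [(chartAt ℂ x).left_inv (mem_chart_source ℂ x)]; exact h3)]
      rfl
    simp [h6]

end ExpAlgStructure.LocalData

end Degree

/-! ### Tangent vectors and line bundles in charts -/

section Tangent

variable {S : Type u} [TopologicalSpace S] [ChartedSpace ℂ S] [IsManifold 𝓘(ℂ) ω S]

/-- The coordinate vector field `∂/∂z` of the chart at `p`. -/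
def coordVector (p : S) (z : ℂ) : TangentSpace 𝓘(ℂ) ((chartAt ℂ p).symm z) :=
  mfderiv 𝓘(ℂ) 𝓘(ℂ) (chartAt ℂ p).symm z (1 : ℂ)

lemma mdifferentiableAt_chart_symm {p : S} {z : ℂ} (hz : z ∈ (chartAt ℂ p).target) :
    MDifferentiableAt 𝓘(ℂ) 𝓘(ℂ) (chartAt ℂ p).symm z := by
  have : IsManifold 𝓘(ℂ) 1 S := IsManifold.of_le (n := ω) le_top
  exact mdifferentiableAt_atlas_symm (chart_mem_atlas ℂ p) hz

lemma mdifferentiableAt_chart {p x : S} (hx : x ∈ (chartAt ℂ p).source) :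
    MDifferentiableAt 𝓘(ℂ) 𝓘(ℂ) (chartAt ℂ p) x := by
  have : IsManifold 𝓘(ℂ) 1 S := IsManifold.of_le (n := ω) le_top
  exact mdifferentiableAt_atlas (chart_mem_atlas ℂ p) hx

/-- This converts manifold derivatives along `∂/∂z` into ordinary complex derivatives, so that
connections can be handled as differential equations in one variable. -/
lemma hasDerivAt_comp_chart_symm {g : S → ℂ} {p : S} {z : ℂ} (hz : z ∈ (chartAt ℂ p).target)
    (hg : MDifferentiableAt 𝓘(ℂ) 𝓘(ℂ) g ((chartAt ℂ p).symm z)) :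
    HasDerivAt (fun w => g ((chartAt ℂ p).symm w))
      (mvfderiv 𝓘(ℂ) g ((chartAt ℂ p).symm z) (coordVector p z)) z := by
  have hsymm := mdifferentiableAt_chart_symm hz
  have h1 := mvfderiv_comp_apply z hg hsymm (1 : ℂ)
  have h3 : mvfderiv 𝓘(ℂ) (g ∘ (chartAt ℂ p).symm) z (1 : ℂ) =
      fderiv ℂ (g ∘ (chartAt ℂ p).symm) z 1 := by
    rw [← mfderiv_eq_fderiv]
    rfl
  have h4 : mvfderiv 𝓘(ℂ) g ((chartAt ℂ p).symm z) (coordVector p z) =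
      deriv (fun w => g ((chartAt ℂ p).symm w)) z := by
    refine h1.symm.trans (h3.trans ?_)
    rw [fderiv_apply_one_eq_deriv]
    rfl
  rw [h4]
  exact (hg.comp z hsymm).differentiableAt.hasDerivAt

lemma coordVector_ne_zero {p : S} {z : ℂ} (hz : z ∈ (chartAt ℂ p).target) :
    coordVector p z ≠ 0 := by
  intro h
  have h1 := hasDerivAt_comp_chart_symm hz (mdifferentiableAt_chart ((chartAt ℂ p).map_target hz))
  rw [h, map_zero] at h1
  have h2 : HasDerivAt (fun w => chartAt ℂ p ((chartAt ℂ p).symm w)) 1 z := by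
    refine (hasDerivAt_id z).congr_of_eventuallyEq ?_
    filter_upwards [(chartAt ℂ p).open_target.mem_nhds hz] with w hw
    exact (chartAt ℂ p).right_inv hw
  exact zero_ne_one (h1.unique h2)

lemma eq_zero_of_apply_coordVector {E : Type*} [AddCommGroup E] [Module ℂ E] [TopologicalSpace E]
    {p : S} {z : ℂ} (hz : z ∈ (chartAt ℂ p).target)
    {T : TangentSpace 𝓘(ℂ) ((chartAt ℂ p).symm z) →L[ℂ] E} (h : T (coordVector p z) = 0) : T = 0 := by
  refine ContinuousLinearMap.ext fun v => ?_
  -- The tangent space is by definition a copy of `ℂ`; division there shows that `∂/∂z` spans it.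
  have key : ∀ a b : ℂ, b ≠ 0 → ∃ c : ℂ, a = c • b := fun a b hb =>
    ⟨a / b, (div_mul_cancel₀ a hb).symm⟩
  obtain ⟨c, hv⟩ : ∃ c : ℂ, v = c • coordVector p z := key v _ (coordVector_ne_zero hz)
  rw [hv, map_smul, h, smul_zero]
  rfl

/-- A function whose derivative vanishes near a point is constant near that point. -/
lemma eventually_eq_of_mvfderiv_eq_zero {g : S → ℂ} {x : S}
    (h : ∀ᶠ y in 𝓝 x, MDifferentiableAt 𝓘(ℂ) 𝓘(ℂ) g y ∧ mvfderiv 𝓘(ℂ) g y = 0) :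
    ∀ᶠ y in 𝓝 x, g y = g x := by
  have h1 : ∀ᶠ z in 𝓝 (chartAt ℂ x x), HasDerivAt (fun w => g ((chartAt ℂ x).symm w)) 0 z := by
    filter_upwards [eventually_chart_symm (mem_chart_source ℂ x) h, chart_target_mem_nhds ℂ x]
      with z hz hzt
    have := hasDerivAt_comp_chart_symm hzt hz.1
    rwa [hz.2] at this
  obtain ⟨r, hr, hball⟩ := Metric.eventually_nhds_iff_ball.1 h1
  have hc : ContinuousAt (chartAt ℂ x) x := (chartAt ℂ x).continuousAt (mem_chart_source ℂ x)
  filter_upwards [hc.eventually_mem (Metric.ball_mem_nhds _ hr), chart_source_mem_nhds ℂ x]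
    with y hy hys
  have h2 := (convex_ball (chartAt ℂ x x) r).is_const_of_fderivWithin_eq_zero (𝕜 := ℂ)
    (f := fun w => g ((chartAt ℂ x).symm w))
    (fun z hz => (hball z hz).differentiableAt.differentiableWithinAt)
    (fun z hz => by
      rw [fderivWithin_of_isOpen Metric.isOpen_ball hz, (hball z hz).hasFDerivAt.fderiv]
      ext; simp) hy (Metric.mem_ball_self hr)
  simpa [(chartAt ℂ x).left_inv hys, (chartAt ℂ x).left_inv (mem_chart_source ℂ x)] using h2

end Tangent

namespace HolomorphicLineBundle

variable {S : Type u} [TopologicalSpace S] [ChartedSpace ℂ S] (L : HolomorphicLineBundle S)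

/-- The domain of the trivialization of `L` at `p`. -/
def domain (p : S) : Set S := (trivializationAt ℂ L.Fiber p).baseSet

/-- The fibre coordinate of the trivialization of `L` at `p`. -/
def coord (p x : S) : L.Fiber x →L[ℂ] ℂ :=
  (trivializationAt ℂ L.Fiber p).continuousLinearMapAt ℂ x

lemma isOpen_domain (p : S) : IsOpen (L.domain p) := (trivializationAt ℂ L.Fiber p).open_baseSet

lemma mem_domain (p : S) : p ∈ L.domain p := FiberBundle.mem_baseSet_trivializationAt' p

lemma domain_mem_nhds (p : S) : L.domain p ∈ 𝓝 p := (L.isOpen_domain p).mem_nhds (L.mem_domain p)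

variable {L}

lemma coord_apply {p x : S} (hx : x ∈ L.domain p) (v : L.Fiber x) :
    L.coord p x v = (trivializationAt ℂ L.Fiber p ⟨x, v⟩).2 := by
  rw [coord, Trivialization.continuousLinearMapAt_apply_of_mem ℂ _ hx]

lemma coord_frame {p x : S} (hx : x ∈ L.domain p) : L.coord p x (L.frame p x) = 1 := by
  have h := (trivializationAt ℂ L.Fiber p).continuousLinearMapAt_symmL (R := ℂ) hx 1
  rwa [Trivialization.symmL_apply _ hx] at h

lemma coord_smul_frame {p x : S} (hx : x ∈ L.domain p) (v : L.Fiber x) :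
    L.coord p x v • L.frame p x = v := by
  have h := (trivializationAt ℂ L.Fiber p).symmL_continuousLinearMapAt (R := ℂ) hx v
  have h1 : L.frame p x = (trivializationAt ℂ L.Fiber p).symmL ℂ x 1 := by
    rw [Trivialization.symmL_apply _ hx, frame]
  rw [h1, ← map_smul, smul_eq_mul, mul_one]
  exact h

lemma coord_injective {p x : S} (hx : x ∈ L.domain p) : Function.Injective (L.coord p x) := by
  intro v w h
  rw [← coord_smul_frame hx v, ← coord_smul_frame hx w, h]

lemma coord_ne_zero {p x : S} (hx : x ∈ L.domain p) {v : L.Fiber x} (hv : v ≠ 0) :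
    L.coord p x v ≠ 0 := fun h => hv (coord_injective hx (by rw [h, map_zero]))

lemma frame_ne_zero {p x : S} (hx : x ∈ L.domain p) : L.frame p x ≠ 0 := by
  intro h
  have := coord_frame hx
  rw [h, map_zero] at this
  exact zero_ne_one this

lemma sectionCoeff_eq {p : S} {z : ℂ} (hz : (chartAt ℂ p).symm z ∈ L.domain p)
    (s : ∀ x, L.Fiber x) :
    L.sectionCoeff s p z = L.coord p ((chartAt ℂ p).symm z) (s ((chartAt ℂ p).symm z)) :=
  (coord_apply hz _).symm

lemma sectionDiffAt_iff {p x : S} (hx : x ∈ L.domain p) {s : ∀ x, L.Fiber x} :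
    L.SectionDiffAt s x ↔ MDifferentiableAt 𝓘(ℂ) 𝓘(ℂ) (fun y => L.coord p y (s y)) x := by
  have : ContMDiffVectorBundle 1 ℂ L.Fiber 𝓘(ℂ) := ContMDiffVectorBundle.of_le (n := ω) le_top
  refine ((trivializationAt ℂ L.Fiber p).mdifferentiableAt_section_iff 𝓘(ℂ) s hx).trans ?_
  refine Filter.EventuallyEq.mdifferentiableAt_iff ?_
  filter_upwards [(L.isOpen_domain p).mem_nhds hx] with y hy
  exact (coord_apply hy _).symm

lemma sectionDiffAt_frame {p x : S} (hx : x ∈ L.domain p) : L.SectionDiffAt (L.frame p) x := by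
  rw [sectionDiffAt_iff hx]
  refine (mdifferentiableAt_const (c := (1 : ℂ))).congr_of_eventuallyEq ?_
  filter_upwards [(L.isOpen_domain p).mem_nhds hx] with y hy using coord_frame hy

lemma sectionDiffAt_smul {p x : S} (hx : x ∈ L.domain p) {s : ∀ x, L.Fiber x} {g : S → ℂ}
    (hg : MDifferentiableAt 𝓘(ℂ) 𝓘(ℂ) g x) (hs : L.SectionDiffAt s x) :
    L.SectionDiffAt (g • s) x := by
  rw [sectionDiffAt_iff hx] at hs ⊢
  have : (fun y => L.coord p y ((g • s) y)) = fun y => g y * L.coord p y (s y) := by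
    funext y
    simp
  rw [this]
  exact hg.mul hs

lemma SectionDiffAt.congr {x : S} {s t : ∀ x, L.Fiber x} (hs : L.SectionDiffAt s x)
    (h : ∀ᶠ y in 𝓝 x, t y = s y) : L.SectionDiffAt t x := by
  rw [sectionDiffAt_iff (L.mem_domain x)] at hs ⊢
  refine hs.congr_of_eventuallyEq ?_
  filter_upwards [h] with y hy
  rw [hy]

end HolomorphicLineBundle

/-! ### Covariant derivatives in coordinates. -/

namespace MeromorphicConnection

open HolomorphicLineBundle

variable {S : Type u} [TopologicalSpace S] [ChartedSpace ℂ S] {L : HolomorphicLineBundle S}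
  (D : MeromorphicConnection L)

lemma isOpen_compl_poles [T1Space S] : IsOpen D.polesᶜ := D.finite_poles.isClosed.isOpen_compl

lemma eventually_notMem_poles [T1Space S] (p : S) : ∀ᶠ x in 𝓝[≠] p, x ∉ D.poles := by
  have h : (D.poles \ {p})ᶜ ∈ 𝓝 p :=
    (D.finite_poles.subset sdiff_subset).isClosed.isOpen_compl.mem_nhds fun h => h.2 rfl
  filter_upwards [nhdsWithin_le_nhds h, self_mem_nhdsWithin] with x hx hxp hxD using hx ⟨hxD, hxp⟩

variable [T1Space S]

lemma congr {s t : ∀ x, L.Fiber x} {x : S} (hx : x ∉ D.poles) (hs : L.SectionDiffAt s x)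
    (h : ∀ᶠ y in 𝓝 x, t y = s y) : D.toFun t x = D.toFun s x :=
  D.isCovariantDerivativeOn.congr_of_eventuallyEq (hs.congr h) hs
    (D.isOpen_compl_poles.mem_nhds hx) h

variable [IsManifold 𝓘(ℂ) ω S]

/-- A covariant derivative in coordinates: `∇(u e) = (u' + a u) dz ⊗ e`. -/
lemma coord_apply_coordVector {s : ∀ x, L.Fiber x} {p : S} {z : ℂ} (hz : z ∈ (chartAt ℂ p).target)
    (hzL : (chartAt ℂ p).symm z ∈ L.domain p) (hzD : (chartAt ℂ p).symm z ∉ D.poles)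
    (hs : L.SectionDiffAt s ((chartAt ℂ p).symm z)) :
    L.coord p ((chartAt ℂ p).symm z) (D.toFun s ((chartAt ℂ p).symm z) (coordVector p z)) =
      deriv (L.sectionCoeff s p) z + L.connectionCoeff D.toFun p z * L.sectionCoeff s p z := by
  set x := (chartAt ℂ p).symm z with hx
  set u : S → ℂ := fun y => L.coord p y (s y) with hu
  have hud : MDifferentiableAt 𝓘(ℂ) 𝓘(ℂ) u x := (sectionDiffAt_iff hzL).1 hs
  have hf := sectionDiffAt_frame hzL
  -- Locality replaces `s` by `u e`, which it equals only on the domain of the trivialization; the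
  -- Leibniz rule then gives both terms.
  have h1 : D.toFun s x = D.toFun (u • L.frame p) x := by
    refine D.congr hzD (sectionDiffAt_smul hzL hud hf) ?_
    filter_upwards [(L.isOpen_domain p).mem_nhds hzL] with y hy
    exact (coord_smul_frame hy (s y)).symm
  have h2 := D.isCovariantDerivativeOn.leibniz hf hud hzD
  have h3 : L.connectionCoeff D.toFun p z =
      L.coord p x (D.toFun (L.frame p) x (coordVector p z)) := (coord_apply hzL _).symm
  have h4 : mvfderiv 𝓘(ℂ) u x (coordVector p z) = deriv (L.sectionCoeff s p) z := by
    rw [← (hasDerivAt_comp_chart_symm hz hud).deriv]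
    refine Filter.EventuallyEq.deriv_eq ?_
    have : ContinuousAt (chartAt ℂ p).symm z := (chartAt ℂ p).continuousAt_symm hz
    filter_upwards [this.eventually_mem ((L.isOpen_domain p).mem_nhds hzL)] with w hw
    exact (sectionCoeff_eq hw s).symm
  have h5 : L.sectionCoeff s p z = u x := sectionCoeff_eq hzL s
  rw [h1, h2, h3, h5, ← h4]
  have h6 : L.coord p x ((u x • D.toFun (L.frame p) x +
      (mvfderiv 𝓘(ℂ) u x).smulRight (L.frame p x)) (coordVector p z)) =
      u x * L.coord p x (D.toFun (L.frame p) x (coordVector p z)) +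
        mvfderiv 𝓘(ℂ) u x (coordVector p z) * L.coord p x (L.frame p x) := by
    rw [add_apply, map_add, smul_apply, map_smul, ContinuousLinearMap.smulRight_apply, map_smul,
      smul_eq_mul, smul_eq_mul]
  rw [h6, coord_frame hzL]
  ring

/-- Horizontal sections in coordinates. -/
lemma toFun_eq_zero_iff {s : ∀ x, L.Fiber x} {p : S} {z : ℂ} (hz : z ∈ (chartAt ℂ p).target)
    (hzL : (chartAt ℂ p).symm z ∈ L.domain p) (hzD : (chartAt ℂ p).symm z ∉ D.poles)
    (hs : L.SectionDiffAt s ((chartAt ℂ p).symm z)) :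
    D.toFun s ((chartAt ℂ p).symm z) = 0 ↔
      deriv (L.sectionCoeff s p) z + L.connectionCoeff D.toFun p z * L.sectionCoeff s p z = 0 := by
  rw [← D.coord_apply_coordVector hz hzL hzD hs]
  constructor
  · intro h
    rw [h]
    simp
  · intro h
    exact eq_zero_of_apply_coordVector hz (coord_injective hzL (by rw [h, map_zero]))

end MeromorphicConnection

/-! ### Isomorphisms from horizontal frames -/

section PrincipalPart

variable {S : Type u} [TopologicalSpace S] [ChartedSpace ℂ S]

/-- Two functions have the same principal part if their difference extends holomorphically. -/
lemma principalPart_eq_iff {p : S} {f g : S → ℂ} (hf : MeromorphicFunAt p f)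
    (hg : MeromorphicFunAt p g) :
    principalPart p f hf = principalPart p g hg ↔ ∃ G : ℂ → ℂ, AnalyticAt ℂ G (chartAt ℂ p p) ∧
      ∀ᶠ z in 𝓝[≠] (chartAt ℂ p p),
        f ((chartAt ℂ p).symm z) - g ((chartAt ℂ p).symm z) = G z := by
  rw [principalPart, principalPart, Submodule.Quotient.eq]
  constructor
  · rintro ⟨F, hF, hFfg⟩
    refine ⟨_, hF, ?_⟩
    have h1 : F =ᶠ[𝓝[≠] p] f - g := Germ.coe_eq.1 hFfg
    filter_upwards [eventually_chart_symm_punctured h1] with z hz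
    exact hz.symm
  · rintro ⟨G, hG, hGfg⟩
    refine ⟨fun x => G (chartAt ℂ p x), hG.congr ?_, ?_⟩
    · filter_upwards [chart_target_mem_nhds ℂ p] with z hz
      rw [(chartAt ℂ p).right_inv hz]
    · refine Germ.coe_eq.2 ?_
      filter_upwards [eventually_chart hGfg, nhdsWithin_le_nhds (chart_source_mem_nhds ℂ p)]
        with x hx hxs
      rw [(chartAt ℂ p).left_inv hxs] at hx
      exact hx.symm

end PrincipalPart

section Iso

variable {S : Type u} [TopologicalSpace S] [ChartedSpace ℂ S]

namespace HolomorphicLineBundle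

variable {L L' : HolomorphicLineBundle S}

/-- The isomorphism between fibres of line bundles which maps one nonzero vector to another. -/
def fiberEquiv {x : S} {v : L.Fiber x} {w : L'.Fiber x} (hv : v ≠ 0) (hw : w ≠ 0) :
    L.Fiber x ≃L[ℂ] L'.Fiber x :=
  ContinuousLinearEquiv.equivOfInverse
    (((L.coord x x v)⁻¹ • L.coord x x).smulRight w)
    (((L'.coord x x w)⁻¹ • L'.coord x x).smulRight v)
    (fun u => by
      have h1 := coord_ne_zero (L.mem_domain x) hv
      have h2 := coord_ne_zero (L'.mem_domain x) hw
      refine coord_injective (L.mem_domain x) ?_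
      simp only [ContinuousLinearMap.smulRight_apply, smul_apply, map_smul, smul_eq_mul]
      field_simp)
    (fun u => by
      have h1 := coord_ne_zero (L.mem_domain x) hv
      have h2 := coord_ne_zero (L'.mem_domain x) hw
      refine coord_injective (L'.mem_domain x) ?_
      simp only [ContinuousLinearMap.smulRight_apply, smul_apply, map_smul, smul_eq_mul]
      field_simp)

lemma fiberEquiv_apply {x : S} {v : L.Fiber x} {w : L'.Fiber x} (hv : v ≠ 0) (hw : w ≠ 0) :
    fiberEquiv hv hw v = w := by
  have h1 := coord_ne_zero (L.mem_domain x) hv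
  change ((L.coord x x v)⁻¹ * L.coord x x v) • w = w
  rw [inv_mul_cancel₀ h1, one_smul]

/-- A fibrewise linear map is holomorphic if it maps frames to holomorphic sections. -/
lemma contMDiff_fiberwise (e : ∀ x, L.Fiber x →L[ℂ] L'.Fiber x)
    (h : ∀ x₀, ContMDiffAt 𝓘(ℂ) 𝓘(ℂ) ω (fun y => L'.coord x₀ y (e y (L.frame x₀ y))) x₀) :
    ContMDiff (𝓘(ℂ).prod 𝓘(ℂ)) (𝓘(ℂ).prod 𝓘(ℂ)) ω
      (fun v : TotalSpace ℂ L.Fiber => (⟨v.proj, e v.proj v.snd⟩ : TotalSpace ℂ L'.Fiber)) := by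
  intro v₀
  have hproj : ContMDiffAt (𝓘(ℂ).prod 𝓘(ℂ)) 𝓘(ℂ) ω
      (fun v : TotalSpace ℂ L.Fiber => v.proj) v₀ := contMDiffAt_proj L.Fiber
  refine contMDiffAt_totalSpace.2 ⟨hproj, ?_⟩
  have h1 : ContMDiffAt (𝓘(ℂ).prod 𝓘(ℂ)) 𝓘(ℂ) ω
      (fun v : TotalSpace ℂ L.Fiber => (trivializationAt ℂ L.Fiber v₀.proj v).2) v₀ :=
    (contMDiffAt_totalSpace.1 (contMDiffAt_id (x := v₀))).2
  -- In trivializations the map is `(y, t) ↦ (y, m(y) t)`, where `m` is the coefficient of the image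
  -- of the frame.
  have h2 := ((h v₀.proj).comp v₀ hproj).mul h1
  refine h2.congr_of_eventuallyEq ?_
  have h3 : ∀ᶠ v : TotalSpace ℂ L.Fiber in 𝓝 v₀, v.proj ∈ L.domain v₀.proj ∩ L'.domain v₀.proj :=
    hproj.continuousAt.eventually_mem
      (inter_mem (L.domain_mem_nhds v₀.proj) (L'.domain_mem_nhds v₀.proj))
  filter_upwards [h3] with v hv
  have h4 : (trivializationAt ℂ L.Fiber v₀.proj v).2 = L.coord v₀.proj v.proj v.snd :=
    (coord_apply hv.1 v.snd).symm
  have h5 : (trivializationAt ℂ L'.Fiber v₀.proj ⟨v.proj, e v.proj v.snd⟩).2 =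
    L'.coord v₀.proj v.proj (e v.proj v.snd) := (coord_apply hv.2 _).symm
  change (trivializationAt ℂ L'.Fiber v₀.proj ⟨v.proj, e v.proj v.snd⟩).2 =
    L'.coord v₀.proj v.proj (e v.proj (L.frame v₀.proj v.proj)) *
      (trivializationAt ℂ L.Fiber v₀.proj v).2
  rw [h4, h5]
  conv_lhs => rw [← coord_smul_frame hv.1 v.snd, map_smul, map_smul, smul_eq_mul]
  ring

/-- In frames the map is multiplication by a holomorphic function without zeros, so its inverse is
multiplication by the reciprocal. -/
lemma contMDiff_fiberwise_symm (e : ∀ x, L.Fiber x ≃L[ℂ] L'.Fiber x)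
    (h : ∀ x₀, ContMDiffAt 𝓘(ℂ) 𝓘(ℂ) ω (fun y => L'.coord x₀ y (e y (L.frame x₀ y))) x₀) :
    ContMDiff (𝓘(ℂ).prod 𝓘(ℂ)) (𝓘(ℂ).prod 𝓘(ℂ)) ω
      (fun v : TotalSpace ℂ L'.Fiber =>
        (⟨v.proj, (e v.proj).symm v.snd⟩ : TotalSpace ℂ L.Fiber)) := by
  refine contMDiff_fiberwise (fun x => ((e x).symm : L'.Fiber x →L[ℂ] L.Fiber x)) fun x₀ => ?_
  have hne : ∀ y ∈ L.domain x₀ ∩ L'.domain x₀, L'.coord x₀ y (e y (L.frame x₀ y)) ≠ 0 := by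
    intro y hy
    refine coord_ne_zero hy.2 fun h0 => frame_ne_zero hy.1 ?_
    exact (e y).injective (by rw [h0, map_zero])
  have h1 := (h x₀).inv₀ (hne x₀ ⟨L.mem_domain x₀, L'.mem_domain x₀⟩)
  refine h1.congr_of_eventuallyEq ?_
  filter_upwards [inter_mem (L.domain_mem_nhds x₀) (L'.domain_mem_nhds x₀)] with y hy
  refine eq_inv_of_mul_eq_one_left ?_
  have h2 := coord_smul_frame hy.2 (e y (L.frame x₀ y))
  have h3 : L'.coord x₀ y (e y (L.frame x₀ y)) • (e y).symm (L'.frame x₀ y) = L.frame x₀ y := by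
    rw [← map_smul, h2, ContinuousLinearEquiv.symm_apply_apply]
  have h4 := congrArg (L.coord x₀ y) h3
  rw [map_smul, coord_frame hy.1, smul_eq_mul, mul_comm] at h4
  exact h4

end HolomorphicLineBundle

namespace LineBundleWithConnection

open HolomorphicLineBundle

/-- A nowhere vanishing horizontal section off the poles. -/
def IsHorizontalFrame (X : LineBundleWithConnection S) (σ : ∀ x, X.bundle.Fiber x) : Prop :=
  ∀ x ∉ X.conn.poles, X.bundle.SectionDiffAt σ x ∧ X.conn.toFun σ x = 0 ∧ σ x ≠ 0

/-- Complex differentiability near a point already gives analyticity. Horizontal sections are only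
assumed differentiable, and this makes them holomorphic. -/
lemma contMDiffAt_of_eventually_mdifferentiableAt [IsManifold 𝓘(ℂ) ω S] {f : S → ℂ} {x : S}
    (h : ∀ᶠ y in 𝓝 x, MDifferentiableAt 𝓘(ℂ) 𝓘(ℂ) f y) : ContMDiffAt 𝓘(ℂ) 𝓘(ℂ) ω f x := by
  refine contMDiffAt_of_analyticAt (mem_chart_source ℂ x) ?_
  rw [analyticAt_iff_eventually_differentiableAt]
  filter_upwards [eventually_chart_symm (mem_chart_source ℂ x) h, chart_target_mem_nhds ℂ x]
    with z hz hzt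
  exact (hasDerivAt_comp_chart_symm hzt hz).differentiableAt

variable {X Y : LineBundleWithConnection S} [T2Space S]

/-- The covariant derivative of a multiple of a horizontal section. -/
lemma IsHorizontalFrame.toFun_smul {σ : ∀ x, X.bundle.Fiber x} (hσ : X.IsHorizontalFrame σ)
    {x : S} (hx : x ∉ X.conn.poles) {f : S → ℂ} (hf : MDifferentiableAt 𝓘(ℂ) 𝓘(ℂ) f x)
    {s : ∀ x, X.bundle.Fiber x} (hs : ∀ᶠ y in 𝓝 x, s y = f y • σ y) (v : TangentSpace 𝓘(ℂ) x) :
    X.conn.toFun s x v = mvfderiv 𝓘(ℂ) f x v • σ x := by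
  have hd := sectionDiffAt_smul (X.bundle.mem_domain x) hf (hσ x hx).1
  rw [X.conn.congr hx hd hs, X.conn.isCovariantDerivativeOn.leibniz (hσ x hx).1 hf hx,
    (hσ x hx).2.1, smul_zero, zero_add]
  rfl

variable [IsManifold 𝓘(ℂ) ω S]

lemma IsHorizontalFrame.contMDiffAt_coord {σ : ∀ x, X.bundle.Fiber x} (hσ : X.IsHorizontalFrame σ)
    {x : S} (hx : x ∉ X.conn.poles) :
    ContMDiffAt 𝓘(ℂ) 𝓘(ℂ) ω (fun y => X.bundle.coord x y (σ y)) x := by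
  refine contMDiffAt_of_eventually_mdifferentiableAt ?_
  filter_upwards [X.conn.isOpen_compl_poles.mem_nhds hx, X.bundle.domain_mem_nhds x] with y hy hyL
  exact (sectionDiffAt_iff hyL).1 (hσ y hy).1

/-- Two pairs with horizontal frames off the same poles are isomorphic if the frames differ by a
holomorphic factor near each pole. -/
theorem nonempty_iso_of_isHorizontalFrame {σ : ∀ x, X.bundle.Fiber x} {τ : ∀ x, Y.bundle.Fiber x}
    (hσ : X.IsHorizontalFrame σ) (hτ : Y.IsHorizontalFrame τ)
    (hpoles : X.conn.poles = Y.conn.poles)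
    (h : ∀ p ∈ X.conn.poles, ∃ v : ℂ → ℂ, AnalyticAt ℂ v (chartAt ℂ p p) ∧ v (chartAt ℂ p p) ≠ 0 ∧
      ∀ᶠ z in 𝓝[≠] (chartAt ℂ p p),
        Y.bundle.sectionCoeff τ p z = v z * X.bundle.sectionCoeff σ p z) :
    Nonempty (Iso X Y) := by
  classical
  choose! v hva hv0 hv using h
  have hτ' : ∀ x ∉ X.conn.poles, τ x ≠ 0 := fun x hx => (hτ x (hpoles ▸ hx)).2.2
  have hvf : ∀ x ∈ X.conn.poles, v x (chartAt ℂ x x) • Y.bundle.frame x x ≠ 0 := fun x hx =>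
    smul_ne_zero (hv0 x hx) (frame_ne_zero (Y.bundle.mem_domain x))
  -- Off the poles `σ` goes to `τ`. At a pole the frames `σ` and `τ` give nothing, and continuity
  -- forces the factor to be the value of `v` there.
  let e : ∀ x, X.bundle.Fiber x ≃L[ℂ] Y.bundle.Fiber x := fun x =>
    if hx : x ∈ X.conn.poles then
      fiberEquiv (frame_ne_zero (X.bundle.mem_domain x)) (hvf x hx)
    else fiberEquiv (hσ x hx).2.2 (hτ' x hx)
  have he : ∀ x ∉ X.conn.poles, e x (σ x) = τ x := by
    intro x hx
    simp only [e, dif_neg hx]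
    exact fiberEquiv_apply _ _
  have hep : ∀ p ∈ X.conn.poles,
      e p (X.bundle.frame p p) = v p (chartAt ℂ p p) • Y.bundle.frame p p := by
    intro x hx
    simp only [e, dif_pos hx]
    exact fiberEquiv_apply _ _
  -- the isomorphism in coordinates
  have hcoord : ∀ x₀ y, y ∉ X.conn.poles → y ∈ X.bundle.domain x₀ →
      Y.bundle.coord x₀ y (e y (X.bundle.frame x₀ y)) =
        Y.bundle.coord x₀ y (τ y) / X.bundle.coord x₀ y (σ y) := by
    intro x₀ y hy hyX
    have h0 := coord_ne_zero hyX (hσ y hy).2.2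
    rw [eq_div_iff h0, ← he y hy]
    conv_rhs => rw [← coord_smul_frame hyX (σ y), map_smul, map_smul, smul_eq_mul]
    ring
  have hsmooth : ∀ x₀, ContMDiffAt 𝓘(ℂ) 𝓘(ℂ) ω
      (fun y => Y.bundle.coord x₀ y (e y (X.bundle.frame x₀ y))) x₀ := by
    intro x₀
    by_cases hx : x₀ ∈ X.conn.poles
    · have h1 : ContMDiffAt 𝓘(ℂ) 𝓘(ℂ) ω (fun y => v x₀ (chartAt ℂ x₀ y)) x₀ := by
        refine contMDiffAt_of_analyticAt (mem_chart_source ℂ x₀) ((hva x₀ hx).congr ?_)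
        filter_upwards [chart_target_mem_nhds ℂ x₀] with z hz
        rw [(chartAt ℂ x₀).right_inv hz]
      refine h1.congr_of_eventuallyEq ?_
      have h2 := eventually_chart (hv x₀ hx)
      have h3 := X.conn.eventually_notMem_poles x₀
      rw [eventually_nhdsWithin_iff] at h2 h3
      filter_upwards [h2, h3, X.bundle.domain_mem_nhds x₀, Y.bundle.domain_mem_nhds x₀,
        chart_source_mem_nhds ℂ x₀] with y k2 k3 hyX hyY hys
      by_cases hyx : y = x₀
      · subst hyx
        rw [hep y hx, map_smul, coord_frame hyY, smul_eq_mul, mul_one]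
      · have k4 := k2 hyx
        rw [hcoord x₀ y (k3 hyx) hyX, div_eq_iff (coord_ne_zero hyX (hσ y (k3 hyx)).2.2)]
        have hyl := (chartAt ℂ x₀).left_inv hys
        rw [sectionCoeff_eq (by rwa [hyl]), sectionCoeff_eq (by rwa [hyl]), hyl] at k4
        exact k4
    · have h1 := (hτ.contMDiffAt_coord (hpoles ▸ hx)).div₀ (hσ.contMDiffAt_coord hx)
        (coord_ne_zero (X.bundle.mem_domain x₀) (hσ x₀ hx).2.2)
      refine h1.congr_of_eventuallyEq ?_
      filter_upwards [X.conn.isOpen_compl_poles.mem_nhds hx, X.bundle.domain_mem_nhds x₀]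
        with y hy hyX
      exact hcoord x₀ y hy hyX
  refine ⟨{
    equiv := e
    holomorphic := contMDiff_fiberwise (fun x => (e x : X.bundle.Fiber x →L[ℂ] Y.bundle.Fiber x))
      hsmooth
    holomorphic_symm := contMDiff_fiberwise_symm e hsmooth
    poles_eq := hpoles
    map_conn := fun s x hx hs w => ?_ }⟩
  -- `f = s / σ` near `x`. Both connections differentiate only `f`, since `σ` and `τ` are
  -- horizontal.
  set f : S → ℂ := fun y => X.bundle.coord x y (s y) / X.bundle.coord x y (σ y) with hf
  have hfd : MDifferentiableAt 𝓘(ℂ) 𝓘(ℂ) f x := by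
    have h1 := (sectionDiffAt_iff (X.bundle.mem_domain x)).1 hs
    have h2 := (sectionDiffAt_iff (X.bundle.mem_domain x)).1 (hσ x hx).1
    have h3 := coord_ne_zero (X.bundle.mem_domain x) (hσ x hx).2.2
    have h4 : MDifferentiableAt 𝓘(ℂ) 𝓘(ℂ) (fun y => (X.bundle.coord x y (σ y))⁻¹) x :=
      (differentiableAt_inv h3).mdifferentiableAt.comp x h2
    simpa only [hf, div_eq_mul_inv] using! h1.mul h4
  have hsf : ∀ᶠ y in 𝓝 x, y ∉ X.conn.poles ∧ s y = f y • σ y := by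
    filter_upwards [X.conn.isOpen_compl_poles.mem_nhds hx, X.bundle.domain_mem_nhds x] with y hy hyX
    refine ⟨hy, coord_injective hyX ?_⟩
    rw [map_smul, smul_eq_mul, hf, div_mul_cancel₀ _ (coord_ne_zero hyX (hσ y hy).2.2)]
  have hsf' : ∀ᶠ y in 𝓝 x, e y (s y) = f y • τ y := by
    filter_upwards [hsf] with y hy
    rw [hy.2, map_smul, he y hy.1]
  rw [hσ.toFun_smul hx hfd (hsf.mono fun y hy => hy.2), hτ.toFun_smul (hpoles ▸ hx) hfd hsf',
    map_smul, he x hx]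

end LineBundleWithConnection

end Iso

/-! ### The pair of an exp-algebraic structure -/

namespace ExpAlgStructure.LocalData

open HolomorphicLineBundle LineBundleWithConnection

variable {S : Type u} [TopologicalSpace S] [ChartedSpace ℂ S] [T2Space S]
  {H : ExpAlgStructure S} (D : H.LocalData)

lemma domain_eq {x : S} (hx : x ∉ H.punctures) : D.lineBundle.domain x = H.puncturesᶜ := by
  change D.baseSet (D.core.indexAt x) = _
  rw [D.indexAt_of_notMem hx]
  rfl

lemma coord_eq_quotientFun {x y : S} (hx : x ∉ H.punctures) (hy : y ∉ H.punctures)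
    (s : ∀ x, D.lineBundle.Fiber x) : D.lineBundle.coord x y (s y) = D.quotientFun s y := by
  have hy' : y ∈ D.lineBundle.domain x := by rw [D.domain_eq hx]; exact hy
  rw [coord_apply hy']
  change D.core.coordChange (D.core.indexAt y) (D.core.indexAt x) y (s y) =
    D.core.coordChange (D.core.indexAt y) none y (s y)
  rw [D.indexAt_of_notMem hx]

lemma quotientFun_horizontalSection {x : S} (hx : x ∉ H.punctures) :
    D.quotientFun D.horizontalSection x = 1 := by
  rw [D.quotientFun_of_notMem _ hx, D.horizontalSection_of_notMem hx]

/-- The comparison of the two frames, applied to the section whose coefficient over `S'` is `1`. -/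
lemma sectionCoeff_horizontalSection (p : S) : ∀ᶠ z in 𝓝[≠] (chartAt ℂ p p),
    D.lineBundle.sectionCoeff D.horizontalSection p z =
      exp (-D.exponent (D.core.indexAt p) ((chartAt ℂ p).symm z)) := by
  filter_upwards [eventually_chart_symm_punctured (D.eventually_mem_baseSet p)] with z hz
  have h := D.quotientFun_eq_sectionCoeff D.horizontalSection p hz.1 hz.2
  rw [D.quotientFun_horizontalSection hz.2] at h
  rw [Complex.exp_neg]
  exact eq_inv_of_mul_eq_one_left h.symm

lemma exponent_of_mem (p : H.punctures) : D.exponent (D.core.indexAt (p : S)) = D.h p := by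
  rw [D.indexAt_of_mem p.2]
  rfl

variable [IsManifold 𝓘(ℂ) ω S]

lemma poles_pair : D.pair.conn.poles = H.punctures := D.poles_connectionFun

lemma isHorizontalFrame_horizontalSection : D.pair.IsHorizontalFrame D.horizontalSection := by
  intro x hx
  rw [D.poles_pair] at hx
  have hev : D.quotientFun D.horizontalSection =ᶠ[𝓝 x] fun _ => 1 := by
    filter_upwards [(isOpen_compl_punctures H).mem_nhds hx] with y hy
    exact D.quotientFun_horizontalSection hy
  refine ⟨?_, ?_, ?_⟩
  · refine (sectionDiffAt_iff (D.lineBundle.mem_domain x)).2 ?_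
    refine (mdifferentiableAt_const (c := (1 : ℂ))).congr_of_eventuallyEq ?_
    filter_upwards [(isOpen_compl_punctures H).mem_nhds hx, hev] with y hy hy1
    exact (D.coord_eq_quotientFun hx hy _).trans hy1
  · have h1 : mvfderiv 𝓘(ℂ) (D.quotientFun D.horizontalSection) x = 0 := by
      have h2 := hev.mfderiv_eq (I := 𝓘(ℂ)) (I' := 𝓘(ℂ))
      have h3 : mfderiv 𝓘(ℂ) 𝓘(ℂ) (fun _ : S => (1 : ℂ)) x = 0 := mfderiv_const
      rw [h3] at h2
      refine ContinuousLinearMap.ext fun v => ?_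
      exact congrArg (fun T : TangentSpace 𝓘(ℂ) x →L[ℂ] ℂ => T v) h2
    change (mvfderiv 𝓘(ℂ) (D.quotientFun D.horizontalSection) x).smulRight
      (D.horizontalSection x) = 0
    rw [h1]
    refine ContinuousLinearMap.ext fun v => ?_
    exact zero_smul ℂ (D.horizontalSection x)
  · rw [D.horizontalSection_of_notMem hx]
    exact one_ne_zero (α := ℂ)

lemma connectionCoeff_pair (p : H.punctures) :
    D.pair.bundle.connectionCoeff D.pair.conn.toFun p =ᶠ[𝓝[≠] (chartAt ℂ (p : S) p)]
      deriv (fun w => D.h p ((chartAt ℂ (p : S)).symm w)) := D.connectionCoeff_of_mem p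

/-- The connection form at a puncture is `dh`, and `h` has a genuine pole there; differentiation
raises its order by one. -/
lemma polesOrderAtLeastTwo : D.pair.conn.PolesOrderAtLeastTwo := by
  intro p hp
  rw [D.poles_pair] at hp
  have hlt := D.order_lt_zero ⟨p, hp⟩
  rw [connectionOrder, meromorphicOrderAt_congr (D.connectionCoeff_pair ⟨p, hp⟩)]
  obtain ⟨n, hn⟩ := WithTop.ne_top_iff_exists.1 hlt.ne_top
  rw [← hn] at hlt
  have hn0 : n < 0 := by exact_mod_cast hlt
  rw [meromorphicOrderAt_deriv_eq_sub_one (n := n) (by exact_mod_cast hn0.ne) hn.symm]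
  exact_mod_cast (by omega : n - 1 ≤ -2)

lemma residuesZero : D.pair.conn.ResiduesZero := by
  intro p hp
  rw [D.poles_pair] at hp
  exact (hasResidueAt_deriv (D.meromorphic_h ⟨p, hp⟩)).congr (D.connectionCoeff_pair ⟨p, hp⟩).symm

/-- The coordinate over `S'`, that is the quotient by `s_𝓗`, is locally constant along a parallel
family. The unit interval is connected, so it has the same value at both ends. -/
lemma hasTrivialMonodromy : D.pair.conn.HasTrivialMonodromy := by
  intro Γ hΓ hΓp hpar hloop
  rw [D.poles_pair] at hΓp
  set q : unitInterval → ℂ := fun t => (D.core.localTriv none (Γ t)).2 with hq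
  have hqs : ∀ (s : ∀ x, D.lineBundle.Fiber x) t, (Γ t).snd = s (Γ t).proj →
      q t = D.quotientFun s (Γ t).proj := by
    intro s t hst
    rw [quotientFun, ← hst]
    rfl
  have hloc : IsLocallyConstant q := by
    rw [IsLocallyConstant.iff_eventually_eq]
    intro t
    obtain ⟨s, hs, hst⟩ := hpar t
    have h1 : ∀ᶠ y in 𝓝 (Γ t).proj, D.quotientFun s y = D.quotientFun s (Γ t).proj := by
      refine eventually_eq_of_mvfderiv_eq_zero ?_
      filter_upwards [hs, (isOpen_compl_punctures H).mem_nhds (hΓp t)] with y hy hyH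
      refine ⟨D.differentiableAt_quotientFun hyH hy.1, ?_⟩
      refine ContinuousLinearMap.ext fun v => ?_
      have h2 : mvfderiv 𝓘(ℂ) (D.quotientFun s) y v • D.horizontalSection y = 0 :=
        congrArg (fun T : TangentSpace 𝓘(ℂ) y →L[ℂ] D.lineBundle.Fiber y => T v) hy.2
      rw [D.horizontalSection_of_notMem hyH] at h2
      exact (smul_eq_zero.1 h2).resolve_right (one_ne_zero (α := ℂ))
    filter_upwards [hst, hΓ.continuousAt.eventually h1] with t' h2 h3
    rw [hqs s t' h2, hqs s t hst.self_of_nhds]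
    exact h3
  have h01 : q 0 = q 1 := hloc.apply_eq_of_isPreconnected isPreconnected_univ (mem_univ _) (mem_univ _)
  have hx : (Γ 0).proj ∈ (D.core.localTriv none).baseSet := hΓp 0
  have hx1 : (Γ 1).proj ∈ (D.core.localTriv none).baseSet := hΓp 1
  refine (D.core.localTriv none).injOn ((D.core.localTriv none).mem_source.2 hx)
    ((D.core.localTriv none).mem_source.2 hx1) ?_
  refine Prod.ext ?_ h01
  exact ((D.core.localTriv none).coe_fst ((D.core.localTriv none).mem_source.2 hx)).trans
    (hloop.trans ((D.core.localTriv none).coe_fst ((D.core.localTriv none).mem_source.2 hx1)).symm)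

/-- The pair `(L_𝓗, ∇_𝓗)` is admissible. -/
theorem admissible_pair [CompactSpace S] : D.pair.Admissible where
  degree_zero := D.hasDegree_zero
  order_ge_two := D.polesOrderAtLeastTwo
  residues_zero := D.residuesZero
  trivial_monodromy := D.hasTrivialMonodromy

/-- A pair is isomorphic to `(L_𝓗, ∇_𝓗)` if it has a horizontal frame off the punctures with
essential singularities `e^{-h}`. -/
theorem nonempty_iso_pair {X : LineBundleWithConnection S} {σ : ∀ x, X.bundle.Fiber x}
    (hσ : X.IsHorizontalFrame σ) (hpoles : X.conn.poles = H.punctures)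
    (h : ∀ p ∈ H.punctures, ∃ (g : S → ℂ) (hg : MeromorphicFunAt p g) (c : ℂ), c ≠ 0 ∧
      principalPart p g hg = H.part p ∧ ∀ᶠ z in 𝓝[≠] (chartAt ℂ p p),
        X.bundle.sectionCoeff σ p z = c * exp (-g ((chartAt ℂ p).symm z))) :
    Nonempty (Iso D.pair X) := by
  refine nonempty_iso_of_isHorizontalFrame D.isHorizontalFrame_horizontalSection hσ
    (D.poles_pair.trans hpoles.symm) fun p hp => ?_
  rw [D.poles_pair] at hp
  obtain ⟨g, hg, c, hc, hgp, hσp⟩ := h p hp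
  rw [← D.principalPart_h ⟨p, hp⟩] at hgp
  obtain ⟨G, hG, hGp⟩ := (principalPart_eq_iff hg (D.meromorphic_h ⟨p, hp⟩)).1 hgp
  -- The ratio of `c e^{-g}` to `e^{-h}`, with `g - h = G` holomorphic.
  refine ⟨fun z => c * exp (-G z), analyticAt_const.mul hG.neg.cexp',
    mul_ne_zero hc (exp_ne_zero _), ?_⟩
  filter_upwards [hσp, hGp, D.sectionCoeff_horizontalSection p] with z h1 h2 h3
  have h4 := D.exponent_of_mem ⟨p, hp⟩
  simp only at h4
  rw [h4] at h3
  rw [h1, ← h2]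
  change _ = _ * D.lineBundle.sectionCoeff D.horizontalSection p z
  rw [h3, mul_assoc, ← Complex.exp_add]
  ring_nf

/-- The isomorphism class of `(L_𝓗, ∇_𝓗)` depends only on `𝓗`. -/
theorem nonempty_iso_pair_pair (D' : H.LocalData) : Nonempty (Iso D.pair D'.pair) := by
  refine D.nonempty_iso_pair D'.isHorizontalFrame_horizontalSection D'.poles_pair fun p hp => ?_
  refine ⟨D'.h ⟨p, hp⟩, D'.meromorphic_h ⟨p, hp⟩, 1, one_ne_zero, D'.principalPart_h ⟨p, hp⟩, ?_⟩
  filter_upwards [D'.sectionCoeff_horizontalSection p] with z hz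
  have h4 := D'.exponent_of_mem ⟨p, hp⟩
  simp only at h4
  rw [h4] at hz
  rw [one_mul]
  exact hz

end ExpAlgStructure.LocalData

/-! ### Recovering principal parts from the isomorphism class. -/

section Injectivity

/-- A meromorphic function whose derivative extends holomorphically extends holomorphically. -/
lemma exists_analyticAt_of_deriv {f w : ℂ → ℂ} {z₀ : ℂ} (hf : MeromorphicAt f z₀)
    (hw : AnalyticAt ℂ w z₀) (h : deriv f =ᶠ[𝓝[≠] z₀] w) :
    ∃ G : ℂ → ℂ, AnalyticAt ℂ G z₀ ∧ f =ᶠ[𝓝[≠] z₀] G := by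
  refine (MeromorphicAt.meromorphicOrderAt_nonneg_iff hf).1 ?_
  by_contra hneg
  have hlt := not_le.1 hneg
  obtain ⟨n, hn⟩ := WithTop.ne_top_iff_exists.1 hlt.ne_top
  rw [← hn] at hlt
  have hn0 : n < 0 := by exact_mod_cast hlt
  -- A pole of `f` would persist in its derivative, with order `n - 1 < 0`.
  have h1 := meromorphicOrderAt_deriv_eq_sub_one (n := n) (by exact_mod_cast hn0.ne) hn.symm
  rw [meromorphicOrderAt_congr h] at h1
  have h2 := hw.meromorphicOrderAt_nonneg
  rw [h1] at h2
  have : 0 ≤ n - 1 := by exact_mod_cast h2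
  omega

variable {S : Type u} [TopologicalSpace S] [ChartedSpace ℂ S] [T2Space S] [IsManifold 𝓘(ℂ) ω S]

open HolomorphicLineBundle

/-- Isomorphic pairs have connection forms which differ by a logarithmic derivative. -/
lemma LineBundleWithConnection.Iso.connectionCoeff_sub {X Y : LineBundleWithConnection S}
    (e : LineBundleWithConnection.Iso X Y) (p : S) :
    ∃ w : ℂ → ℂ, AnalyticAt ℂ w (chartAt ℂ p p) ∧ ∀ᶠ z in 𝓝[≠] (chartAt ℂ p p),
      X.bundle.connectionCoeff X.conn.toFun p z - Y.bundle.connectionCoeff Y.conn.toFun p z =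
        w z := by
  set s : ∀ x, Y.bundle.Fiber x := fun y => e.equiv y (X.bundle.frame p y) with hs
  -- The isomorphism in frames: it maps the frame of `X` to `m` times the frame of `Y`.
  set m : ℂ → ℂ := Y.bundle.sectionCoeff s p with hm
  have hsd : ∀ y ∈ X.bundle.domain p, Y.bundle.SectionDiffAt s y := fun y hy =>
    LineBundleWithConnection.sectionDiffAt_map e.equiv e.holomorphic (sectionDiffAt_frame hy)
  have hnear : ∀ᶠ z in 𝓝 (chartAt ℂ p p), z ∈ (chartAt ℂ p).target ∧
      (chartAt ℂ p).symm z ∈ X.bundle.domain p ∧ (chartAt ℂ p).symm z ∈ Y.bundle.domain p := by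
    filter_upwards [chart_target_mem_nhds ℂ p,
      eventually_chart_symm (mem_chart_source ℂ p) (X.bundle.domain_mem_nhds p),
      eventually_chart_symm (mem_chart_source ℂ p) (Y.bundle.domain_mem_nhds p)] with z h1 h2 h3
    exact ⟨h1, h2, h3⟩
  have hma : AnalyticAt ℂ m (chartAt ℂ p p) := by
    rw [analyticAt_iff_eventually_differentiableAt]
    filter_upwards [hnear.eventually_nhds] with z hz
    obtain ⟨hzt, hzX, hzY⟩ := hz.self_of_nhds
    have h1 := (hasDerivAt_comp_chart_symm hzt
      ((sectionDiffAt_iff hzY).1 (hsd _ hzX))).differentiableAt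
    refine h1.congr_of_eventuallyEq ?_
    filter_upwards [hz] with w hw
    exact sectionCoeff_eq hw.2.2 s
  have hm0 : m (chartAt ℂ p p) ≠ 0 := by
    have h1 := hnear.self_of_nhds
    rw [hm, sectionCoeff_eq h1.2.2]
    refine coord_ne_zero h1.2.2 fun h0 => frame_ne_zero h1.2.1 ?_
    exact (e.equiv _).injective (by rw [map_zero]; exact h0)
  refine ⟨fun z => deriv m z / m z, hma.deriv.div hma hm0, ?_⟩
  filter_upwards [nhdsWithin_le_nhds hnear, nhdsWithin_le_nhds (hma.continuousAt.eventually_ne hm0),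
    eventually_chart_symm_punctured (X.conn.eventually_notMem_poles p)] with z hz hmz hzp
  obtain ⟨hzt, hzX, hzY⟩ := hz
  have h1 := Y.conn.coord_apply_coordVector hzt hzY (e.poles_eq ▸ hzp) (hsd _ hzX)
  have h2 := e.map_conn (X.bundle.frame p) _ hzp (sectionDiffAt_frame hzX) (coordVector p z)
  have h3 : X.conn.toFun (X.bundle.frame p) ((chartAt ℂ p).symm z) (coordVector p z) =
      X.bundle.connectionCoeff X.conn.toFun p z • X.bundle.frame p ((chartAt ℂ p).symm z) := by
    have h4 : X.bundle.connectionCoeff X.conn.toFun p z = X.bundle.coord p ((chartAt ℂ p).symm z)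
        (X.conn.toFun (X.bundle.frame p) ((chartAt ℂ p).symm z) (coordVector p z)) :=
      (coord_apply hzX _).symm
    rw [h4, coord_smul_frame hzX]
  have h5 : m z = Y.bundle.coord p ((chartAt ℂ p).symm z) (s ((chartAt ℂ p).symm z)) :=
    sectionCoeff_eq hzY s
  rw [h2, h3, map_smul, map_smul, smul_eq_mul, ← hm] at h1
  rw [eq_div_iff hmz]
  -- Computing the derivative of the image of the frame in two ways gives `a_X m = m' + a_Y m`, so
  -- the forms differ by `m'/m`.
  have h6 : X.bundle.connectionCoeff X.conn.toFun p z * m z =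
    deriv m z + Y.bundle.connectionCoeff Y.conn.toFun p z * m z := by
    rw [← h1, h5]
  linear_combination h6

/-- The assignment `𝓗 ↦ (L_𝓗, ∇_𝓗)` is injective. -/
theorem ExpAlgStructure.eq_of_iso {H H' : ExpAlgStructure S} (D : H.LocalData) (D' : H'.LocalData)
    (e : LineBundleWithConnection.Iso D.pair D'.pair) : H = H' := by
  have hP : H.punctures = H'.punctures := by
    rw [← D.poles_pair, ← D'.poles_pair]
    exact e.poles_eq
  refine ExpAlgStructure.ext (funext fun p => ?_)
  by_cases hp : p ∈ H.punctures
  · have hp' : p ∈ H'.punctures := hP ▸ hp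
    have e1 := D.principalPart_h ⟨p, hp⟩
    have e2 := D'.principalPart_h ⟨p, hp'⟩
    simp only at e1 e2
    rw [← e1, ← e2, principalPart_eq_iff]
    obtain ⟨w, hw, hwp⟩ := e.connectionCoeff_sub p
    have hf := D.meromorphic_h ⟨p, hp⟩
    have hf' := D'.meromorphic_h ⟨p, hp'⟩
    -- The derivative of `h - h'` is the difference of the connection forms, which extends
    -- holomorphically.
    refine exists_analyticAt_of_deriv (MeromorphicAt.sub hf hf') hw ?_
    filter_upwards [hwp, D.connectionCoeff_pair ⟨p, hp⟩, D'.connectionCoeff_pair ⟨p, hp'⟩,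
      MeromorphicAt.eventually_analyticAt hf, MeromorphicAt.eventually_analyticAt hf']
      with z h1 h2 h3 h4 h5
    rw [← h1, h2, h3, ← deriv_sub h4.differentiableAt h5.differentiableAt]
    rfl
  · have hp' : p ∉ H'.punctures := hP ▸ hp
    have e1 : H.part p = 0 := not_not.1 hp
    have e2 : H'.part p = 0 := not_not.1 hp'
    rw [e1, e2]

end Injectivity

/-! ### The complement of finitely many points is connected -/

section Connected

/-- A punctured disc is the image of a half plane under the exponential. -/
lemma isPreconnected_punctured_ball (c : ℂ) (r : ℝ) :
    IsPreconnected (Metric.ball c r \ {c}) := by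
  have h : Metric.ball c r \ {c} = (fun w => c + exp w) '' (re ⁻¹' {t : ℝ | Real.exp t < r}) := by
    ext z
    simp only [Set.mem_sdiff, Metric.mem_ball, mem_singleton_iff, mem_image, mem_preimage,
      mem_ofPred_eq]
    constructor
    · rintro ⟨h1, h2⟩
      have h3 : z - c ≠ 0 := sub_ne_zero.2 h2
      refine ⟨log (z - c), ?_, ?_⟩
      · rw [← norm_exp, exp_log h3, ← dist_eq_norm]
        exact h1
      · rw [exp_log h3]
        ring
    · rintro ⟨w, hw, rfl⟩
      refine ⟨?_, fun h => exp_ne_zero w (add_eq_left.1 h)⟩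
      rw [dist_eq_norm, add_sub_cancel_left, norm_exp]
      exact hw
  rw [h]
  have hconv : Convex ℝ {t : ℝ | Real.exp t < r} := by
    have : OrdConnected {t : ℝ | Real.exp t < r} :=
      ⟨fun x _ y hy t ht => (Real.exp_le_exp.2 ht.2).trans_lt hy⟩
    exact this.convex
  have h1 : Convex ℝ (re ⁻¹' {t : ℝ | Real.exp t < r}) := hconv.linear_preimage reLm
  exact h1.isPreconnected.image _ (by fun_prop)

variable {S : Type u} [TopologicalSpace S] [ChartedSpace ℂ S]

/-- Points of a surface have small neighbourhoods which remain connected when punctured. -/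
lemma exists_isOpen_isPreconnected_punctured {x : S} {U : Set S} (hU : U ∈ 𝓝 x) :
    ∃ V ⊆ U, IsOpen V ∧ x ∈ V ∧ IsPreconnected (V \ {x}) := by
  set φ := chartAt ℂ x with hφ
  have hx := mem_chart_source ℂ x
  have h1 : ∀ᶠ z in 𝓝 (φ x), φ.symm z ∈ U ∧ z ∈ φ.target :=
    (eventually_chart_symm hx hU).and (chart_target_mem_nhds ℂ x)
  obtain ⟨r, hr, hball⟩ := Metric.eventually_nhds_iff_ball.1 h1
  have hsub : Metric.ball (φ x) r ⊆ φ.target := fun z hz => (hball z hz).2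
  refine ⟨φ.symm '' Metric.ball (φ x) r, ?_, ?_, ?_, ?_⟩
  · rintro _ ⟨z, hz, rfl⟩
    exact (hball z hz).1
  · exact φ.symm.isOpen_image_of_subset_source Metric.isOpen_ball hsub
  · exact ⟨φ x, Metric.mem_ball_self hr, φ.left_inv hx⟩
  · have h2 : φ.symm '' Metric.ball (φ x) r \ {x} = φ.symm '' (Metric.ball (φ x) r \ {φ x}) := by
      rw [(φ.symm.injOn.mono hsub).image_sdiff_subset
        (singleton_subset_iff.2 (Metric.mem_ball_self hr)), image_singleton, φ.left_inv hx]
    rw [h2]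
    exact (isPreconnected_punctured_ball _ _).image _
      (φ.continuousOn_symm.mono (sdiff_subset.trans hsub))

/-- Punctured neighbourhoods are nontrivial. -/
lemma neBot_nhdsNE (x : S) : (𝓝[≠] x).NeBot := by
  refine ⟨fun h => ?_⟩
  have h1 : ∀ᶠ y in 𝓝[≠] x, False := by rw [h]; exact eventually_bot
  exact (eventually_chart_symm_punctured h1).exists.elim fun _ h => h

variable [T2Space S] [ConnectedSpace S]

/-- A connected surface remains connected when finitely many points are removed. -/
theorem isPreconnected_compl_finite {P : Set S} (hP : P.Finite) : IsPreconnected Pᶜ := by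
  rw [isPreconnected_iff_subset_of_disjoint]
  intro u v hu hv huv hdisj
  have hPe : ∀ x, ∀ᶠ y in 𝓝[≠] x, y ∈ Pᶜ := by
    intro x
    have h : (P \ {x})ᶜ ∈ 𝓝 x :=
      (hP.subset sdiff_subset).isClosed.isOpen_compl.mem_nhds fun h => h.2 rfl
    filter_upwards [nhdsWithin_le_nhds h, self_mem_nhdsWithin] with y hy hyx hyP
      using hy ⟨hyP, hyx⟩
  -- `E w` adds to an open set `w` the points it surrounds. A separation of the complement of `P` by
  -- `u` and `v` becomes a separation of all of `S` by `E u` and `E v`.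
  set E : Set S → Set S := fun w => {x | ∀ᶠ y in 𝓝[≠] x, y ∈ w} with hE
  have hEo : ∀ w, IsOpen (E w) := by
    intro w
    rw [isOpen_iff_eventually]
    intro x hx
    have hx' : ∀ᶠ y in 𝓝 x, y ≠ x → y ∈ w := eventually_nhdsWithin_iff.1 hx
    filter_upwards [hx'.eventually_nhds] with y hy
    by_cases hyx : y = x
    · exact hyx ▸ hx
    · refine nhdsWithin_le_nhds ?_
      filter_upwards [hy, isOpen_ne.mem_nhds hyx] with z hz hzx using hz hzx
  -- A small punctured disc around `x` is connected and avoids `P`, so it lies entirely in `u` or in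
  -- `v`.
  have hcover : ∀ x, x ∈ E u ∨ x ∈ E v := by
    intro x
    obtain ⟨V, hVP, hVo, hxV, hV⟩ :=
      exists_isOpen_isPreconnected_punctured (eventually_nhdsWithin_iff.1 (hPe x))
    have hsub : V \ {x} ⊆ Pᶜ := fun y hy => hVP hy.1 hy.2
    have hmem : V \ {x} ∈ 𝓝[≠] x := by
      rw [sdiff_eq, inter_comm]
      exact inter_mem_nhdsWithin _ (hVo.mem_nhds hxV)
    refine (isPreconnected_iff_subset_of_disjoint.1 hV u v hu hv (hsub.trans huv) ?_).imp
      (fun h => mem_of_superset hmem h) (fun h => mem_of_superset hmem h)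
    rw [← subset_empty_iff, ← hdisj]
    exact inter_subset_inter_left _ hsub
  have hEd : ∀ x, x ∈ E u → x ∈ E v → False := by
    intro x h1 h2
    have := neBot_nhdsNE x
    have h1' : ∀ᶠ y in 𝓝[≠] x, y ∈ u := h1
    have h2' : ∀ᶠ y in 𝓝[≠] x, y ∈ v := h2
    obtain ⟨y, hy⟩ := (h1'.and (h2'.and (hPe x))).exists
    exact (hdisj.subset ⟨hy.2.2, hy.1, hy.2.1⟩).elim
  have hcl : IsClopen (E u) := by
    refine ⟨⟨?_⟩, hEo u⟩
    have : (E u)ᶜ = E v := Subset.antisymm (fun x hx => (hcover x).resolve_left hx)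
      (fun x hx hxu => hEd x hxu hx)
    rw [this]
    exact hEo v
  have hsubE : ∀ w, IsOpen w → w ⊆ E w := fun w hw x hx => nhdsWithin_le_nhds (hw.mem_nhds hx)
  rcases isClopen_iff.1 hcl with h | h
  · refine Or.inr fun x hx => (huv hx).resolve_left fun hxu => ?_
    exact (h ▸ hsubE u hu hxu : x ∈ (∅ : Set S))
  · refine Or.inl fun x hx => (huv hx).resolve_right fun hxv => ?_
    exact hEd x (h ▸ mem_univ x) (hsubE v hv hxv)

end Connected

/-! ### Parallel transport -/

section Horizontal

variable {S : Type u} [TopologicalSpace S] [ChartedSpace ℂ S]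

namespace MeromorphicConnection

open HolomorphicLineBundle

variable {L : HolomorphicLineBundle S} (D : MeromorphicConnection L)

/-- The section `s` is horizontal near `x`. -/
def HorizontalNear (s : ∀ x, L.Fiber x) (x : S) : Prop :=
  ∀ᶠ y in 𝓝 x, L.SectionDiffAt s y ∧ D.toFun s y = 0

variable {D}

lemma HorizontalNear.eventually {s : ∀ x, L.Fiber x} {x : S} (h : D.HorizontalNear s x) :
    ∀ᶠ y in 𝓝 x, D.HorizontalNear s y := h.eventually_nhds

variable [T1Space S]

lemma HorizontalNear.congr {s t : ∀ x, L.Fiber x} {x : S} (hs : D.HorizontalNear s x)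
    (hx : x ∉ D.poles) (h : ∀ᶠ y in 𝓝 x, t y = s y) : D.HorizontalNear t x := by
  filter_upwards [hs, D.isOpen_compl_poles.mem_nhds hx, h.eventually_nhds] with y h1 h2 h3
  exact ⟨h1.1.congr h3, (D.congr h2 h1.1 h3).trans h1.2⟩

lemma HorizontalNear.const_smul {s : ∀ x, L.Fiber x} {x : S} (hs : D.HorizontalNear s x)
    (hx : x ∉ D.poles) (c : ℂ) : D.HorizontalNear (fun y => c • s y) x := by
  filter_upwards [hs, D.isOpen_compl_poles.mem_nhds hx] with y h1 h2
  refine ⟨sectionDiffAt_smul (L.mem_domain y) (mdifferentiableAt_const (c := c)) h1.1, ?_⟩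
  have h3 := D.isCovariantDerivativeOn.smul_const c h1.1 h2
  rw [h1.2, smul_zero] at h3
  exact h3

variable [IsManifold 𝓘(ℂ) ω S]

variable (D) in
/-- Off the poles there is a local horizontal frame, and all horizontal sections are its
multiples. -/
lemma exists_horizontalNear {x : S} (hx : x ∉ D.poles) :
    ∃ e : ∀ x, L.Fiber x, D.HorizontalNear e x ∧ (∀ᶠ y in 𝓝 x, e y ≠ 0) ∧
      ∀ s : ∀ x, L.Fiber x, D.HorizontalNear s x → ∃ c : ℂ, ∀ᶠ y in 𝓝 x, s y = c • e y := by
  -- In coordinates horizontality is `u' + a u = 0`. With `A' = a`, a solution is `e^{-A}`.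
  obtain ⟨A, hA, hAd⟩ := exists_primitive (D.holomorphic x hx)
  set φ := chartAt ℂ x with hφ
  have hxs : x ∈ φ.source := mem_chart_source ℂ x
  have hnear : ∀ᶠ y in 𝓝 x, y ∈ φ.source ∧ y ∈ L.domain x ∧ y ∉ D.poles ∧
      DifferentiableAt ℂ A (φ y) := by
    filter_upwards [φ.open_source.mem_nhds hxs, L.domain_mem_nhds x,
      D.isOpen_compl_poles.mem_nhds hx,
      (φ.continuousAt hxs).eventually hA.eventually_analyticAt] with y h1 h2 h3 h4
    exact ⟨h1, h2, h3, h4.differentiableAt⟩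
  have hnear' : ∀ᶠ z in 𝓝 (φ x), (z ∈ φ.target ∧ φ.symm z ∈ L.domain x ∧ φ.symm z ∉ D.poles) := by
    filter_upwards [eventually_chart_symm hxs hnear, chart_target_mem_nhds ℂ x] with z h1 h2
    exact ⟨h2, h1.2.1, h1.2.2.1⟩
  set e : ∀ x, L.Fiber x := (fun y => exp (-A (φ y))) • L.frame x with he
  have hed : ∀ᶠ y in 𝓝 x, L.SectionDiffAt e y := by
    filter_upwards [hnear] with y hy
    refine sectionDiffAt_smul hy.2.1 ?_ (sectionDiffAt_frame hy.2.1)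
    have h1 : DifferentiableAt ℂ (fun z => exp (-A z)) (φ y) := hy.2.2.2.neg.cexp
    exact h1.mdifferentiableAt.comp y (mdifferentiableAt_chart hy.1)
  have hec : ∀ᶠ z in 𝓝 (φ x), L.sectionCoeff e x z = exp (-A z) := by
    filter_upwards [hnear'] with z hz
    rw [sectionCoeff_eq hz.2.1]
    change L.coord x _ (exp (-A (φ (φ.symm z))) • L.frame x _) = _
    rw [map_smul, coord_frame hz.2.1, φ.right_inv hz.1, smul_eq_mul, mul_one]
  -- horizontality in terms of coordinates
  have hcoord : ∀ {Q : S → Prop}, (∀ᶠ z in 𝓝 (φ x), Q (φ.symm z)) → ∀ᶠ y in 𝓝 x, Q y := by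
    intro Q hQ
    filter_upwards [(φ.continuousAt hxs).eventually hQ, φ.open_source.mem_nhds hxs] with y h1 h2
    rwa [φ.left_inv h2] at h1
  refine ⟨e, ?_, ?_, fun s hs => ?_⟩
  · refine hcoord ?_
    filter_upwards [hec.eventually_nhds, hnear', hAd, eventually_chart_symm hxs hed]
      with z h1 h2 h3 h4
    refine ⟨h4, (D.toFun_eq_zero_iff h2.1 h2.2.1 h2.2.2 h4).2 ?_⟩
    have h5 : deriv (L.sectionCoeff e x) z = exp (-A z) * -(L.connectionCoeff D.toFun x z) :=
      (EventuallyEq.deriv_eq h1).trans h3.neg.cexp.deriv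
    rw [h5, h1.self_of_nhds]
    ring
  · filter_upwards [hnear] with y hy
    exact smul_ne_zero (exp_ne_zero _) (frame_ne_zero hy.2.1)
  -- For any solution `u`, the product `u e^A` has derivative zero, hence is a constant on a disc.
  · have h1 : ∀ᶠ z in 𝓝 (φ x), HasDerivAt (fun w => L.sectionCoeff s x w * exp (A w)) 0 z := by
      filter_upwards [hnear'.eventually_nhds, hAd, eventually_chart_symm hxs hs] with z h2 h3 h4
      have h2' := h2.self_of_nhds
      have h5 := (D.toFun_eq_zero_iff h2'.1 h2'.2.1 h2'.2.2 h4.1).1 h4.2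
      have h6 : DifferentiableAt ℂ (L.sectionCoeff s x) z := by
        have h7 := (hasDerivAt_comp_chart_symm h2'.1
          ((sectionDiffAt_iff h2'.2.1).1 h4.1)).differentiableAt
        refine h7.congr_of_eventuallyEq ?_
        filter_upwards [h2] with w hw using sectionCoeff_eq hw.2.1 s
      have h8 := h6.hasDerivAt.mul h3.cexp
      refine h8.congr_deriv ?_
      linear_combination exp (A z) * h5
    obtain ⟨r, hr, hball⟩ := Metric.eventually_nhds_iff_ball.1 h1
    refine ⟨L.sectionCoeff s x (φ x) * exp (A (φ x)), hcoord ?_⟩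
    filter_upwards [Metric.ball_mem_nhds (φ x) hr, hnear', hec] with z hz hz' hze
    have h2 := (Metric.isOpen_ball (x := φ x) (ε := r)).is_const_of_deriv_eq_zero
      (convex_ball (φ x) r).isPreconnected
      (fun w hw => (hball w hw).differentiableAt.differentiableWithinAt)
      (fun w hw => (hball w hw).deriv) hz (Metric.mem_ball_self hr)
    rw [← h2]
    refine coord_injective hz'.2.1 ?_
    rw [map_smul, ← sectionCoeff_eq hz'.2.1, ← sectionCoeff_eq hz'.2.1, hze, smul_eq_mul, mul_assoc,
      ← Complex.exp_add, add_neg_cancel, exp_zero, mul_one]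

/-- A horizontal section is locally determined by one value. -/
lemma HorizontalNear.eventually_eq {s t : ∀ x, L.Fiber x} {x : S} (hx : x ∉ D.poles)
    (hs : D.HorizontalNear s x) (ht : D.HorizontalNear t x) (h : s x = t x) :
    ∀ᶠ y in 𝓝 x, s y = t y := by
  obtain ⟨e, he, he0, hes⟩ := D.exists_horizontalNear hx
  obtain ⟨c, hc⟩ := hes s hs
  obtain ⟨d, hd⟩ := hes t ht
  rw [hc.self_of_nhds, hd.self_of_nhds] at h
  have hcd : c = d := smul_left_injective ℂ he0.self_of_nhds h
  filter_upwards [hc, hd] with y h1 h2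
  rw [h1, h2, hcd]

variable (D) in
/-- Every vector off the poles extends to a local horizontal section. -/
lemma exists_horizontalNear_eq {x : S} (hx : x ∉ D.poles) (v : L.Fiber x) :
    ∃ s : ∀ x, L.Fiber x, D.HorizontalNear s x ∧ s x = v := by
  obtain ⟨e, he, he0, -⟩ := D.exists_horizontalNear hx
  refine ⟨_, he.const_smul hx (L.coord x x v / L.coord x x (e x)), ?_⟩
  refine coord_injective (L.mem_domain x) ?_
  rw [map_smul, smul_eq_mul, div_mul_cancel₀]
  exact coord_ne_zero (L.mem_domain x) he0.self_of_nhds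

variable (D) in
/-- Near a pole without residue, a horizontal section is `c e^{-h}` with `h` meromorphic. -/
lemma exists_sectionCoeff_eq_exp {p : S}
    (hres : HasResidueAt (L.connectionCoeff D.toFun p) (chartAt ℂ p p) 0) {σ : ∀ x, L.Fiber x}
    (hσ : ∀ x ∉ D.poles, L.SectionDiffAt σ x ∧ D.toFun σ x = 0 ∧ σ x ≠ 0) :
    ∃ h : ℂ → ℂ, MeromorphicAt h (chartAt ℂ p p) ∧
      (∀ᶠ z in 𝓝[≠] (chartAt ℂ p p), HasDerivAt h (L.connectionCoeff D.toFun p z) z) ∧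
      ∃ c : ℂ, c ≠ 0 ∧ ∀ᶠ z in 𝓝[≠] (chartAt ℂ p p), L.sectionCoeff σ p z = c * exp (-h z) := by
  -- The vanishing residue makes the primitive single valued around `p` and excludes a logarithm.
  obtain ⟨h, hm, hd⟩ := exists_primitive_of_hasResidueAt_zero (D.meromorphic p) hres
  refine ⟨h, hm, hd, ?_⟩
  have hxs := mem_chart_source ℂ p
  have hnear : ∀ᶠ z in 𝓝 (chartAt ℂ p p), z ∈ (chartAt ℂ p).target ∧
      (chartAt ℂ p).symm z ∈ L.domain p := by
    filter_upwards [chart_target_mem_nhds ℂ p, eventually_chart_symm hxs (L.domain_mem_nhds p)]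
      with z h1 h2 using ⟨h1, h2⟩
  have h1 : ∀ᶠ z in 𝓝[≠] (chartAt ℂ p p),
      HasDerivAt (fun w => L.sectionCoeff σ p w * exp (h w)) 0 z ∧ L.sectionCoeff σ p z ≠ 0 := by
    filter_upwards [nhdsWithin_le_nhds hnear.eventually_nhds, hd,
      eventually_chart_symm_punctured (D.eventually_notMem_poles p)] with z h2 h3 h4
    have h2' := h2.self_of_nhds
    obtain ⟨k1, k2, k3⟩ := hσ _ h4
    have h5 := (D.toFun_eq_zero_iff h2'.1 h2'.2 h4 k1).1 k2
    have h6 : DifferentiableAt ℂ (L.sectionCoeff σ p) z := by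
      have h7 := (hasDerivAt_comp_chart_symm h2'.1
        ((sectionDiffAt_iff h2'.2).1 k1)).differentiableAt
      refine h7.congr_of_eventuallyEq ?_
      filter_upwards [h2] with w hw using sectionCoeff_eq hw.2 σ
    refine ⟨(h6.hasDerivAt.mul h3.cexp).congr_deriv ?_, ?_⟩
    · linear_combination exp (h z) * h5
    · rw [sectionCoeff_eq h2'.2]
      exact coord_ne_zero h2'.2 k3
  obtain ⟨r, hr, hball⟩ := Metric.eventually_nhds_iff_ball.1 (eventually_nhdsWithin_iff.1 h1)
  set z₀ := chartAt ℂ p p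
  -- Connectedness of the punctured disc gives one constant `σ e^h = c` all around the pole.
  obtain ⟨c, hc⟩ := (Metric.isOpen_ball.sdiff isClosed_singleton :
      IsOpen (Metric.ball z₀ r \ {z₀})).exists_is_const_of_deriv_eq_zero
    (isPreconnected_punctured_ball z₀ r)
    (fun w hw => (hball w hw.1 hw.2).1.differentiableAt.differentiableWithinAt)
    (fun w hw => (hball w hw.1 hw.2).1.deriv)
  have h2 : ∀ᶠ z in 𝓝[≠] z₀, z ∈ Metric.ball z₀ r \ {z₀} := by
    filter_upwards [nhdsWithin_le_nhds (Metric.ball_mem_nhds z₀ hr), self_mem_nhdsWithin]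
      with z h3 h4 using ⟨h3, h4⟩
  refine ⟨c, ?_, ?_⟩
  · obtain ⟨z, hz⟩ := h2.exists
    rw [← hc z hz]
    exact mul_ne_zero (hball z hz.1 hz.2).2 (exp_ne_zero _)
  · filter_upwards [h2] with z hz
    rw [← hc z hz, mul_assoc, ← Complex.exp_add, add_neg_cancel, exp_zero, mul_one]

end MeromorphicConnection

end Horizontal

/-! ### The étale space of horizontal sections and global frames. -/

section Etale

variable {S : Type u} [TopologicalSpace S] [ChartedSpace ℂ S]

namespace MeromorphicConnection

open HolomorphicLineBundle

variable {L : HolomorphicLineBundle S}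

/-- The étale space of the sheaf of horizontal sections: vectors of `L` off the poles, with the
topology in which the local horizontal sections are the sheets. -/
structure EtaleSpace (D : MeromorphicConnection L) where
  proj : S
  notMem : proj ∉ D.poles
  vec : L.Fiber proj

variable {D : MeromorphicConnection L}

/-- Quantifying over all horizontal sections through a vector makes the axioms immediate. Existence
and local uniqueness of these sections are needed only later, to see that the sheets are open. -/
instance : TopologicalSpace D.EtaleSpace where
  IsOpen U := ∀ v ∈ U, ∀ s : ∀ x, L.Fiber x, D.HorizontalNear s v.proj → s v.proj = v.vec →
    ∀ᶠ y in 𝓝 v.proj, ∀ hy : y ∉ D.poles, (⟨y, hy, s y⟩ : D.EtaleSpace) ∈ U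
  isOpen_univ _ _ _ _ _ := Eventually.of_forall fun _ _ => mem_univ _
  isOpen_inter U V hU hV v hv s hs hsv := by
    filter_upwards [hU v hv.1 s hs hsv, hV v hv.2 s hs hsv] with y h1 h2 hy using ⟨h1 hy, h2 hy⟩
  isOpen_sUnion 𝒰 h𝒰 v hv s hs hsv := by
    obtain ⟨U, hU, hvU⟩ := hv
    filter_upwards [h𝒰 U hU v hvU s hs hsv] with y h1 hy using ⟨U, hU, h1 hy⟩

namespace EtaleSpace

lemma isOpen_iff {U : Set D.EtaleSpace} : IsOpen U ↔ ∀ v ∈ U, ∀ s : ∀ x, L.Fiber x,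
    D.HorizontalNear s v.proj → s v.proj = v.vec →
    ∀ᶠ y in 𝓝 v.proj, ∀ hy : y ∉ D.poles, (⟨y, hy, s y⟩ : D.EtaleSpace) ∈ U := Iff.rfl

/-- A point of the étale space as a vector of `L`. -/
def toTotalSpace (v : D.EtaleSpace) : TotalSpace ℂ L.Fiber := ⟨v.proj, v.vec⟩

lemma mk_eq_mk (s : ∀ x, L.Fiber x) {x y : S} (h : x = y) (hx : x ∉ D.poles) (hy : y ∉ D.poles) :
    (⟨x, hx, s x⟩ : D.EtaleSpace) = ⟨y, hy, s y⟩ := by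
  subst h
  rfl

lemma continuous_proj : Continuous (proj : D.EtaleSpace → S) := by
  refine continuous_def.2 fun V hV => isOpen_iff.2 fun v hv s _ _ => ?_
  filter_upwards [hV.mem_nhds hv] with y hy _ using hy

/-- Horizontal sections are continuous maps to the étale space. -/
lemma continuous_section {X : Type*} [TopologicalSpace X] {γ : X → S} (hγ : Continuous γ)
    (hγD : ∀ t, γ t ∉ D.poles) {s : ∀ x, L.Fiber x} (hs : ∀ t, D.HorizontalNear s (γ t)) :
    Continuous fun t => (⟨γ t, hγD t, s (γ t)⟩ : D.EtaleSpace) := by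
  refine continuous_def.2 fun U hU => isOpen_iff_eventually.2 fun t ht => ?_
  filter_upwards [hγ.continuousAt.eventually (isOpen_iff.1 hU _ ht s (hs t) rfl)] with t' ht'
    using ht' (hγD t')

variable [T1Space S] [IsManifold 𝓘(ℂ) ω S]

/-- The sheet of a horizontal section is open because horizontal sections agreeing at a point agree
nearby. Hence a continuous path into the étale space follows such a section locally. -/
lemma eventually_vec_eq {v : D.EtaleSpace} {s : ∀ x, L.Fiber x} (hs : D.HorizontalNear s v.proj)
    (hsv : s v.proj = v.vec) : ∀ᶠ w in 𝓝 v, w.vec = s w.proj := by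
  have h : IsOpen {w : D.EtaleSpace | D.HorizontalNear s w.proj ∧ w.vec = s w.proj} := by
    refine isOpen_iff.2 fun w hw t ht htw => ?_
    filter_upwards [hw.1.eventually, ht.eventually_eq w.notMem hw.1 (htw.trans hw.2)]
      with y h1 h2 _ using ⟨h1, h2⟩
  exact mem_of_superset (h.mem_nhds ⟨hs, hsv.symm⟩) fun w hw => hw.2

/-- Paths in the étale space are parallel families of vectors. -/
lemma isParallelAlong {Γ : unitInterval → D.EtaleSpace} (hΓ : Continuous Γ) :
    D.IsParallelAlong fun t => (Γ t).toTotalSpace := by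
  intro t
  obtain ⟨s, hs, hst⟩ := D.exists_horizontalNear_eq (Γ t).notMem (Γ t).vec
  exact ⟨s, hs, hΓ.continuousAt.eventually (eventually_vec_eq hs hst)⟩

/-- Parallel transport with trivial monodromy does not depend on the path. -/
lemma vec_eq_of_joined (hD : D.HasTrivialMonodromy) {x : S} {hx : x ∉ D.poles} {v w : L.Fiber x}
    (h : Joined (⟨x, hx, v⟩ : D.EtaleSpace) ⟨x, hx, w⟩) : v = w := by
  obtain ⟨Γ⟩ := h
  have h1 : (Γ 0).toTotalSpace = (Γ 1).toTotalSpace :=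
    hD (fun t => (Γ t).toTotalSpace) (continuous_proj.comp Γ.continuous) (fun t => (Γ t).notMem)
      (isParallelAlong Γ.continuous)
      ((congrArg proj Γ.source).trans (congrArg proj Γ.target).symm)
  rw [Γ.source, Γ.target] at h1
  exact TotalSpace.mk_inj.1 h1

/-- The zero section is open and closed in the étale space. -/
lemma isClopen_zero : IsClopen {v : D.EtaleSpace | v.vec = 0} := by
  refine ⟨⟨isOpen_iff.2 fun v hv s hs hsv => ?_⟩, isOpen_iff.2 fun v hv s hs hsv => ?_⟩
  -- A local horizontal section is a constant multiple of a nonvanishing one, so it vanishes near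
  -- the point either everywhere or nowhere.
  · obtain ⟨e, -, he0, hes⟩ := D.exists_horizontalNear v.notMem
    obtain ⟨c, hc⟩ := hes s hs
    have hc0 : c ≠ 0 := by
      rintro rfl
      refine hv ?_
      change v.vec = 0
      rw [← hsv, hc.self_of_nhds, zero_smul]
    filter_upwards [hc, he0] with y h1 h2 hy h3
    have h4 : s y = 0 := h3
    rw [h1] at h4
    exact smul_ne_zero hc0 h2 h4
  · obtain ⟨e, -, he0, hes⟩ := D.exists_horizontalNear v.notMem
    obtain ⟨c, hc⟩ := hes s hs
    have hc0 : c = 0 := by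
      have h1 : s v.proj = 0 := hsv.trans hv
      rw [hc.self_of_nhds] at h1
      exact (smul_eq_zero.1 h1).resolve_right he0.self_of_nhds
    filter_upwards [hc] with y h1 hy
    change s y = 0
    rw [h1, hc0, zero_smul]

/-- Parallel transport maps nonzero vectors to nonzero vectors. -/
lemma vec_ne_zero_of_joined {v w : D.EtaleSpace} (h : Joined v w) (hv : v.vec ≠ 0) :
    w.vec ≠ 0 := by
  obtain ⟨Γ⟩ := h
  have h1 := (isPreconnected_range Γ.continuous).subset_isClopen
    (isClopen_zero (D := D)).compl ⟨v, ⟨0, Γ.source⟩, hv⟩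
  exact h1 ⟨1, Γ.target⟩

/-- Near a point off the poles, vectors can be transported. -/
lemma exists_joined {x : S} (hx : x ∉ D.poles) : ∃ U ∈ 𝓝 x, U ⊆ D.polesᶜ ∧
    ∃ e : ∀ x, L.Fiber x, (∀ y ∈ U, D.HorizontalNear e y ∧ e y ≠ 0) ∧
      ∀ y ∈ U, ∀ y' ∈ U, ∀ (hy : y ∉ D.poles) (hy' : y' ∉ D.poles) (c : ℂ),
        Joined (⟨y, hy, c • e y⟩ : D.EtaleSpace) ⟨y', hy', c • e y'⟩ := by
  obtain ⟨e, he, he0, -⟩ := D.exists_horizontalNear hx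
  have : LocallyPathConnectedSpace S := ChartedSpace.locallyPathConnectedSpace ℂ S
  obtain ⟨U, ⟨hU, hUp⟩, hUs⟩ := (path_connected_basis x).mem_iff.1
    (inter_mem (D.isOpen_compl_poles.mem_nhds hx) (he.eventually.and he0))
  refine ⟨U, hU, fun y hy => (hUs hy).1, e, fun y hy => (hUs hy).2,
    fun y hy y' hy' hyD hyD' c => ?_⟩
  obtain ⟨γ, hγ⟩ := hUp.joinedIn y hy y' hy'
  have h1 : ∀ t, D.HorizontalNear (fun y => c • e y) (γ t) := fun t =>
    (hUs (hγ t)).2.1.const_smul (hUs (hγ t)).1 c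
  refine ⟨⟨⟨_, continuous_section γ.continuous (fun t => (hUs (hγ t)).1) h1⟩, ?_, ?_⟩⟩
  · exact mk_eq_mk (fun y => c • e y) γ.source _ _
  · exact mk_eq_mk (fun y => c • e y) γ.target _ _

variable [T2Space S] [ConnectedSpace S]

/-- On a connected surface, every vector can be transported to every point off the poles. -/
lemma exists_joined_of_connected (v : D.EtaleSpace) {x : S} (hx : x ∉ D.poles) :
    ∃ w : L.Fiber x, Joined v ⟨x, hx, w⟩ := by
  -- The points to which `v` can be transported. Local transport makes both this set and its
  -- complement off the poles open, and the complement of the poles is connected.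
  set A : Set S := {x | ∃ (hx : x ∉ D.poles) (w : L.Fiber x), Joined v ⟨x, hx, w⟩} with hA
  have key : ∀ x ∉ D.poles, ∃ U ∈ 𝓝 x, U ⊆ D.polesᶜ ∧ ∀ y ∈ U, ∀ y' ∈ U, y ∈ A → y' ∈ A := by
    intro x hx
    obtain ⟨U, hU, hUD, e, he, hj⟩ := exists_joined hx
    refine ⟨U, hU, hUD, ?_⟩
    rintro y hy y' hy' ⟨hyD, w, hw⟩
    have h0 := coord_ne_zero (L.mem_domain y) (he y hy).2
    have h1 : w = (L.coord y y w / L.coord y y (e y)) • e y := by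
      refine coord_injective (L.mem_domain y) ?_
      rw [map_smul, smul_eq_mul, div_mul_cancel₀ _ h0]
    rw [h1] at hw
    exact ⟨hUD hy', _, hw.trans (hj y hy y' hy' hyD (hUD hy') _)⟩
  have hAo : IsOpen A := by
    refine isOpen_iff_eventually.2 fun x hxA => ?_
    obtain ⟨U, hU, -, h⟩ := key x hxA.1
    filter_upwards [hU] with y hy using h x (mem_of_mem_nhds hU) y hy hxA
  have hBo : IsOpen (D.polesᶜ \ A) := by
    refine isOpen_iff_eventually.2 fun x hxA => ?_
    obtain ⟨U, hU, hUD, h⟩ := key x hxA.1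
    filter_upwards [hU] with y hy
      using ⟨hUD hy, fun hyA => hxA.2 (h y hy x (mem_of_mem_nhds hU) hyA)⟩
  have hsub := (isPreconnected_compl_finite D.finite_poles).subset_left_of_subset_union hAo hBo
    (disjoint_sdiff_self_right) (fun y hy => (em (y ∈ A)).imp id fun h => ⟨hy, h⟩)
    ⟨v.proj, v.notMem, v.notMem, v.vec, Joined.refl v⟩
  exact (hsub hx).2

/-- A connection with trivial monodromy has a horizontal frame. -/
theorem exists_horizontal_frame (hD : D.HasTrivialMonodromy) :
    ∃ σ : ∀ x, L.Fiber x, ∀ x ∉ D.poles, L.SectionDiffAt σ x ∧ D.toFun σ x = 0 ∧ σ x ≠ 0 := by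
  by_cases hne : ∃ x₀, x₀ ∉ D.poles
  swap
  · exact ⟨fun _ => 0, fun x hx => (hne ⟨x, hx⟩).elim⟩
  obtain ⟨x₀, hx₀⟩ := hne
  set v : D.EtaleSpace := ⟨x₀, hx₀, L.frame x₀ x₀⟩ with hv
  have hv0 : v.vec ≠ 0 := frame_ne_zero (L.mem_domain x₀)
  -- A single vector is transported everywhere along arbitrary paths; trivial monodromy makes the
  -- result independent of them.
  choose! σ hσ using fun (x : S) (hx : x ∉ D.poles) => exists_joined_of_connected v hx
  refine ⟨σ, fun x hx => ?_⟩
  obtain ⟨U, hU, hUD, e, he, hj⟩ := exists_joined hx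
  have hxU := mem_of_mem_nhds hU
  have h0 := coord_ne_zero (L.mem_domain x) (he x hxU).2
  set c : ℂ := L.coord x x (σ x) / L.coord x x (e x)
  have h1 : σ x = c • e x := by
    refine coord_injective (L.mem_domain x) ?_
    rw [map_smul, smul_eq_mul, div_mul_cancel₀ _ h0]
  -- Transport to `y` may go through `x` and then along the local section `c e`, so `σ` agrees with
  -- that section and is horizontal.
  have h2 : ∀ᶠ y in 𝓝 x, σ y = c • e y := by
    filter_upwards [hU] with y hy
    have h3 := hj x hxU y hy hx (hUD hy) c
    rw [← h1] at h3
    exact vec_eq_of_joined hD ((hσ y (hUD hy)).symm.trans ((hσ x hx).trans h3))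
  have h4 := (((he x hxU).1.const_smul hx c).congr hx h2).self_of_nhds
  exact ⟨h4.1, h4.2, vec_ne_zero_of_joined (hσ x hx) hv0⟩

end EtaleSpace

end MeromorphicConnection

end Etale

/-! ### Constructing the exp-algebraic structure of an admissible pair. -/

section Surjectivity

variable {S : Type u} [TopologicalSpace S] [ChartedSpace ℂ S] [T2Space S] [ConnectedSpace S]
  [IsManifold 𝓘(ℂ) ω S]

/-- Every admissible pair comes from an exp-algebraic structure. -/
theorem LineBundleWithConnection.Admissible.exists_nonempty_iso {X : LineBundleWithConnection S}
    (hX : X.Admissible) : ∃ H : ExpAlgStructure S, ∀ D : H.LocalData, Nonempty (Iso D.pair X) := by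
  classical
  obtain ⟨σ, hσ⟩ :=
    MeromorphicConnection.EtaleSpace.exists_horizontal_frame hX.trivial_monodromy
  have hloc : ∀ p ∈ X.conn.poles, ∃ (g : S → ℂ) (hg : MeromorphicFunAt p g) (c : ℂ), c ≠ 0 ∧
      principalPart p g hg ≠ 0 ∧ ∀ᶠ z in 𝓝[≠] (chartAt ℂ p p),
        X.bundle.sectionCoeff σ p z = c * exp (-g ((chartAt ℂ p).symm z)) := by
    intro p hp
    obtain ⟨h, hm, hd, c, hc, hσp⟩ :=
      X.conn.exists_sectionCoeff_eq_exp (hX.residues_zero p hp) hσ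
    have hinv : ∀ᶠ z in 𝓝 (chartAt ℂ p p), chartAt ℂ p ((chartAt ℂ p).symm z) = z := by
      filter_upwards [chart_target_mem_nhds ℂ p] with z hz using (chartAt ℂ p).right_inv hz
    have hg : MeromorphicFunAt p (fun x => h (chartAt ℂ p x)) := by
      refine MeromorphicAt.congr hm (nhdsWithin_le_nhds ?_)
      filter_upwards [hinv] with z hz
      rw [hz]
    refine ⟨fun x => h (chartAt ℂ p x), hg, c, hc, fun h0 => ?_, ?_⟩
    -- If `h` had no pole, the connection form `dh` would extend holomorphically, and `p` would not
    -- be a pole of the connection.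
    · have h1 : principalPart p (fun x => h (chartAt ℂ p x)) hg =
          principalPart p (fun _ => 0) (MeromorphicAt.const 0 _) := h0
      obtain ⟨G, hG, hGp⟩ := (principalPart_eq_iff _ _).1 h1
      have h2 : X.bundle.connectionCoeff X.conn.toFun p =ᶠ[𝓝[≠] (chartAt ℂ p p)] deriv G := by
        have h3 : h =ᶠ[𝓝[≠] (chartAt ℂ p p)] G := by
          filter_upwards [hGp, nhdsWithin_le_nhds hinv] with z h4 h5
          rwa [h5, sub_zero] at h4
        filter_upwards [hd, eventually_punctured_nhds h3] with z h4 h5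
        rw [← h4.deriv, EventuallyEq.deriv_eq h5]
      have h3 : X.bundle.connectionOrder X.conn.toFun p < 0 := hp
      rw [HolomorphicLineBundle.connectionOrder, meromorphicOrderAt_congr h2] at h3
      exact not_lt.2 hG.deriv.meromorphicOrderAt_nonneg h3
    · filter_upwards [hσp, nhdsWithin_le_nhds hinv] with z h1 h2
      rw [h1, h2]
  choose g hg c hc hpart hσp using hloc
  -- Zero off the poles and nonzero at them, so that the punctures are exactly the poles of the
  -- connection.
  set part : ∀ p : S, PrincipalParts p := fun p =>
    if hp : p ∈ X.conn.poles then principalPart p (g p hp) (hg p hp) else 0 with hpart_def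
  have hpart_of_mem : ∀ p (hp : p ∈ X.conn.poles),
      part p = principalPart p (g p hp) (hg p hp) := fun p hp => dif_pos hp
  have hsupp : {p : S | part p ≠ 0} = X.conn.poles := by
    ext p
    by_cases hp : p ∈ X.conn.poles
    · refine iff_of_true ?_ hp
      change part p ≠ 0
      rw [hpart_of_mem p hp]
      exact hpart p hp
    · exact iff_of_false (fun h => h (dif_neg hp)) hp
  refine ⟨⟨part, hsupp ▸ X.conn.finite_poles⟩, fun D => D.nonempty_iso_pair hσ hsupp.symm ?_⟩
  intro p hp
  have hp' : p ∈ X.conn.poles := hsupp ▸ hp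
  exact ⟨g p hp', hg p hp', c p hp', hc p hp', (hpart_of_mem p hp').symm, hσp p hp'⟩

end Surjectivity

end ExpAlg

end

/-- Let `S` be a compact (connected) Riemann surface. For every exp-algebraic structure `H` on `S`
the pair `(L_H, ∇_H)` consists of a line bundle of degree zero and a meromorphic connection with
all poles of order at least two, zero residues and trivial monodromy; its poles are the punctures
of `H`, and its isomorphism class does not depend on the local data used to build it. The
assignment `H ↦ (L_H, ∇_H)` is a bijection between exp-algebraic structures on `S` and isomorphism
classes of such pairs. -/
theorem proposition3p2 {S : Type*} [TopologicalSpace S] [T2Space S] [CompactSpace S]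
    [ConnectedSpace S] [ChartedSpace ℂ S] [IsManifold 𝓘(ℂ) ω S] :
    (∀ (H : ExpAlg.ExpAlgStructure S) (D : H.LocalData),
      D.pair.Admissible ∧ D.pair.conn.poles = H.punctures ∧
        D.pair.isoClass = H.toIsoClass) ∧
    Set.BijOn (fun H : ExpAlg.ExpAlgStructure S => H.toIsoClass) Set.univ
      {c : ExpAlg.LineBundleWithConnection.IsoClass S |
        ∃ X : ExpAlg.LineBundleWithConnection S, X.Admissible ∧ X.isoClass = c} := by
  refine ⟨fun H D => ⟨D.admissible_pair, D.poles_pair,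
    Quotient.sound (D.nonempty_iso_pair_pair _)⟩, ?_, ?_, ?_⟩
  · intro H _
    exact ⟨_, (Classical.arbitrary H.LocalData).admissible_pair, rfl⟩
  · intro H _ H' _ h
    obtain ⟨e⟩ := Quotient.exact h
    exact ExpAlg.ExpAlgStructure.eq_of_iso _ _ e
  · rintro _ ⟨X, hX, rfl⟩
    obtain ⟨H, hH⟩ := hX.exists_nonempty_iso
    exact ⟨H, mem_univ H, Quotient.sound (hH _)⟩
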